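/- Let $\Lambda<0$ and $v_{\mathcal I}=\sqrt{-3/\Lambda}\,\pi$. **Parameters.** For small $\varepsilon>0$ let $\rho_\varepsilon,\delta_\varepsilon,\sigma_\varepsilon>0$ be defined by $\varepsilon=\exp(-\exp(\rho_\varepsilon^{-10}))$, $\rho_\varepsilon=\exp(-\exp(\exp(\exp(\exp(\delta_\varepsilon^{-10})))))$, $\delta_\varepsilon=\exp(-\exp(\exp(\sigma_\varepsilon^{-10})))$; put $N_\varepsilon=\lceil\rho_\varepsilon^{-1}\exp(\exp(\delta_\varepsilon^{-15}))\rceil$, $\varepsilon^{(0)}=\varepsilon$, $\varepsilon^{(i+1)}=\exp(-\exp((\varepsilon^{(i)})^{-2}))$ and $v_{\varepsilon,i}=\sqrt{-3/\Lambda}\,\frac{\pi}{2}+\rho_\varepsilon^{-1}\sum_{j<i}\varepsilon^{(j)}(-\Lambda)^{-1/2}$. Given a small $\varepsilon_1>0$, for $\varepsilon\in[\varepsilon_1,1]$ one sets $\sigma_\varepsilon=\sigma_{\varepsilon_1}$. **Initial data.** An asymptotically AdS initial data set $(r,\Omega^2,\bar f)$ on $u=0$ consists of smooth functions $r,\Omega^2$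 on $[0,v_{\mathcal I})$, positive on $(0,v_{\mathcal I})$, and a smooth $\bar f(v;p,l)\ge0$ on $(0,v_{\mathcal I})\times[0,\infty)^2$, such that $\partial_v(\Omega^{-2}\partial_vr)=-4\pi rT_{vv}\Omega^{-2}$; $r(0)=0$, $\Omega^2(0)>0$; $1/r$ and $\Omega^2/r^2$ extend smoothly to $v=v_{\mathcal I}$ with $1/r=0$, $\partial_v(1/r)<0$ and $\Omega^2/r^2>0$ there; and for all $p,l\ge0$, $\bar f(v;\Omega^{-2}(v)p,l)$ extends smoothly to $v=v_{\mathcal I}$. Here, with $q=l^2/(\Omega^2r^2p)$, $$(T_{uu},T_{uv},T_{vv})=\tfrac{\pi}{2}r^{-2}\int_0^\infty\!\!\int_0^\infty\big((\Omega^2q)^2,\;\Omega^2p\,\Omega^2q,\;(\Omega^2p)^2\big)\,\bar f\,\tfrac{dp}{p}\,l\,dl .$$ Its renormalised Hawking mass is $\tilde m=\frac r2(1+4\Omega^{-2}\,\partial_ur\,\partial_vr)-\frac16\Lambda r^3$, where $\partial_ur:=\frac1{2r}\int_0^v\big(-\frac12(1-\Lambda r^2)\Omega^2+8\pi r^2T_{uv}\big)d\bar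 v$. A gauge transformation is a smooth $V:[0,v_{\mathcal I}]\to[0,v_{\mathcal I}]$ with $V'>0$, $V(0)=0$, $V(v_{\mathcal I})=v_{\mathcal I}$; it sends $(r,\Omega^2,\bar f)$ to $(r',\Omega'^2,\bar f')$ with $r'(V(v))=r(v)$, $\Omega'^2(V(v))=\frac{\Omega^2(v)}{V'(0)V'(v)}$, $\bar f'(V(v);V'(0)p,l)=\bar f(v;p,l)$. A data set is gauge normalised if $\frac{\partial_vr}{1-\frac13\Lambda r^2}=\frac{\Omega^2}{4\partial_vr}$ on $(0,v_{\mathcal I})$. **The norm.** On AdS let $r_{AdS}(u,v)=\sqrt{-3/\Lambda}\tan(\frac12\sqrt{-\Lambda/3}(v-u))$ and $\Omega^2_{AdS}=1-\frac13\Lambda r_{AdS}^2$, for $u<v<u+v_{\mathcal I}$. For a data set $\mathcal S$ let $\bar f'$ be the Vlasov component of its gauge normalised form, and let $f^{(AdS)}$ be the free massless Vlasov field on AdS that equals $\bar f'$ at $u=0$ and is constant along null geodesics extended through reflections at conformal infinity $\{v=u+v_{\mathcal I}\}$ (at a reflection the limits of $\Omega^2p^u$ and $\Omega^2p^v$ are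 interchanged). With $T_{\alpha\beta}$ formed from $f^{(AdS)}$, $r_{AdS}$, $\Omega^2_{AdS}$ and with $r=r_{AdS}$, $$\|\mathcal S\|=\sup_{U\ge0}\int_U^{U+v_{\mathcal I}}\Big(\frac{rT_{vv}}{\partial_vr}+\frac{rT_{uv}}{-\partial_ur}\Big)(U,v)\,dv+\sup_{V\ge0}\int_{\max\{0,V-v_{\mathcal I}\}}^{V}\Big(\frac{rT_{uu}}{-\partial_ur}+\frac{rT_{uv}}{\partial_vr}\Big)(u,V)\,du+\sqrt{-\Lambda}\,\lim_{v\to v_{\mathcal I}}\tilde m(v),$$ $\tilde m$ being the renormalised Hawking mass of $\mathcal S$. **The family.** Let $\chi:\mathbb R\to[0,1]$ be smooth, $\chi=1$ on $[-1,1]$, $\chi=0$ outside $(-2,2)$, and let $$F_i^{(\varepsilon)}(v;p,l)=\frac1{(\varepsilon^{(i)})^2}\,\chi\Big(\frac{\sqrt{-\Lambda}(v-v_{\varepsilon,i})}{\varepsilon^{(i)}}\Big)\chi(p-3)\,\chi\Big(\frac{\sqrt{-\Lambda}\,l}{\varepsilon^{(i)}}-4\Big).$$ For $\varepsilon\in(0,\varepsilon_1]$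 let $a_{\varepsilon i}\in(0,\sigma_\varepsilon)$, $0\le i\le N_\varepsilon$, with $\sum_ia_{\varepsilon i}\le\rho_\varepsilon^{-1}\sigma_\varepsilon$, and let $\mathcal S^{(\varepsilon)}$ be an initial data set obtained by some gauge transformation (for instance one making it compatible with a smooth development at the axis and at infinity) from a gauge normalised asymptotically AdS initial data set $(r',\Omega'^2,\bar f')$ with $\bar f'(v;p,l)=\sum_{i=0}^{N_\varepsilon}a_{\varepsilon i}F_i^{(\varepsilon)}(v;\partial_vr'(v)\,p,\,l)$. For $\varepsilon\in(\varepsilon_1,1]$ put $\mathcal S^{(\varepsilon)}=\mathcal S^{(\varepsilon_1)}$. **Statement.** There are $\varepsilon_0\in(0,1)$ and $C>0$ (depending only on $\Lambda$) such that, for every $\varepsilon_1\in(0,\varepsilon_0]$ and every $\chi$, $(a_{\varepsilon i})$ and $(\mathcal S^{(\varepsilon)})_{\varepsilon\in(0,1]}$ as above, the norms $\|\mathcal S^{(\varepsilon)}\|$ are well defined and finite, and $$\|\mathcal S^{(\varepsilon)}\|\le C\sigma_\varepsilon\quad\text{for all }\varepsilon\in(0,1),\qquad \lim_{\varepsilon\to0}\|\mathcal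 S^{(\varepsilon)}\|=0 .$$ -/

import Mathlib

open Real Set Filter Topology MeasureTheory
open scoped ENNReal ContDiff

noncomputable section

namespace AdSVlasov

/-! ### The hierarchy of parameters

`rho`, `delta`, `sigma` are the explicit solutions of the implicit relations
`ε = exp (-exp (ρ⁻¹⁰))`, `ρ = exp (-exp (exp (exp (exp (δ⁻¹⁰)))))`, `δ = exp (-exp (exp (σ⁻¹⁰)))`;
see `eps_eq`, `rho_eq`, `delta_eq` below. -/

def rho (ε : ℝ) : ℝ := (log (-log ε)) ^ (-(1 / 10) : ℝ)

def delta (ε : ℝ) : ℝ := (log (log (log (log (-log (rho ε)))))) ^ (-(1 / 10) : ℝ)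

def sigma (ε : ℝ) : ℝ := (log (log (-log (delta ε)))) ^ (-(1 / 10) : ℝ)

theorem rpow_neg_tenth_zpow {x : ℝ} (hx : 0 < x) :
    (x ^ (-(1 / 10) : ℝ)) ^ (-10 : ℤ) = x := by
  rw [← Real.rpow_intCast, ← Real.rpow_mul hx.le]
  norm_num

theorem eps_eq {ε : ℝ} (h0 : 0 < ε) (h : ε < exp (-1)) :
    ε = exp (-exp ((rho ε) ^ (-10 : ℤ))) := by
  have h1 : 1 < -log ε := by
    have := (Real.log_lt_iff_lt_exp h0).2 h
    linarith
  rw [rho, rpow_neg_tenth_zpow (Real.log_pos h1), Real.exp_log (by linarith), neg_neg,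
    Real.exp_log h0]

theorem rho_eq {ε : ℝ} (h0 : 0 < rho ε) (h : rho ε < exp (-exp (exp (exp 1)))) :
    rho ε = exp (-exp (exp (exp (exp ((delta ε) ^ (-10 : ℤ)))))) := by
  have h1 : exp (exp (exp 1)) < -log (rho ε) := by
    have := (Real.log_lt_iff_lt_exp h0).2 h
    linarith
  have h1' := (Real.exp_pos _).trans h1
  have h2 : exp (exp 1) < log (-log (rho ε)) := (Real.lt_log_iff_exp_lt h1').2 h1
  have h2' := (Real.exp_pos _).trans h2
  have h3 : exp 1 < log (log (-log (rho ε))) := (Real.lt_log_iff_exp_lt h2').2 h2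
  have h3' := (Real.exp_pos _).trans h3
  have h4 : 1 < log (log (log (-log (rho ε)))) := (Real.lt_log_iff_exp_lt h3').2 h3
  rw [delta, rpow_neg_tenth_zpow (Real.log_pos h4), Real.exp_log (by linarith), Real.exp_log h3',
    Real.exp_log h2', Real.exp_log h1', neg_neg, Real.exp_log h0]

theorem delta_eq {ε : ℝ} (h0 : 0 < delta ε) (h : delta ε < exp (-exp 1)) :
    delta ε = exp (-exp (exp ((sigma ε) ^ (-10 : ℤ)))) := by
  have h1 : exp 1 < -log (delta ε) := by
    have := (Real.log_lt_iff_lt_exp h0).2 h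
    linarith
  have h1' := (Real.exp_pos _).trans h1
  have h2 : 1 < log (-log (delta ε)) := (Real.lt_log_iff_exp_lt h1').2 h1
  rw [sigma, rpow_neg_tenth_zpow (Real.log_pos h2), Real.exp_log (by linarith),
    Real.exp_log h1', neg_neg, Real.exp_log h0]

/-- The parameter `σ_ε` on all of `(0, 1]`: it is frozen at its value at `ε₁` for `ε ≥ ε₁`. -/
def sigmaTrunc (ε₁ ε : ℝ) : ℝ := sigma (min ε ε₁)

/-- `N_ε`; there are `N_ε + 1` beams. -/
def numBeams (ε : ℝ) : ℕ := ⌈(rho ε)⁻¹ * exp (exp ((delta ε) ^ (-15 : ℤ)))⌉₊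

/-- The beam scales `ε^{(i)}`. -/
def epsSeq (ε : ℝ) : ℕ → ℝ
  | 0 => ε
  | i + 1 => exp (-exp ((epsSeq ε i) ^ (-2 : ℤ)))

/-! ### Seed functions -/

/-- The value `√(-3/Λ) π` of `v` at conformal infinity on the initial slice. -/
def vInf (Λ : ℝ) : ℝ := √(-3 / Λ) * π

structure IsCutoff (χ : ℝ → ℝ) : Prop where
  smooth : ContDiff ℝ ∞ χ
  mem_Icc : ∀ x, χ x ∈ Icc (0 : ℝ) 1
  eq_one : ∀ x ∈ Icc (-1 : ℝ) 1, χ x = 1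
  eq_zero : ∀ x, x ∉ Ioo (-2 : ℝ) 2 → χ x = 0

/-- The centres `v_{ε,i}` of the beams. -/
def center (Λ ε : ℝ) (i : ℕ) : ℝ :=
  √(-3 / Λ) * (π / 2) + (rho ε)⁻¹ * ∑ j ∈ Finset.range i, epsSeq ε j * (√(-Λ))⁻¹

/-- The seed functions `F_i^{(ε)}(v; p, l)`. -/
def seed (Λ : ℝ) (χ : ℝ → ℝ) (ε : ℝ) (i : ℕ) (v p l : ℝ) : ℝ :=
  1 / (epsSeq ε i) ^ 2 * χ (√(-Λ) * (v - center Λ ε i) / epsSeq ε i) * χ (p - 3) *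
    χ (√(-Λ) * l / epsSeq ε i - 4)

/-- `F^{(ε)} = ∑_i a_{εi} F_i^{(ε)}`. -/
def totalSeed (Λ : ℝ) (χ : ℝ → ℝ) (a : ℕ → ℝ) (ε v p l : ℝ) : ℝ :=
  ∑ i ∈ Finset.range (numBeams ε + 1), a i * seed Λ χ ε i v p l

/-! ### Characteristic initial data on `u = 0`, `0 ≤ v < √(-3/Λ) π` -/

/-- The triplet `(r, Ω², f)`; only the values for `0 ≤ v < √(-3/Λ) π` and `p, l ≥ 0` matter. The
function `f v p l` is the density of the Vlasov field with respect to the null shell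
`Ω² p^u p^v = l² / r²`, at momentum `p^u = p` and angular momentum `l`. -/
structure InitialData where
  r : ℝ → ℝ
  Ω2 : ℝ → ℝ
  f : ℝ → ℝ → ℝ → ℝ

namespace InitialData

/-- `T_vv` on the initial slice. -/
def Tvv (S : InitialData) (v : ℝ) : ℝ :=
  π / 2 * ((S.r v) ^ 2)⁻¹ *
    ∫ l in Ioi (0 : ℝ), ∫ p in Ioi (0 : ℝ), (S.Ω2 v * p) ^ 2 * S.f v p l * p⁻¹ * l

/-- `T_uv` on the initial slice; here `Ω² p^v = l² / (r² p^u)`. -/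
def Tuv (S : InitialData) (v : ℝ) : ℝ :=
  π / 2 * ((S.r v) ^ 2)⁻¹ *
    ∫ l in Ioi (0 : ℝ), ∫ p in Ioi (0 : ℝ),
      (S.Ω2 v * p) * (l ^ 2 / ((S.r v) ^ 2 * p)) * S.f v p l * p⁻¹ * l

/-- `∂_u r` on the initial slice, obtained by integrating
`∂_u ∂_v (r²) = -(1 - Λ r²) Ω² / 2 + 8 π r² T_uv` from the axis. -/
def dur (Λ : ℝ) (S : InitialData) (v : ℝ) : ℝ :=
  1 / (2 * S.r v) *
    ∫ w in (0 : ℝ)..v, (-(1 / 2) * (1 - Λ * (S.r w) ^ 2) * S.Ω2 w + 8 * π * (S.r w) ^ 2 * S.Tuv w)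

/-- The Hawking mass `m = r/2 (1 + 4 Ω⁻² ∂_u r ∂_v r)`. -/
def hawkingMass (Λ : ℝ) (S : InitialData) (v : ℝ) : ℝ :=
  S.r v / 2 * (1 + 4 * (S.Ω2 v)⁻¹ * S.dur Λ v * deriv S.r v)

/-- The renormalised Hawking mass `m - Λ r³ / 6`. -/
def renMass (Λ : ℝ) (S : InitialData) (v : ℝ) : ℝ :=
  S.hawkingMass Λ v - 1 / 6 * Λ * (S.r v) ^ 3

/-- Asymptotically AdS initial data sets (in an arbitrary gauge). -/
structure IsAsymptoticallyAdS (Λ : ℝ) (S : InitialData) : Prop where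
  smooth_r : ContDiffOn ℝ ∞ S.r (Ico 0 (vInf Λ))
  smooth_Ω2 : ContDiffOn ℝ ∞ S.Ω2 (Ico 0 (vInf Λ))
  smooth_f : ContDiffOn ℝ ∞ (fun x : ℝ × ℝ × ℝ => S.f x.1 x.2.1 x.2.2)
    (Ioo 0 (vInf Λ) ×ˢ Ici 0 ×ˢ Ici 0)
  r_pos : ∀ v ∈ Ioo 0 (vInf Λ), 0 < S.r v
  Ω2_pos : ∀ v ∈ Ioo 0 (vInf Λ), 0 < S.Ω2 v
  f_nonneg : ∀ v ∈ Ioo 0 (vInf Λ), ∀ p ≥ 0, ∀ l ≥ 0, 0 ≤ S.f v p l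
  /-- the constraint equation `∂_v (Ω⁻² ∂_v r) = -4 π r T_vv Ω⁻²` -/
  constraint : ∀ v ∈ Ioo 0 (vInf Λ),
    deriv (fun w => (S.Ω2 w)⁻¹ * deriv S.r w) v = -4 * π * S.r v * S.Tvv v * (S.Ω2 v)⁻¹
  r_axis : S.r 0 = 0
  Ω2_axis : 0 < S.Ω2 0
  /-- `1/r` extends smoothly to infinity, vanishing there with negative derivative -/
  inv_r_infinity : ∃ g : ℝ → ℝ, ContDiffOn ℝ ∞ g (Ioc 0 (vInf Λ)) ∧
    (∀ v ∈ Ioo 0 (vInf Λ), g v = 1 / S.r v) ∧ g (vInf Λ) = 0 ∧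
    derivWithin g (Ioc 0 (vInf Λ)) (vInf Λ) < 0
  /-- `Ω²/r²` extends smoothly to infinity, with positive value there -/
  Ω2_infinity : ∃ h : ℝ → ℝ, ContDiffOn ℝ ∞ h (Ioc 0 (vInf Λ)) ∧
    (∀ v ∈ Ioo 0 (vInf Λ), h v = S.Ω2 v / (S.r v) ^ 2) ∧ 0 < h (vInf Λ)
  f_infinity : ∀ p ≥ 0, ∀ l ≥ 0, ∃ h : ℝ → ℝ, ContDiffOn ℝ ∞ h (Ioc 0 (vInf Λ)) ∧
    ∀ v ∈ Ioo 0 (vInf Λ), h v = S.f v ((S.Ω2 v)⁻¹ * p) l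

/-- The normalised gauge condition `∂_v r / (1 - Λ r² / 3) = Ω² / (4 ∂_v r)`. -/
def IsGaugeNormalised (Λ : ℝ) (S : InitialData) : Prop :=
  ∀ v ∈ Ioo 0 (vInf Λ),
    deriv S.r v / (1 - 1 / 3 * Λ * (S.r v) ^ 2) = S.Ω2 v / (4 * deriv S.r v)

/-- `S'` is obtained from `S` by the gauge transformation `v ↦ V v` (which fixes the axis and
infinity, so that `dU/du(0) = dV/dv(0)` for the associated transformation `u ↦ U u`). -/
structure IsGaugeTransformation (Λ : ℝ) (V : ℝ → ℝ) (S S' : InitialData) : Prop where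
  smooth : ContDiffOn ℝ ∞ V (Icc 0 (vInf Λ))
  deriv_pos : ∀ v ∈ Icc 0 (vInf Λ), 0 < derivWithin V (Icc 0 (vInf Λ)) v
  map_axis : V 0 = 0
  map_infinity : V (vInf Λ) = vInf Λ
  r_eq : ∀ v ∈ Ico 0 (vInf Λ), S'.r (V v) = S.r v
  Ω2_eq : ∀ v ∈ Ico 0 (vInf Λ), S'.Ω2 (V v) =
    1 / (derivWithin V (Icc 0 (vInf Λ)) 0 * derivWithin V (Icc 0 (vInf Λ)) v) * S.Ω2 v
  f_eq : ∀ v ∈ Ioo 0 (vInf Λ), ∀ p ≥ 0, ∀ l ≥ 0,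
    S'.f (V v) (derivWithin V (Icc 0 (vInf Λ)) 0 * p) l = S.f v p l

end InitialData

/-! ### Free massless Vlasov fields on AdS, with reflection at conformal infinity -/

/-- The AdS area radius in the standard double null coordinates. -/
def rAdS (Λ u v : ℝ) : ℝ := √(-3 / Λ) * tan (1 / 2 * √(-Λ / 3) * (v - u))

def Ω2AdS (Λ u v : ℝ) : ℝ := 1 - 1 / 3 * Λ * (rAdS Λ u v) ^ 2

/-- Position and momentum `(u, v, p^u, p^v)` in the reduced phase space. -/
structure PhasePoint where
  u : ℝ
  v : ℝ
  pu : ℝ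
  pv : ℝ

/-- `γ`, on the parameter set `I`, is (the planar reduction of) a future directed, affinely
parametrised null geodesic of AdS with angular momentum `l`. -/
structure IsNullGeodesic (Λ l : ℝ) (γ : ℝ → PhasePoint) (I : Set ℝ) : Prop where
  mem : ∀ s ∈ I, (γ s).u < (γ s).v ∧ (γ s).v < (γ s).u + vInf Λ
  future : ∀ s ∈ I, 0 ≤ (γ s).pu
  shell : ∀ s ∈ I, Ω2AdS Λ (γ s).u (γ s).v * (γ s).pu * (γ s).pv
    = l ^ 2 / (rAdS Λ (γ s).u (γ s).v) ^ 2
  deriv_u : ∀ s ∈ I, HasDerivAt (fun t => (γ t).u) (γ s).pu s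
  deriv_v : ∀ s ∈ I, HasDerivAt (fun t => (γ t).v) (γ s).pv s
  deriv_pu : ∀ s ∈ I, HasDerivAt (fun t => Ω2AdS Λ (γ t).u (γ t).v * (γ t).pu)
    ((deriv (fun v => log (Ω2AdS Λ (γ s).u v)) (γ s).v
      - 2 * deriv (fun v => rAdS Λ (γ s).u v) (γ s).v / rAdS Λ (γ s).u (γ s).v)
      * (l ^ 2 / (rAdS Λ (γ s).u (γ s).v) ^ 2)) s
  deriv_pv : ∀ s ∈ I, HasDerivAt (fun t => Ω2AdS Λ (γ t).u (γ t).v * (γ t).pv)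
    ((deriv (fun u => log (Ω2AdS Λ u (γ s).v)) (γ s).u
      - 2 * deriv (fun u => rAdS Λ u (γ s).v) (γ s).u / rAdS Λ (γ s).u (γ s).v)
      * (l ^ 2 / (rAdS Λ (γ s).u (γ s).v) ^ 2)) s

/-- `γ'` (on `(-∞, b)`) is the reflection of `γ` (on `(a, ∞)`) off conformal infinity: both end at
the same point of infinity, where the momentum component normal to infinity changes sign, i.e. the
limits of `Ω² p^u` and `Ω² p^v` are interchanged. -/
structure IsReflection (Λ l : ℝ) (γ γ' : ℝ → PhasePoint) (a b : ℝ) : Prop where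
  incoming : IsNullGeodesic Λ l γ (Ioi a)
  outgoing : IsNullGeodesic Λ l γ' (Iio b)
  endpoint : ∃ u₀ : ℝ,
    Tendsto (fun s => (γ s).u) atTop (𝓝 u₀) ∧ Tendsto (fun s => (γ s).v) atTop (𝓝 (u₀ + vInf Λ)) ∧
    Tendsto (fun s => (γ' s).u) atBot (𝓝 u₀) ∧ Tendsto (fun s => (γ' s).v) atBot (𝓝 (u₀ + vInf Λ))
  momentum : ∃ A B : ℝ,
    Tendsto (fun s => Ω2AdS Λ (γ s).u (γ s).v * (γ s).pu) atTop (𝓝 A) ∧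
    Tendsto (fun s => Ω2AdS Λ (γ s).u (γ s).v * (γ s).pv) atTop (𝓝 B) ∧
    Tendsto (fun s => Ω2AdS Λ (γ' s).u (γ' s).v * (γ' s).pu) atBot (𝓝 B) ∧
    Tendsto (fun s => Ω2AdS Λ (γ' s).u (γ' s).v * (γ' s).pv) atBot (𝓝 A)

/-- `y` lies to the future of `x` along one null geodesic, or along one null geodesic followed by
its reflection. -/
def Step (Λ l : ℝ) (x y : PhasePoint) : Prop :=
  (∃ γ : ℝ → PhasePoint, ∃ a b s t : ℝ, IsNullGeodesic Λ l γ (Ioo a b) ∧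
    a < s ∧ s ≤ t ∧ t < b ∧ γ s = x ∧ γ t = y) ∨
  (∃ γ γ' : ℝ → PhasePoint, ∃ a b s t : ℝ, IsReflection Λ l γ γ' a b ∧
    a < s ∧ t < b ∧ γ s = x ∧ γ' t = y)

/-- `y` lies to the future of `x` along a null geodesic maximally extended through reflections. -/
def Reaches (Λ l : ℝ) : PhasePoint → PhasePoint → Prop := Relation.ReflTransGen (Step Λ l)

/-- The point of the null shell over `(u, v)` with `p^u = p` and angular momentum `l`. -/
def shellPoint (Λ u v p l : ℝ) : PhasePoint :=
  ⟨u, v, p, l ^ 2 / (Ω2AdS Λ u v * (rAdS Λ u v) ^ 2 * p)⟩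

/-- The free massless Vlasov field on AdS with data `f₀` at `u = 0`: it takes at a phase space point
the value of `f₀` at the point of `{u = 0}` which lies on the same null geodesic, maximally
extended through reflections. (There is at most one such point, `u` being strictly increasing
along the geodesic, so the supremum only selects the value at this point.) -/
def freeVlasov (Λ : ℝ) (f₀ : ℝ → ℝ → ℝ → ℝ) (u v p l : ℝ) : ℝ≥0∞ :=
  ⨆ (v₀ : ℝ) (p₀ : ℝ) (_ : v₀ ∈ Ioo 0 (vInf Λ)) (_ : 0 < p₀)
    (_ : Reaches Λ l (shellPoint Λ 0 v₀ p₀ l) (shellPoint Λ u v p l)), ENNReal.ofReal (f₀ v₀ p₀ l)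

/-- `π/2 r⁻² ∫∫ w(Ω² p^u, Ω² p^v) f dp^u/p^u l dl` on AdS; the weights `q²`, `p²` and `p q` give
`T_uu`, `T_vv` and `T_uv`. -/
def TAdS (Λ : ℝ) (w : ℝ → ℝ → ℝ) (f : ℝ → ℝ → ℝ → ℝ → ℝ≥0∞) (u v : ℝ) : ℝ≥0∞ :=
  ENNReal.ofReal (π / 2 * ((rAdS Λ u v) ^ 2)⁻¹) *
    ∫⁻ l in Ioi (0 : ℝ), ∫⁻ p in Ioi (0 : ℝ),
      ENNReal.ofReal (w (Ω2AdS Λ u v * p) (l ^ 2 / ((rAdS Λ u v) ^ 2 * p)) * p⁻¹ * l) * f u v p l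

def TuuAdS (Λ : ℝ) (f : ℝ → ℝ → ℝ → ℝ → ℝ≥0∞) : ℝ → ℝ → ℝ≥0∞ := TAdS Λ (fun _ q => q ^ 2) f

def TvvAdS (Λ : ℝ) (f : ℝ → ℝ → ℝ → ℝ → ℝ≥0∞) : ℝ → ℝ → ℝ≥0∞ := TAdS Λ (fun p _ => p ^ 2) f

def TuvAdS (Λ : ℝ) (f : ℝ → ℝ → ℝ → ℝ → ℝ≥0∞) : ℝ → ℝ → ℝ≥0∞ := TAdS Λ (fun p q => p * q) f

/-- `r / ∂_v r` on AdS. -/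
def rOverDvr (Λ u v : ℝ) : ℝ := rAdS Λ u v / deriv (fun w => rAdS Λ u w) v

/-- `r / (-∂_u r)` on AdS. -/
def rOverDur (Λ u v : ℝ) : ℝ := rAdS Λ u v / (-deriv (fun w => rAdS Λ w v) u)

/-! ### The initial data norm -/

/-- The contribution of the slices `{u = U}`, `U ≥ 0`. -/
def outgoingPart (Λ : ℝ) (f : ℝ → ℝ → ℝ → ℝ → ℝ≥0∞) : ℝ≥0∞ :=
  ⨆ (U : ℝ) (_ : 0 ≤ U), ∫⁻ v in Ioo U (U + vInf Λ),
    (ENNReal.ofReal (rOverDvr Λ U v) * TvvAdS Λ f U v +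
      ENNReal.ofReal (rOverDur Λ U v) * TuvAdS Λ f U v)

/-- The contribution of the slices `{v = V}`, `V ≥ 0`. -/
def ingoingPart (Λ : ℝ) (f : ℝ → ℝ → ℝ → ℝ → ℝ≥0∞) : ℝ≥0∞ :=
  ⨆ (V : ℝ) (_ : 0 ≤ V), ∫⁻ u in Ioo (max 0 (V - vInf Λ)) V,
    (ENNReal.ofReal (rOverDur Λ u V) * TuuAdS Λ f u V +
      ENNReal.ofReal (rOverDvr Λ u V) * TuvAdS Λ f u V)

/-- `x` is the norm `‖S‖`: with `S'` the gauge normalised form of `S`, with the free Vlasov field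
on AdS launched by the Vlasov part of `S'`, and with `M` the renormalised Hawking mass of `S` at
infinity, `x` is the sum of the two suprema and of `√(-Λ) M`. -/
def IsInitialDataNorm (Λ : ℝ) (S : InitialData) (x : EReal) : Prop :=
  ∃ (V : ℝ → ℝ) (S' : InitialData) (M : ℝ),
    S.IsGaugeTransformation Λ V S' ∧ S'.IsGaugeNormalised Λ ∧
    Tendsto (S.renMass Λ) (𝓝[<] (vInf Λ)) (𝓝 M) ∧
    x = ((outgoingPart Λ (freeVlasov Λ S'.f) + ingoingPart Λ (freeVlasov Λ S'.f) : ℝ≥0∞) : EReal)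
      + ((√(-Λ) * M : ℝ) : EReal)

/-! ### The initial data family -/

/-- Admissible beam weights `a_{εi}`. -/
structure IsWeightFamily (ε₁ : ℝ) (a : ℝ → ℕ → ℝ) : Prop where
  mem : ∀ ε ∈ Ioc 0 ε₁, ∀ i ≤ numBeams ε, a ε i ∈ Ioo 0 (sigma ε)
  sum_le : ∀ ε ∈ Ioc 0 ε₁, ∑ i ∈ Finset.range (numBeams ε + 1), a ε i ≤ (rho ε)⁻¹ * sigma ε

/-- For `ε ≤ ε₁`, `𝒮 ε` is obtained by a gauge transformation from a gauge normalised,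
asymptotically AdS initial data set `S'` whose Vlasov part is `F^{(ε)}(v; ∂_v r' p, l)`. Any gauge
transformation is allowed here, in particular one for which `𝒮 ε` is compatible with a smooth
development at the axis and at infinity. For `ε₁ < ε ≤ 1` the family is constant. -/
structure IsInitialDataFamily (Λ ε₁ : ℝ) (χ : ℝ → ℝ) (a : ℝ → ℕ → ℝ) (𝒮 : ℝ → InitialData) :
    Prop where
  small : ∀ ε ∈ Ioc 0 ε₁, ∃ (W : ℝ → ℝ) (S' : InitialData),
    S'.IsAsymptoticallyAdS Λ ∧ S'.IsGaugeNormalised Λ ∧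
    (∀ v ∈ Ioo 0 (vInf Λ), ∀ p ≥ 0, ∀ l ≥ 0,
      S'.f v p l = totalSeed Λ χ (a ε) ε v (deriv S'.r v * p) l) ∧
    S'.IsGaugeTransformation Λ W (𝒮 ε)
  large : ∀ ε ∈ Ioc ε₁ 1, 𝒮 ε = 𝒮 ε₁

end AdSVlasov

end

noncomputable section

namespace AdSVlasov

/-! ### Asymptotics of the parameters -/

/-! Write `Λ = -3 k²`, `X = k (v - u) / 2`, `T = k (u + v) / 2`. Along a null geodesic of AdS the
energy `E = Ω² (p^u + p^v)` is conserved, and so is a phase vector (`phaseCos`, `phaseSin`), because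
AdS is a hyperboloid whose null geodesics are straight lines of the ambient space. Reflection at
infinity only reverses the sign of the phase vector (`Reaches.sameOrbit`). A beam of width and
angular momentum of order `e`, launched inwards from the middle of the slice with phase `θ`,
therefore satisfies for all time, up to errors `O(e E)`, the relations `E |sin (k u - θ)| = 2 Ω² p^u
sin X cos X` and `E |sin (k v - θ)| = 2 Ω² p^v sin X cos X` (`InBeam`, `inBeam_of_reaches`).
Together with the shell relation `Ω² p^u · Ω² p^v · sin² X = (k l)²` they bound the contribution of
a beam of weight `a` to a null slice at phase distance `φ` by a constant times `a min (1, e / |sin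
φ|)` (`lintegral_profile_le`, `outgoingPart_le`, `ingoingPart_le`).

The phases of two beams differ by at least `ρ⁻¹ / 2` times the larger of the two widths. Hence a
given slice is close to at most one beam, which contributes `O(σ)` since its weight is below `σ`;
all others are damped by a factor `O(ρ)`, which compensates for `∑ a ≤ ρ⁻¹ σ` (`sum_weights_le`).
Both suprema are thus `O(σ)`, whatever the number of beams.

It remains to control the data themselves. In the normalised gauge `q = 2 Ω⁻² ∂_v r` is constant off
the beams, and `(2/k) arctan (k r)` has derivative `1/q`. The source has size `O(ρ⁻¹ σ)` on an
interval of length `O(ρ⁻¹ ε)`, and `ρ⁻² ε` is small; so `q` stays in `[1/2, 2]`, `∂_v r` is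
comparable to `1` on the beams, and the launched momenta are of order one (`RadialSystem.q_mem`,
`RadialSystem.deriv_r_mem`). The same product bounds the renormalised mass by a multiple of `σ`
(`exists_mass`). The mass is gauge invariant and the normalised form is unique, so the norm is well
defined (`isInitialDataNorm_iff`), and `σ → 0` gives the limit. -/

theorem tendsto_rpow_neg_tenth {α : Type*} {l : Filter α} {g : α → ℝ} (hg : Tendsto g l atTop) :
    Tendsto (fun x => (g x) ^ (-(1 / 10) : ℝ)) l (𝓝[>] 0) := by
  refine tendsto_nhdsWithin_iff.2 ⟨(tendsto_rpow_neg_atTop (by norm_num)).comp hg, ?_⟩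
  filter_upwards [hg.eventually_gt_atTop 0] with x hx
  exact Real.rpow_pos_of_pos hx _

theorem tendsto_neg_log_nhdsGT {α : Type*} {l : Filter α} {g : α → ℝ}
    (hg : Tendsto g l (𝓝[>] 0)) : Tendsto (fun x => -log (g x)) l atTop :=
  tendsto_neg_atBot_atTop.comp (Real.tendsto_log_nhdsGT_zero.comp hg)

theorem tendsto_rho : Tendsto rho (𝓝[>] 0) (𝓝[>] 0) :=
  tendsto_rpow_neg_tenth (Real.tendsto_log_atTop.comp (tendsto_neg_log_nhdsGT tendsto_id))

theorem tendsto_delta : Tendsto delta (𝓝[>] 0) (𝓝[>] 0) :=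
  tendsto_rpow_neg_tenth (Real.tendsto_log_atTop.comp (Real.tendsto_log_atTop.comp
    (Real.tendsto_log_atTop.comp (Real.tendsto_log_atTop.comp
      (tendsto_neg_log_nhdsGT tendsto_rho)))))

theorem tendsto_sigma : Tendsto sigma (𝓝[>] 0) (𝓝[>] 0) :=
  tendsto_rpow_neg_tenth (Real.tendsto_log_atTop.comp (Real.tendsto_log_atTop.comp
    (tendsto_neg_log_nhdsGT tendsto_delta)))

/-- The beams occupy an interval of length `O(ρ⁻¹ ε)` and carry total weight at most `ρ⁻¹ σ`, so the
mass and the distortion of the geometry are governed by `ρ⁻² ε`. With `L = -log ε`, `ρ⁻¹ = (log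
L)^(1/10) ≤ L`, and `L² e^{-L} → 0`. -/
theorem tendsto_rho_inv_sq_mul : Tendsto (fun ε => ((rho ε)⁻¹) ^ 2 * ε) (𝓝[>] 0) (𝓝 0) := by
  have hL : Tendsto (fun ε : ℝ => -log ε) (𝓝[>] 0) atTop := tendsto_neg_log_nhdsGT tendsto_id
  have h1 : Tendsto (fun ε : ℝ => (-log ε) ^ 2 * exp (-(-log ε))) (𝓝[>] 0) (𝓝 0) :=
    (Real.tendsto_pow_mul_exp_neg_atTop_nhds_zero 2).comp hL
  refine squeeze_zero' ?_ ?_ h1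
  · filter_upwards [self_mem_nhdsWithin] with ε hε
    exact mul_nonneg (sq_nonneg _) (le_of_lt hε)
  · filter_upwards [self_mem_nhdsWithin, hL.eventually_gt_atTop 1,
      (Real.tendsto_log_atTop.comp hL).eventually_ge_atTop 1] with ε hε h1 h2
    simp only [Function.comp] at h2
    rw [neg_neg, Real.exp_log hε]
    have h3 : (rho ε)⁻¹ ≤ -log ε := by
      rw [rho, ← Real.rpow_neg (by linarith)]
      calc (log (-log ε)) ^ (-(-(1 / 10)) : ℝ) ≤ (log (-log ε)) ^ (1 : ℝ) :=
            Real.rpow_le_rpow_of_exponent_le h2 (by norm_num)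
        _ = log (-log ε) := Real.rpow_one _
        _ ≤ -log ε := (Real.log_le_sub_one_of_pos (by linarith)).trans (by linarith)
    have h4 : 0 ≤ (rho ε)⁻¹ := inv_nonneg.2 (Real.rpow_nonneg (by linarith) _)
    exact mul_le_mul_of_nonneg_right (pow_le_pow_left₀ h4 h3 2) (le_of_lt hε)

/-- The smallness of the parameters that the estimates use. -/
structure Small (κ ε : ℝ) : Prop where
  eps_pos : 0 < ε
  eps_le : ε ≤ 1 / 2
  rho_pos : 0 < rho ε
  rho_le : rho ε ≤ 1
  sigma_pos : 0 < sigma ε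
  sigma_le : sigma ε ≤ 1
  rho_eps : ((rho ε)⁻¹) ^ 2 * ε ≤ κ

theorem exists_small {κ : ℝ} (hκ : 0 < κ) : ∃ ε₀ ∈ Ioo (0 : ℝ) 1, ∀ ε ∈ Ioc 0 ε₀, Small κ ε := by
  have hev : ∀ᶠ ε in 𝓝[>] (0 : ℝ), Small κ ε := by
    have e1 := (tendsto_nhdsWithin_iff.1 tendsto_rho)
    have e2 := (tendsto_nhdsWithin_iff.1 tendsto_sigma)
    filter_upwards [self_mem_nhdsWithin,
      (nhdsWithin_le_nhds : 𝓝[>] (0 : ℝ) ≤ 𝓝 0) (Iic_mem_nhds (show (0 : ℝ) < 1 / 2 by norm_num)),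
      e1.2, e1.1.eventually (Iic_mem_nhds (show (0 : ℝ) < 1 by norm_num)),
      e2.2, e2.1.eventually (Iic_mem_nhds (show (0 : ℝ) < 1 by norm_num)),
      tendsto_rho_inv_sq_mul.eventually (Iic_mem_nhds hκ)] with ε h1 h2 h3 h4 h5 h6 h7
    exact ⟨h1, h2, h3, h4, h5, h6, h7⟩
  obtain ⟨x, hx, hsub⟩ := mem_nhdsGT_iff_exists_Ioc_subset.1 hev
  refine ⟨min x (1 / 2), ⟨lt_min hx (by norm_num), (min_le_right _ _).trans_lt (by norm_num)⟩, ?_⟩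
  intro ε hε
  exact hsub ⟨hε.1, hε.2.trans (min_le_left _ _)⟩

/-! ### Beam scales and centres -/

/-- Of the doubly exponential decay of the beam scales only halving at each stage is used, which
makes their sum geometric. -/
theorem exp_neg_exp_le_half {x : ℝ} (hx : 0 < x) (hx1 : x ≤ 1 / 2) :
    exp (-exp (x ^ (-2 : ℤ))) ≤ x / 2 := by
  have h1 : x ^ (-2 : ℤ) = (x ^ 2)⁻¹ := by rw [zpow_neg]; norm_cast
  have h2 : (x ^ 2)⁻¹ + 1 ≤ exp ((x ^ 2)⁻¹) := Real.add_one_le_exp _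
  have h3 : exp ((x ^ 2)⁻¹) + 1 ≤ exp (exp ((x ^ 2)⁻¹)) := Real.add_one_le_exp _
  rw [h1, Real.exp_neg]
  have h4 : (x ^ 2)⁻¹ ≤ exp (exp ((x ^ 2)⁻¹)) := by linarith
  calc (exp (exp ((x ^ 2)⁻¹)))⁻¹ ≤ ((x ^ 2)⁻¹)⁻¹ := inv_anti₀ (by positivity) h4
    _ = x ^ 2 := inv_inv _
    _ ≤ x / 2 := by nlinarith

theorem epsSeq_pos {ε : ℝ} (h0 : 0 < ε) (i : ℕ) : 0 < epsSeq ε i := by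
  cases i with
  | zero => exact h0
  | succ i => exact Real.exp_pos _

theorem epsSeq_le {ε : ℝ} (h0 : 0 < ε) (h1 : ε ≤ 1 / 2) (i : ℕ) :
    epsSeq ε i ≤ ε * (1 / 2) ^ i := by
  induction i with
  | zero => simp [epsSeq]
  | succ i ih =>
    have h2 : epsSeq ε i ≤ 1 / 2 :=
      ih.trans ((mul_le_of_le_one_right h0.le (pow_le_one₀ (by norm_num) (by norm_num))).trans h1)
    calc epsSeq ε (i + 1) ≤ epsSeq ε i / 2 := exp_neg_exp_le_half (epsSeq_pos h0 i) h2
      _ ≤ ε * (1 / 2) ^ i / 2 := by linarith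
      _ = ε * (1 / 2) ^ (i + 1) := by ring

theorem epsSeq_le_self {ε : ℝ} (h0 : 0 < ε) (h1 : ε ≤ 1 / 2) (i : ℕ) : epsSeq ε i ≤ ε :=
  (epsSeq_le h0 h1 i).trans
    (mul_le_of_le_one_right h0.le (pow_le_one₀ (by norm_num) (by norm_num)))

theorem epsSeq_antitone {ε : ℝ} (h0 : 0 < ε) (h1 : ε ≤ 1 / 2) : Antitone (epsSeq ε) := by
  refine antitone_nat_of_succ_le fun i => ?_
  have h2 := (epsSeq_le_self h0 h1 i).trans h1
  have h3 := epsSeq_pos h0 i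
  exact (exp_neg_exp_le_half h3 h2).trans (by linarith)

theorem sum_epsSeq_le {ε : ℝ} (h0 : 0 < ε) (h1 : ε ≤ 1 / 2) (s : Finset ℕ) :
    ∑ j ∈ s, epsSeq ε j ≤ 2 * ε := by
  calc ∑ j ∈ s, epsSeq ε j ≤ ∑ j ∈ s, ε * (1 / 2) ^ j :=
        Finset.sum_le_sum fun j _ => epsSeq_le h0 h1 j
    _ = ε * ∑ j ∈ s, (1 / 2 : ℝ) ^ j := by rw [Finset.mul_sum]
    _ ≤ ε * 2 := by
        refine mul_le_mul_of_nonneg_left ?_ h0.le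
        refine (summable_geometric_two.sum_le_tsum s fun _ _ => by positivity).trans ?_
        rw [tsum_geometric_two]
    _ = 2 * ε := by ring

section AdSScale

variable {k : ℝ}

theorem sqrt_neg_div_three (hk : 0 < k) : √(-(-3 * k ^ 2) / 3) = k := by
  rw [show -(-3 * k ^ 2) / 3 = k ^ 2 by ring, Real.sqrt_sq hk.le]

theorem sqrt_neg_three_div (hk : 0 < k) : √(-3 / (-3 * k ^ 2)) = 1 / k := by
  rw [show -3 / (-3 * k ^ 2) = (1 / k) ^ 2 by field_simp, Real.sqrt_sq (by positivity)]

theorem sqrt_neg_Λ (hk : 0 < k) : √(-(-3 * k ^ 2)) = √3 * k := by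
  rw [show -(-3 * k ^ 2) = 3 * k ^ 2 by ring, Real.sqrt_mul (by norm_num), Real.sqrt_sq hk.le]

theorem vInf_eq (hk : 0 < k) : vInf (-3 * k ^ 2) = π / k := by
  rw [vInf, sqrt_neg_three_div hk]; ring

/-- The phase `k v_{ε,i}` of the `i`-th beam. -/
theorem mul_center (hk : 0 < k) (ε : ℝ) (i : ℕ) :
    k * center (-3 * k ^ 2) ε i
      = π / 2 + (rho ε)⁻¹ * (√3)⁻¹ * ∑ j ∈ Finset.range i, epsSeq ε j := by
  have h3 : (0 : ℝ) < √3 := by positivity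
  rw [center, sqrt_neg_three_div hk, sqrt_neg_Λ hk, ← Finset.sum_mul]
  field_simp

theorem one_le_sqrt_three : (1 : ℝ) ≤ √3 := Real.one_le_sqrt.2 (by norm_num)

theorem sqrt_three_le_two : √3 ≤ (2 : ℝ) := by
  rw [Real.sqrt_le_left (by norm_num)]; norm_num

theorem mul_center_mem {κ ε : ℝ} (hk : 0 < k) (hs : Small κ ε) (i : ℕ) :
    k * center (-3 * k ^ 2) ε i ∈ Icc (π / 2) (π / 2 + 2 * (rho ε)⁻¹ * ε) := by
  rw [mul_center hk]
  have hS := sum_epsSeq_le hs.eps_pos hs.eps_le (Finset.range i)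
  have hS0 : 0 ≤ ∑ j ∈ Finset.range i, epsSeq ε j :=
    Finset.sum_nonneg fun j _ => (epsSeq_pos hs.eps_pos j).le
  have hρ : 0 < (rho ε)⁻¹ := inv_pos.2 hs.rho_pos
  have h3 : (√3)⁻¹ ≤ (1 : ℝ) := inv_le_one_of_one_le₀ one_le_sqrt_three
  have h30 : 0 ≤ (√3 : ℝ)⁻¹ := by positivity
  refine ⟨by have := mul_nonneg (mul_nonneg hρ.le h30) hS0; linarith, ?_⟩
  have : (rho ε)⁻¹ * (√3)⁻¹ * ∑ j ∈ Finset.range i, epsSeq ε j ≤ (rho ε)⁻¹ * 1 * (2 * ε) := by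
    gcongr
  linarith

/-- The gap between the two centres contains the term of index `j`, the larger of the two scales,
and `1/√3 ≥ 1/2`. The separation is thus measured in the larger width. -/
theorem mul_center_sub {κ ε : ℝ} (hk : 0 < k) (hs : Small κ ε) {i j : ℕ} (hij : j < i) :
    (rho ε)⁻¹ / 2 * epsSeq ε j ≤
      k * center (-3 * k ^ 2) ε i - k * center (-3 * k ^ 2) ε j := by
  rw [mul_center hk, mul_center hk]
  have h1 : ∑ m ∈ Finset.range j, epsSeq ε m + epsSeq ε j ≤ ∑ m ∈ Finset.range i, epsSeq ε m := by
    rw [← Finset.sum_range_succ]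
    exact Finset.sum_le_sum_of_subset_of_nonneg
      (Finset.range_subset_range.2 hij) fun m _ _ => (epsSeq_pos hs.eps_pos m).le
  have hρ : 0 < (rho ε)⁻¹ := inv_pos.2 hs.rho_pos
  have h3 : (1 / 2 : ℝ) ≤ (√3)⁻¹ := by
    rw [one_div]; exact inv_anti₀ (by positivity) sqrt_three_le_two
  have h4 : (rho ε)⁻¹ * (1 / 2) * epsSeq ε j ≤ (rho ε)⁻¹ * (√3)⁻¹ *
      (∑ m ∈ Finset.range i, epsSeq ε m - ∑ m ∈ Finset.range j, epsSeq ε m) := by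
    have := (epsSeq_pos hs.eps_pos j).le
    gcongr
    linarith
  linarith

end AdSScale

/-- Among the beams at most one is close to a given phase, compared with its own separation
scale; the others are damped by a factor `ρ`. -/
theorem sum_weights_le {κ ε k : ℝ} (hk : 0 < k) (hs : Small κ ε) (hκ : κ ≤ 1 / 4) {n : ℕ}
    {a : ℕ → ℝ} (ha : ∀ i ∈ Finset.range n, a i ∈ Icc 0 (sigma ε))
    (hsum : ∑ i ∈ Finset.range n, a i ≤ (rho ε)⁻¹ * sigma ε) (φ : ℝ) {w : ℕ → ℝ}
    (hw1 : ∀ i, w i ≤ 1)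
    (hw : ∀ i, w i * |sin (φ - k * center (-3 * k ^ 2) ε i)| ≤ epsSeq ε i) :
    ∑ i ∈ Finset.range n, a i * w i ≤ 9 * sigma ε := by
  set b : ℕ → ℝ := fun i => |sin (φ - k * center (-3 * k ^ 2) ε i)| with hb
  set ρ' := (rho ε)⁻¹ with hρ'
  have hρ : 0 < ρ' := inv_pos.2 hs.rho_pos
  have hρ1 : 1 ≤ ρ' := one_le_inv_iff₀.2 ⟨hs.rho_pos, hs.rho_le⟩
  have hsmall : ρ' * ε ≤ 1 / 4 := by
    have h1 := hs.rho_eps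
    have h2 : ρ' * ε ≤ ρ' ^ 2 * ε := by
      have := hs.eps_pos.le
      gcongr
      nlinarith
    linarith
  -- Two phases cannot both be close to `φ`: the sine of their difference is at most `b i + b j` by
  -- the addition formula, and it is bounded below by Jordan's inequality, as all phases lie within
  -- `π / 2` of each other.
  have hpair : ∀ i j, j < i → ρ' / 4 * epsSeq ε j ≤ b i + b j := by
    intro i j hij
    have h1 := mul_center_sub hk hs hij
    have h2 := mul_center_mem hk hs i
    have h3 := mul_center_mem hk hs j
    set θi := k * center (-3 * k ^ 2) ε i
    set θj := k * center (-3 * k ^ 2) ε j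
    have h4 : θi - θj ≤ π / 2 := by
      have := h2.2; have := h3.1; have := pi_gt_three; nlinarith
    have h40 : 0 ≤ θi - θj := by
      have := mul_pos (half_pos hρ) (epsSeq_pos hs.eps_pos j); linarith
    have h5 : 2 / π * (θi - θj) ≤ sin (θi - θj) := Real.mul_le_sin h40 h4
    have h6 : sin (θi - θj) ≤ b i + b j := by
      have e : θi - θj = (φ - θj) - (φ - θi) := by ring
      rw [e, sin_sub]
      have c1 := abs_cos_le_one (φ - θi)
      have c2 := abs_cos_le_one (φ - θj)
      have : |sin (φ - θj) * cos (φ - θi)| ≤ b j := by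
        rw [abs_mul]; exact mul_le_of_le_one_right (abs_nonneg _) c1
      have h' : |cos (φ - θj) * sin (φ - θi)| ≤ b i := by
        rw [abs_mul]; exact mul_le_of_le_one_left (abs_nonneg _) c2
      have := le_abs_self (sin (φ - θj) * cos (φ - θi))
      have := neg_abs_le (cos (φ - θj) * sin (φ - θi))
      linarith
    have h7 : (1 / 2 : ℝ) ≤ 2 / π := by
      rw [div_le_div_iff₀ (by norm_num) pi_pos]; have := pi_le_four; linarith
    have h8 : 1 / 2 * (θi - θj) ≤ 2 / π * (θi - θj) := by gcongr
    linarith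
  have hb0 : ∀ i, 0 ≤ b i := fun i => abs_nonneg _
  -- A beam at distance at least `ρ⁻¹ / 8` in units of its own width has weight at most `8 ρ`, and
  -- `∑ a ≤ ρ⁻¹ σ` absorbs the factor `ρ`.
  have hfar : ∀ i, ρ' / 8 * epsSeq ε i ≤ b i → w i ≤ 8 * rho ε := by
    intro i hi
    by_contra hcon
    push Not at hcon
    have h1 := hw i
    have h2 := epsSeq_pos hs.eps_pos i
    have h3 : 8 * rho ε * (ρ' / 8 * epsSeq ε i) < epsSeq ε i := by
      refine lt_of_lt_of_le ?_ h1
      have : 0 < ρ' / 8 * epsSeq ε i := by positivity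
      calc 8 * rho ε * (ρ' / 8 * epsSeq ε i) < w i * (ρ' / 8 * epsSeq ε i) := by gcongr
        _ ≤ w i * b i := by
          have : 0 < w i := lt_trans (by have := hs.rho_pos; positivity) hcon
          gcongr
    have h4 : 8 * rho ε * (ρ' / 8 * epsSeq ε i) = epsSeq ε i := by
      have := hs.rho_pos.ne'
      rw [hρ']; field_simp
    linarith
  have hσ := hs.sigma_pos
  have hfarsum : ∀ s ⊆ Finset.range n, (∀ i ∈ s, w i ≤ 8 * rho ε) →
      ∑ i ∈ s, a i * w i ≤ 8 * sigma ε := by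
    intro s hsn h
    calc ∑ i ∈ s, a i * w i ≤ ∑ i ∈ s, a i * (8 * rho ε) :=
          Finset.sum_le_sum fun i hi => mul_le_mul_of_nonneg_left (h i hi) (ha i (hsn hi)).1
      _ = (∑ i ∈ s, a i) * (8 * rho ε) := by rw [Finset.sum_mul]
      _ ≤ (ρ' * sigma ε) * (8 * rho ε) := by
          refine mul_le_mul_of_nonneg_right ?_ (by have := hs.rho_pos; positivity)
          exact (Finset.sum_le_sum_of_subset_of_nonneg hsn fun i hi _ => (ha i hi).1).trans hsum
      _ = 8 * sigma ε := by
          have := hs.rho_pos.ne'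
          rw [hρ']; field_simp
  -- If one beam is close, `hpair` makes every other one far. Monotonicity of the scales converts
  -- the gap, measured in the larger width, into the width of the beam in question.
  by_cases hex : ∃ j ∈ Finset.range n, b j < ρ' / 8 * epsSeq ε j
  · obtain ⟨j, hj, hbj⟩ := hex
    rw [← Finset.add_sum_erase _ _ hj]
    have h1 : a j * w j ≤ sigma ε :=
      (mul_le_of_le_one_right (ha j hj).1 (hw1 j)).trans (ha j hj).2
    have h2 : ∑ i ∈ (Finset.range n).erase j, a i * w i ≤ 8 * sigma ε := by
      refine hfarsum _ (Finset.erase_subset _ _) fun i hi => hfar i ?_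
      rcases lt_or_gt_of_ne (Finset.ne_of_mem_erase hi) with hij | hij
      · have h3 := hpair j i hij
        have h4 := epsSeq_antitone hs.eps_pos hs.eps_le hij.le
        nlinarith
      · have h3 := hpair i j hij
        have h4 := epsSeq_antitone hs.eps_pos hs.eps_le hij.le
        nlinarith
    linarith
  · push Not at hex
    have := hfarsum _ subset_rfl fun i hi => hfar i (hex i hi)
    linarith

/-! ### AdS in terms of the angle `X = k (v - u) / 2`, where `Λ = -3 k²` -/

section AdS

variable {k : ℝ}

theorem rAdS_eq (hk : 0 < k) (u v : ℝ) :
    rAdS (-3 * k ^ 2) u v = tan (k * (v - u) / 2) / k := by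
  rw [rAdS, sqrt_neg_three_div hk, sqrt_neg_div_three hk,
    show 1 / 2 * k * (v - u) = k * (v - u) / 2 by ring]
  ring

theorem Ω2AdS_eq (hk : 0 < k) {u v : ℝ} (hc : cos (k * (v - u) / 2) ≠ 0) :
    Ω2AdS (-3 * k ^ 2) u v = 1 / cos (k * (v - u) / 2) ^ 2 := by
  rw [Ω2AdS, rAdS_eq hk, tan_eq_sin_div_cos]
  have := sin_sq_add_cos_sq (k * (v - u) / 2)
  field_simp
  linarith

theorem angle_mem (hk : 0 < k) {u v : ℝ} (h1 : u < v) (h2 : v < u + vInf (-3 * k ^ 2)) :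
    k * (v - u) / 2 ∈ Ioo 0 (π / 2) := by
  rw [vInf_eq hk] at h2
  have h3 : k * (v - u) < k * (π / k) := by gcongr; linarith
  rw [mul_div_cancel₀ _ hk.ne'] at h3
  have h4 : 0 < k * (v - u) := mul_pos hk (by linarith)
  constructor <;> linarith

theorem cos_pos_of_mem {X : ℝ} (hX : X ∈ Ioo 0 (π / 2)) : 0 < cos X :=
  cos_pos_of_mem_Ioo ⟨by linarith [hX.1, pi_pos], hX.2⟩

theorem sin_pos_of_mem {X : ℝ} (hX : X ∈ Ioo 0 (π / 2)) : 0 < sin X :=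
  sin_pos_of_pos_of_lt_pi hX.1 (by linarith [hX.2, pi_pos])

theorem tan_pos_of_mem {X : ℝ} (hX : X ∈ Ioo 0 (π / 2)) : 0 < tan X :=
  tan_pos_of_pos_of_lt_pi_div_two hX.1 hX.2

theorem hasDerivAt_rAdS_v (hk : 0 < k) {u v : ℝ} (hc : cos (k * (v - u) / 2) ≠ 0) :
    HasDerivAt (fun w => rAdS (-3 * k ^ 2) u w) (1 / (2 * cos (k * (v - u) / 2) ^ 2)) v := by
  have h1 : HasDerivAt (fun w : ℝ => k * (w - u) / 2) (k / 2) v := by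
    simpa using (((hasDerivAt_id v).sub_const u).const_mul k).div_const 2
  have h2 := ((hasDerivAt_tan hc).comp v h1).div_const k
  refine (h2.congr_of_eventuallyEq (Eventually.of_forall fun w => rAdS_eq hk u w)).congr_deriv ?_
  field_simp

theorem hasDerivAt_rAdS_u (hk : 0 < k) {u v : ℝ} (hc : cos (k * (v - u) / 2) ≠ 0) :
    HasDerivAt (fun w => rAdS (-3 * k ^ 2) w v) (-(1 / (2 * cos (k * (v - u) / 2) ^ 2))) u := by
  have h1 : HasDerivAt (fun w : ℝ => k * (v - w) / 2) (-k / 2) u := by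
    simpa using (((hasDerivAt_id u).const_sub v).const_mul k).div_const 2
  have h2 := ((hasDerivAt_tan hc).comp u h1).div_const k
  refine (h2.congr_of_eventuallyEq (Eventually.of_forall fun w => rAdS_eq hk w v)).congr_deriv ?_
  field_simp

theorem deriv_log_Ω2AdS_v (hk : 0 < k) {u v : ℝ} (hc : cos (k * (v - u) / 2) ≠ 0) :
    deriv (fun w => log (Ω2AdS (-3 * k ^ 2) u w)) v = k * tan (k * (v - u) / 2) := by
  have h1 := ((hasDerivAt_rAdS_v hk hc).pow 2).const_mul (1 / 3 * (-3 * k ^ 2))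
  have h2 := h1.const_sub 1
  have h3 : HasDerivAt (fun w => Ω2AdS (-3 * k ^ 2) u w) _ v := h2
  have h0 : Ω2AdS (-3 * k ^ 2) u v ≠ 0 := by rw [Ω2AdS_eq hk hc]; positivity
  rw [(h3.log h0).deriv, Ω2AdS_eq hk hc, rAdS_eq hk]
  simp only [Nat.add_one_sub_one, pow_one, Nat.cast_ofNat]
  field_simp

theorem deriv_log_Ω2AdS_u (hk : 0 < k) {u v : ℝ} (hc : cos (k * (v - u) / 2) ≠ 0) :
    deriv (fun w => log (Ω2AdS (-3 * k ^ 2) w v)) u = -(k * tan (k * (v - u) / 2)) := by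
  have h1 := ((hasDerivAt_rAdS_u hk hc).pow 2).const_mul (1 / 3 * (-3 * k ^ 2))
  have h2 := h1.const_sub 1
  have h3 : HasDerivAt (fun w => Ω2AdS (-3 * k ^ 2) w v) _ u := h2
  have h0 : Ω2AdS (-3 * k ^ 2) u v ≠ 0 := by rw [Ω2AdS_eq hk hc]; positivity
  rw [(h3.log h0).deriv, Ω2AdS_eq hk hc, rAdS_eq hk]
  simp only [Nat.add_one_sub_one, pow_one, Nat.cast_ofNat]
  field_simp

theorem rOverDvr_eq (hk : 0 < k) {u v : ℝ} (hc : cos (k * (v - u) / 2) ≠ 0) :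
    rOverDvr (-3 * k ^ 2) u v
      = 2 / k * (sin (k * (v - u) / 2) * cos (k * (v - u) / 2)) := by
  rw [rOverDvr, (hasDerivAt_rAdS_v hk hc).deriv, rAdS_eq hk, tan_eq_sin_div_cos]
  field_simp

theorem rOverDur_eq (hk : 0 < k) {u v : ℝ} (hc : cos (k * (v - u) / 2) ≠ 0) :
    rOverDur (-3 * k ^ 2) u v
      = 2 / k * (sin (k * (v - u) / 2) * cos (k * (v - u) / 2)) := by
  rw [rOverDur, (hasDerivAt_rAdS_u hk hc).deriv, rAdS_eq hk, tan_eq_sin_div_cos]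
  field_simp

end AdS

/-! ### Conserved quantities of null geodesics -/

/-- `Ω² (p^u + p^v)`, the conserved energy. -/
def energy (Λ : ℝ) (x : PhasePoint) : ℝ := Ω2AdS Λ x.u x.v * x.pu + Ω2AdS Λ x.u x.v * x.pv

/-- The cosine component of the (energy weighted) phase of the orbit. -/
def phaseCos (k : ℝ) (x : PhasePoint) : ℝ :=
  energy (-3 * k ^ 2) x * (cos (k * (x.v - x.u) / 2) * cos (k * (x.u + x.v) / 2)) +
    (Ω2AdS (-3 * k ^ 2) x.u x.v * x.pv - Ω2AdS (-3 * k ^ 2) x.u x.v * x.pu) *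
      (sin (k * (x.v - x.u) / 2) * sin (k * (x.u + x.v) / 2))

/-- The sine component of the (energy weighted) phase of the orbit. -/
def phaseSin (k : ℝ) (x : PhasePoint) : ℝ :=
  energy (-3 * k ^ 2) x * (cos (k * (x.v - x.u) / 2) * sin (k * (x.u + x.v) / 2)) -
    (Ω2AdS (-3 * k ^ 2) x.u x.v * x.pv - Ω2AdS (-3 * k ^ 2) x.u x.v * x.pu) *
      (sin (k * (x.v - x.u) / 2) * cos (k * (x.u + x.v) / 2))

/-- The two phase space points have the same energy, and the same phase up to sign. -/
def SameOrbit (k : ℝ) (x y : PhasePoint) : Prop :=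
  energy (-3 * k ^ 2) y = energy (-3 * k ^ 2) x ∧ ∃ s : ℝ, (s = 1 ∨ s = -1) ∧
    phaseCos k y = s * phaseCos k x ∧ phaseSin k y = s * phaseSin k x

theorem SameOrbit.refl (k : ℝ) (x : PhasePoint) : SameOrbit k x x :=
  ⟨rfl, 1, Or.inl rfl, by simp, by simp⟩

theorem SameOrbit.trans {k : ℝ} {x y z : PhasePoint} (h1 : SameOrbit k x y)
    (h2 : SameOrbit k y z) : SameOrbit k x z := by
  obtain ⟨e1, s1, hs1, c1, d1⟩ := h1
  obtain ⟨e2, s2, hs2, c2, d2⟩ := h2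
  refine ⟨e2.trans e1, s2 * s1, ?_, by rw [c2, c1]; ring, by rw [d2, d1]; ring⟩
  rcases hs1 with rfl | rfl <;> rcases hs2 with rfl | rfl <;> norm_num

theorem eqOn_of_hasDerivAt_zero {f : ℝ → ℝ} {I : Set ℝ} (hI : Convex ℝ I) (hO : IsOpen I)
    (h : ∀ s ∈ I, HasDerivAt f 0 s) {s t : ℝ} (hs : s ∈ I) (ht : t ∈ I) : f t = f s := by
  refine hO.is_const_of_deriv_eq_zero hI.isPreconnected
    (fun x hx => (h x hx).differentiableAt.differentiableWithinAt) (fun x hx => (h x hx).deriv)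
    ht hs

section Conservation

variable {k l : ℝ} {γ : ℝ → PhasePoint} {I : Set ℝ}

/-- The two derivatives are opposite, which expresses the time translation symmetry of AdS and
yields conservation of energy. -/
theorem IsNullGeodesic.hasDerivAt_momenta (hk : 0 < k) (hγ : IsNullGeodesic (-3 * k ^ 2) l γ I)
    {s : ℝ} (hs : s ∈ I) :
    HasDerivAt (fun t => Ω2AdS (-3 * k ^ 2) (γ t).u (γ t).v * (γ t).pu)
      (-(k ^ 3 * l ^ 2 * (cos (k * ((γ s).v - (γ s).u) / 2)) ^ 3 /
        (sin (k * ((γ s).v - (γ s).u) / 2)) ^ 3)) s ∧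
    HasDerivAt (fun t => Ω2AdS (-3 * k ^ 2) (γ t).u (γ t).v * (γ t).pv)
      (k ^ 3 * l ^ 2 * (cos (k * ((γ s).v - (γ s).u) / 2)) ^ 3 /
        (sin (k * ((γ s).v - (γ s).u) / 2)) ^ 3) s := by
  have hX := angle_mem hk (hγ.mem s hs).1 (hγ.mem s hs).2
  have hc := cos_pos_of_mem hX
  have hsn := sin_pos_of_mem hX
  have hpy := sin_sq_add_cos_sq (k * ((γ s).v - (γ s).u) / 2)
  have h1 := hγ.deriv_pu s hs
  have h2 := hγ.deriv_pv s hs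
  rw [deriv_log_Ω2AdS_v hk hc.ne', (hasDerivAt_rAdS_v hk hc.ne').deriv, rAdS_eq hk,
    tan_eq_sin_div_cos] at h1
  rw [deriv_log_Ω2AdS_u hk hc.ne', (hasDerivAt_rAdS_u hk hc.ne').deriv, rAdS_eq hk,
    tan_eq_sin_div_cos] at h2
  set c := cos (k * ((γ s).v - (γ s).u) / 2)
  set n := sin (k * ((γ s).v - (γ s).u) / 2)
  have hn2 : n ^ 2 = 1 - c ^ 2 := by linarith
  have hn2' : 1 - c ^ 2 ≠ 0 := by rw [← hn2]; positivity
  constructor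
  · refine h1.congr_deriv ?_
    field_simp
    linear_combination (l ^ 2) * hn2
  · refine h2.congr_deriv ?_
    field_simp
    linear_combination (-l ^ 2) * hn2

theorem IsNullGeodesic.hasDerivAt_energy (hk : 0 < k) (hγ : IsNullGeodesic (-3 * k ^ 2) l γ I)
    {s : ℝ} (hs : s ∈ I) : HasDerivAt (fun t => energy (-3 * k ^ 2) (γ t)) 0 s := by
  have h := hγ.hasDerivAt_momenta hk hs
  exact (h.1.add h.2).congr_deriv (by ring)

/-- The functions `cos T / cos X` and `sin T / cos X` are, up to scale, ambient coordinates of the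
hyperboloid, and along the curve their derivatives are `-(k/2) phaseSin` and `(k/2) phaseCos`. Null
geodesics are ambient straight lines, so these velocities are constant. In the computation the shell
relation is what makes the terms cancel. -/
theorem IsNullGeodesic.hasDerivAt_phase (hk : 0 < k) (hγ : IsNullGeodesic (-3 * k ^ 2) l γ I)
    {s : ℝ} (hs : s ∈ I) :
    HasDerivAt (fun t => phaseCos k (γ t)) 0 s ∧ HasDerivAt (fun t => phaseSin k (γ t)) 0 s := by
  have hX := angle_mem hk (hγ.mem s hs).1 (hγ.mem s hs).2
  have hc := cos_pos_of_mem hX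
  have hsn := sin_pos_of_mem hX
  have hA := hγ.hasDerivAt_momenta hk hs
  have hE := hγ.hasDerivAt_energy hk hs
  have hu := hγ.deriv_u s hs
  have hv := hγ.deriv_v s hs
  have hsh := hγ.shell s hs
  have hX' := ((hv.sub hu).const_mul k).div_const 2
  have hT' := ((hu.add hv).const_mul k).div_const 2
  have hD := hA.2.sub hA.1
  have hcX := hX'.cos
  have hsX := hX'.sin
  have hcT := hT'.cos
  have hsT := hT'.sin
  simp only [Pi.sub_apply, Pi.add_apply] at hcX hsX hcT hsT
  have g1 := (hE.mul (hcX.mul hcT)).add (hD.mul (hsX.mul hsT))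
  have g2 := (hE.mul (hcX.mul hsT)).sub (hD.mul (hsX.mul hcT))
  rw [rAdS_eq hk, tan_eq_sin_div_cos, Ω2AdS_eq hk hc.ne'] at hsh
  simp only [Pi.sub_apply, Pi.mul_apply, energy, Ω2AdS_eq hk hc.ne'] at g1 g2
  set c := cos (k * ((γ s).v - (γ s).u) / 2)
  set n := sin (k * ((γ s).v - (γ s).u) / 2)
  set C := cos (k * ((γ s).u + (γ s).v) / 2)
  set S := sin (k * ((γ s).u + (γ s).v) / 2)
  have hsh' : (γ s).pu * (γ s).pv * n ^ 2 = l ^ 2 * k ^ 2 * c ^ 4 := by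
    field_simp at hsh
    linear_combination hsh
  constructor
  · refine HasDerivAt.congr_deriv g1 ?_
    field_simp
    linear_combination (-4 * S * c * k) * hsh'
  · refine HasDerivAt.congr_deriv g2 ?_
    field_simp
    linear_combination (4 * C * c * k) * hsh'

theorem IsNullGeodesic.sameOrbit (hk : 0 < k) (hγ : IsNullGeodesic (-3 * k ^ 2) l γ I)
    (hI : Convex ℝ I) (hO : IsOpen I) {s t : ℝ} (hs : s ∈ I) (ht : t ∈ I) :
    energy (-3 * k ^ 2) (γ t) = energy (-3 * k ^ 2) (γ s) ∧
      phaseCos k (γ t) = phaseCos k (γ s) ∧ phaseSin k (γ t) = phaseSin k (γ s) :=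
  ⟨eqOn_of_hasDerivAt_zero hI hO (fun _ h => hγ.hasDerivAt_energy hk h) hs ht,
    eqOn_of_hasDerivAt_zero hI hO (fun _ h => (hγ.hasDerivAt_phase hk h).1) hs ht,
    eqOn_of_hasDerivAt_zero hI hO (fun _ h => (hγ.hasDerivAt_phase hk h).2) hs ht⟩

/-- The limits of the conserved quantities along a curve that runs into infinity. -/
theorem tendsto_phase_infinity (hk : 0 < k) {F : Filter ℝ} {u₀ A B : ℝ}
    (hu : Tendsto (fun s => (γ s).u) F (𝓝 u₀))
    (hv : Tendsto (fun s => (γ s).v) F (𝓝 (u₀ + vInf (-3 * k ^ 2))))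
    (hA : Tendsto (fun s => Ω2AdS (-3 * k ^ 2) (γ s).u (γ s).v * (γ s).pu) F (𝓝 A))
    (hB : Tendsto (fun s => Ω2AdS (-3 * k ^ 2) (γ s).u (γ s).v * (γ s).pv) F (𝓝 B)) :
    Tendsto (fun s => energy (-3 * k ^ 2) (γ s)) F (𝓝 (A + B)) ∧
    Tendsto (fun s => phaseCos k (γ s)) F (𝓝 ((B - A) * sin (k * u₀ + π / 2))) ∧
    Tendsto (fun s => phaseSin k (γ s)) F (𝓝 (-((B - A) * cos (k * u₀ + π / 2)))) := by
  have hX := ((hv.sub hu).const_mul k).div_const 2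
  have hT := ((hu.add hv).const_mul k).div_const 2
  rw [vInf_eq hk, show k * (u₀ + π / k - u₀) / 2 = π / 2 by field_simp; ring] at hX
  rw [vInf_eq hk, show k * (u₀ + (u₀ + π / k)) / 2 = k * u₀ + π / 2 by field_simp; ring] at hT
  have hcX := (continuous_cos.tendsto _).comp hX
  have hsX := (continuous_sin.tendsto _).comp hX
  have hcT := (continuous_cos.tendsto _).comp hT
  have hsT := (continuous_sin.tendsto _).comp hT
  rw [cos_pi_div_two] at hcX
  rw [sin_pi_div_two] at hsX
  have hE := hA.add hB
  have hD := hB.sub hA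
  refine ⟨hE, ?_, ?_⟩
  · have := (hE.mul (hcX.mul hcT)).add (hD.mul (hsX.mul hsT))
    simp only [zero_mul, mul_zero, one_mul, zero_add] at this
    exact this
  · have := (hE.mul (hcX.mul hsT)).sub (hD.mul (hsX.mul hcT))
    simp only [zero_mul, mul_zero, one_mul, zero_sub] at this
    exact this

/-- At infinity `cos X = 0`, so only the terms with `B - A` survive in the phase vector, while the
energy tends to `A + B`. Interchanging `A` and `B` keeps the energy and reverses the phase vector.
-/
theorem IsReflection.sameOrbit (hk : 0 < k) {γ' : ℝ → PhasePoint} {a b : ℝ}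
    (h : IsReflection (-3 * k ^ 2) l γ γ' a b) {s t : ℝ} (hs : a < s) (ht : t < b) :
    SameOrbit k (γ s) (γ' t) := by
  obtain ⟨u₀, hu, hv, hu', hv'⟩ := h.endpoint
  obtain ⟨A, B, hA, hB, hA', hB'⟩ := h.momentum
  have c := tendsto_phase_infinity hk hu hv hA hB
  have c' := tendsto_phase_infinity hk hu' hv' hA' hB'
  have key : ∀ {f : PhasePoint → ℝ} {y : ℝ}, (∀ r ∈ Ioi a, f (γ r) = f (γ s)) →
      Tendsto (fun r => f (γ r)) atTop (𝓝 y) → f (γ s) = y := by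
    intro f y hf hy
    refine tendsto_nhds_unique (tendsto_const_nhds.congr' ?_) hy
    filter_upwards [Ioi_mem_atTop a] with r hr using (hf r hr).symm
  have key' : ∀ {f : PhasePoint → ℝ} {y : ℝ}, (∀ r ∈ Iio b, f (γ' r) = f (γ' t)) →
      Tendsto (fun r => f (γ' r)) atBot (𝓝 y) → f (γ' t) = y := by
    intro f y hf hy
    refine tendsto_nhds_unique (tendsto_const_nhds.congr' ?_) hy
    filter_upwards [Iio_mem_atBot b] with r hr using (hf r hr).symm
  have o := fun r (hr : r ∈ Ioi a) =>
    h.incoming.sameOrbit hk (convex_Ioi a) isOpen_Ioi (show s ∈ Ioi a from hs) hr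
  have o' := fun r (hr : r ∈ Iio b) =>
    h.outgoing.sameOrbit hk (convex_Iio b) isOpen_Iio (show t ∈ Iio b from ht) hr
  refine ⟨?_, -1, Or.inr rfl, ?_, ?_⟩
  · rw [key (fun r hr => (o r hr).1) c.1, key' (fun r hr => (o' r hr).1) c'.1]; ring
  · rw [key (fun r hr => (o r hr).2.1) c.2.1, key' (fun r hr => (o' r hr).2.1) c'.2.1]; ring
  · rw [key (fun r hr => (o r hr).2.2) c.2.2, key' (fun r hr => (o' r hr).2.2) c'.2.2]; ring

theorem Reaches.sameOrbit (hk : 0 < k) {x y : PhasePoint} (h : Reaches (-3 * k ^ 2) l x y) :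
    SameOrbit k x y := by
  induction h with
  | refl => exact SameOrbit.refl k x
  | tail _ hstep ih =>
    refine ih.trans ?_
    rcases hstep with ⟨γ, a, b, s, t, hγ, has, hst, htb, rfl, rfl⟩ |
      ⟨γ, γ', a, b, s, t, hr, has, htb, rfl, rfl⟩
    · have := hγ.sameOrbit hk (convex_Ioo a b) isOpen_Ioo ⟨has, hst.trans_lt htb⟩
        ⟨has.trans_le hst, htb⟩
      exact ⟨this.1, 1, Or.inl rfl, by rw [this.2.1, one_mul], by rw [this.2.2, one_mul]⟩
    · exact hr.sameOrbit hk has htb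

end Conservation

/-! ### The phase space region swept out by a beam -/

/-- Necessary conditions for the phase space point over `(u, v)` with `p^u = p` and angular
momentum `l` to lie on an orbit of the beam of width `ε` and phase `θ`, up to the constant `K`. -/
structure InBeam (K ε θ k u v p l : ℝ) : Prop where
  angular_le : k * l ≤ K * ε
  le_angular : ε ≤ K * (k * l)
  energy_le : Ω2AdS (-3 * k ^ 2) u v * p + l ^ 2 / (rAdS (-3 * k ^ 2) u v ^ 2 * p) ≤ K
  le_energy : 1 ≤ K * (Ω2AdS (-3 * k ^ 2) u v * p + l ^ 2 / (rAdS (-3 * k ^ 2) u v ^ 2 * p))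
  phase_u : |(Ω2AdS (-3 * k ^ 2) u v * p + l ^ 2 / (rAdS (-3 * k ^ 2) u v ^ 2 * p)) *
        |sin (k * u - θ)| - 2 * (Ω2AdS (-3 * k ^ 2) u v * p) *
        (sin (k * (v - u) / 2) * cos (k * (v - u) / 2))| ≤
      4 * K * ε * (Ω2AdS (-3 * k ^ 2) u v * p + l ^ 2 / (rAdS (-3 * k ^ 2) u v ^ 2 * p))
  phase_v : |(Ω2AdS (-3 * k ^ 2) u v * p + l ^ 2 / (rAdS (-3 * k ^ 2) u v ^ 2 * p)) *
        |sin (k * v - θ)| - 2 * (l ^ 2 / (rAdS (-3 * k ^ 2) u v ^ 2 * p)) *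
        (sin (k * (v - u) / 2) * cos (k * (v - u) / 2))| ≤
      4 * K * ε * (Ω2AdS (-3 * k ^ 2) u v * p + l ^ 2 / (rAdS (-3 * k ^ 2) u v ^ 2 * p))

/-- Rotating the phase relations by `T` turns them, for `δ = 0`, into `(A + B) cos X = s (A + B) cos
(T - θ)` and `(B - A) sin X = s (A + B) sin (T - θ)`. Inserting these in the addition formula for
`sin (T - θ ∓ X)` leaves `∓ 2 s A sin X cos X`, respectively with `B`. Here `T - X = k u` and `T + X
= k v`. The rotation costs a factor two in the error, and so does the sum of two terms. -/
theorem abs_mul_sin_sub_le {A B X T θ s δ : ℝ} (hs : s = 1 ∨ s = -1) (hA : 0 < A) (hB : 0 < B)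
    (hX : X ∈ Ioo 0 (π / 2))
    (h1 : |(A + B) * (cos X * cos T) + (B - A) * (sin X * sin T) - s * ((A + B) * cos θ)| ≤ δ)
    (h2 : |(A + B) * (cos X * sin T) - (B - A) * (sin X * cos T) - s * ((A + B) * sin θ)| ≤ δ) :
    |(A + B) * |sin (T - X - θ)| - 2 * A * (sin X * cos X)| ≤ 4 * δ ∧
    |(A + B) * |sin (T + X - θ)| - 2 * B * (sin X * cos X)| ≤ 4 * δ := by
  have hc := cos_pos_of_mem hX
  have hn := sin_pos_of_mem hX
  have hδ : 0 ≤ δ := (abs_nonneg _).trans h1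
  set e1 := (A + B) * (cos X * cos T) + (B - A) * (sin X * sin T) - s * ((A + B) * cos θ)
  set e2 := (A + B) * (cos X * sin T) - (B - A) * (sin X * cos T) - s * ((A + B) * sin θ)
  have hss : s * s = 1 := by rcases hs with rfl | rfl <;> norm_num
  have habs : |s| = 1 := by rcases hs with rfl | rfl <;> norm_num
  have bd : ∀ {x y : ℝ}, |x| ≤ δ → |y| ≤ 1 → |x * y| ≤ δ := by
    intro x y hx hy
    rw [abs_mul]
    exact (mul_le_of_le_one_right (abs_nonneg _) hy).trans hx
  have hpT := sin_sq_add_cos_sq T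
  have f1 : e1 * cos T + e2 * sin T = (A + B) * cos X - s * ((A + B) * cos (T - θ)) := by
    rw [cos_sub]; simp only [e1, e2]
    linear_combination ((A + B) * cos X) * hpT
  have f2 : e1 * sin T - e2 * cos T = (B - A) * sin X - s * ((A + B) * sin (T - θ)) := by
    rw [sin_sub]; simp only [e1, e2]
    linear_combination ((B - A) * sin X) * hpT
  have g1 : |e1 * cos T + e2 * sin T| ≤ 2 * δ := by
    have := abs_add_le (e1 * cos T) (e2 * sin T)
    have := bd h1 (abs_cos_le_one T)
    have := bd h2 (abs_sin_le_one T)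
    linarith
  have g2 : |e1 * sin T - e2 * cos T| ≤ 2 * δ := by
    have := abs_sub (e1 * sin T) (e2 * cos T)
    have := bd h1 (abs_sin_le_one T)
    have := bd h2 (abs_cos_le_one T)
    linarith
  rw [f1] at g1
  rw [f2] at g2
  have g1' : |((A + B) * cos X - s * ((A + B) * cos (T - θ))) * sin X| ≤ 2 * δ := by
    rw [abs_mul]
    exact (mul_le_of_le_one_right (abs_nonneg _) (abs_sin_le_one X)).trans g1
  have g2' : |((B - A) * sin X - s * ((A + B) * sin (T - θ))) * cos X| ≤ 2 * δ := by
    rw [abs_mul]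
    exact (mul_le_of_le_one_right (abs_nonneg _) (abs_cos_le_one X)).trans g2
  constructor
  · have hS : |s * ((A + B) * sin (T - X - θ)) - -(2 * A * (sin X * cos X))| ≤ 4 * δ := by
      have e : T - X - θ = (T - θ) - X := by ring
      rw [e, sin_sub (T - θ)]
      have : s * ((A + B) * (sin (T - θ) * cos X - cos (T - θ) * sin X))
          - -(2 * A * (sin X * cos X))
          = ((A + B) * cos X - s * ((A + B) * cos (T - θ))) * sin X
            - ((B - A) * sin X - s * ((A + B) * sin (T - θ))) * cos X := by ring
      rw [this]
      refine (abs_sub _ _).trans (by linarith)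
    have := (abs_abs_sub_abs_le_abs_sub (s * ((A + B) * sin (T - X - θ)))
      (-(2 * A * (sin X * cos X)))).trans hS
    rwa [abs_neg, abs_mul, habs, one_mul, abs_mul, abs_of_pos (show 0 < A + B by linarith),
      abs_of_pos (show 0 < 2 * A * (sin X * cos X) by positivity)] at this
  · have hS : |s * ((A + B) * sin (T + X - θ)) - (2 * B * (sin X * cos X))| ≤ 4 * δ := by
      have e : T + X - θ = (T - θ) + X := by ring
      rw [e, sin_add (T - θ)]
      have : s * ((A + B) * (sin (T - θ) * cos X + cos (T - θ) * sin X))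
          - (2 * B * (sin X * cos X))
          = -((A + B) * cos X - s * ((A + B) * cos (T - θ))) * sin X
            - ((B - A) * sin X - s * ((A + B) * sin (T - θ))) * cos X := by ring
      rw [this]
      refine (abs_sub _ _).trans ?_
      rw [neg_mul, abs_neg]
      linarith
    have := (abs_abs_sub_abs_le_abs_sub (s * ((A + B) * sin (T + X - θ)))
      ((2 * B * (sin X * cos X)))).trans hS
    rwa [abs_mul, habs, one_mul, abs_mul, abs_of_pos (show 0 < A + B by linarith),
      abs_of_pos (show 0 < 2 * B * (sin X * cos X) by positivity)] at this

theorem abs_cos_sub_cos_le (x y : ℝ) : |cos x - cos y| ≤ |x - y| := by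
  rw [cos_sub_cos, abs_mul, abs_mul, abs_neg, abs_two]
  have h1 := abs_sin_le_one ((x + y) / 2)
  have h2 : |sin ((x - y) / 2)| ≤ |(x - y) / 2| := abs_sin_le_abs
  rw [abs_div, abs_two] at h2
  have h3 := abs_nonneg (sin ((x + y) / 2))
  have h4 := abs_nonneg (sin ((x - y) / 2))
  nlinarith

theorem abs_sin_sub_sin_le (x y : ℝ) : |sin x - sin y| ≤ |x - y| := by
  rw [← cos_pi_div_two_sub, ← cos_pi_div_two_sub]
  refine (abs_cos_sub_cos_le _ _).trans ?_
  rw [show π / 2 - x - (π / 2 - y) = -(x - y) by ring, abs_neg]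

section Shell

variable {k u v p l : ℝ}

theorem shell_pv (hk : 0 < k) (hX : k * (v - u) / 2 ∈ Ioo 0 (π / 2)) :
    Ω2AdS (-3 * k ^ 2) u v * (shellPoint (-3 * k ^ 2) u v p l).pv
      = l ^ 2 / (rAdS (-3 * k ^ 2) u v ^ 2 * p) := by
  have hc := cos_pos_of_mem hX
  have : Ω2AdS (-3 * k ^ 2) u v ≠ 0 := by rw [Ω2AdS_eq hk hc.ne']; positivity
  simp only [shellPoint]
  rw [mul_assoc (Ω2AdS (-3 * k ^ 2) u v), ← mul_div_assoc, mul_div_mul_left _ _ this]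

theorem energy_shellPoint (hk : 0 < k) (hX : k * (v - u) / 2 ∈ Ioo 0 (π / 2)) :
    energy (-3 * k ^ 2) (shellPoint (-3 * k ^ 2) u v p l)
      = Ω2AdS (-3 * k ^ 2) u v * p + l ^ 2 / (rAdS (-3 * k ^ 2) u v ^ 2 * p) := by
  rw [← shell_pv hk hX]; rfl

theorem phaseCos_shellPoint (hk : 0 < k) (hX : k * (v - u) / 2 ∈ Ioo 0 (π / 2)) :
    phaseCos k (shellPoint (-3 * k ^ 2) u v p l)
      = (Ω2AdS (-3 * k ^ 2) u v * p + l ^ 2 / (rAdS (-3 * k ^ 2) u v ^ 2 * p)) *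
          (cos (k * (v - u) / 2) * cos (k * (u + v) / 2)) +
        (l ^ 2 / (rAdS (-3 * k ^ 2) u v ^ 2 * p) - Ω2AdS (-3 * k ^ 2) u v * p) *
          (sin (k * (v - u) / 2) * sin (k * (u + v) / 2)) := by
  rw [← shell_pv hk hX]; rfl

theorem phaseSin_shellPoint (hk : 0 < k) (hX : k * (v - u) / 2 ∈ Ioo 0 (π / 2)) :
    phaseSin k (shellPoint (-3 * k ^ 2) u v p l)
      = (Ω2AdS (-3 * k ^ 2) u v * p + l ^ 2 / (rAdS (-3 * k ^ 2) u v ^ 2 * p)) *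
          (cos (k * (v - u) / 2) * sin (k * (u + v) / 2)) -
        (l ^ 2 / (rAdS (-3 * k ^ 2) u v ^ 2 * p) - Ω2AdS (-3 * k ^ 2) u v * p) *
          (sin (k * (v - u) / 2) * cos (k * (u + v) / 2)) := by
  rw [← shell_pv hk hX]; rfl

theorem shell_product (hk : 0 < k) (hX : k * (v - u) / 2 ∈ Ioo 0 (π / 2)) (hp : 0 < p) :
    Ω2AdS (-3 * k ^ 2) u v * p * (l ^ 2 / (rAdS (-3 * k ^ 2) u v ^ 2 * p))
      * sin (k * (v - u) / 2) ^ 2 = (k * l) ^ 2 := by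
  have hc := cos_pos_of_mem hX
  have hn := sin_pos_of_mem hX
  rw [Ω2AdS_eq hk hc.ne', rAdS_eq hk, tan_eq_sin_div_cos]
  field_simp

theorem rAdS_pos (hk : 0 < k) (hX : k * (v - u) / 2 ∈ Ioo 0 (π / 2)) :
    0 < rAdS (-3 * k ^ 2) u v := by
  rw [rAdS_eq hk]; exact div_pos (tan_pos_of_mem hX) hk

theorem Ω2AdS_pos (hk : 0 < k) (hX : k * (v - u) / 2 ∈ Ioo 0 (π / 2)) :
    0 < Ω2AdS (-3 * k ^ 2) u v := by
  have hc := cos_pos_of_mem hX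
  rw [Ω2AdS_eq hk hc.ne']; positivity

/-- Energy and phase of the inward moving points in the middle of the initial slice. -/
theorem initial_energy_phase {ε θ x A B p₀ m : ℝ} (hε : 0 < ε) (hε1 : ε ≤ 1)
    (hx : x ∈ Icc (π / 6) (π / 3)) (hp₀ : p₀ ∈ Icc (1 / 17) 20) (hθ : |2 * x - θ| ≤ 2 * ε)
    (hm : 0 < m) (hm2 : m ≤ 4 * ε) (hB : 0 < B) (hAp : A * cos x ^ 2 = p₀)
    (hprod : A * B * sin x ^ 2 = m ^ 2) :
    A + B ≤ 100000 ∧ 1 / 17 ≤ A + B ∧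
    |(A + B) * (cos x * cos x) + (B - A) * (sin x * sin x) - (A + B) * cos θ| ≤
      100000 * ε * (A + B) ∧
    |(A + B) * (cos x * sin x) - (B - A) * (sin x * cos x) - (A + B) * sin θ| ≤
      100000 * ε * (A + B) := by
  have hcx : 1 / 2 ≤ cos x := by
    rw [← cos_pi_div_three]
    exact cos_le_cos_of_nonneg_of_le_pi (by linarith [hx.1, pi_pos]) (by linarith [pi_pos]) hx.2
  have hnx : 1 / 2 ≤ sin x := by
    rw [← sin_pi_div_six]
    exact sin_le_sin_of_le_of_le_pi_div_two (by linarith [pi_pos])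
      (by linarith [hx.2, pi_pos]) hx.1
  have hpy : sin x ^ 2 + cos x ^ 2 = 1 := sin_sq_add_cos_sq _
  have hcosθ : |cos x ^ 2 - sin x ^ 2 - cos θ| ≤ 2 * ε := by
    rw [← cos_two_mul']; exact (abs_cos_sub_cos_le _ θ).trans hθ
  have hsinθ : |2 * sin x * cos x - sin θ| ≤ 2 * ε := by
    rw [← sin_two_mul]; exact (abs_sin_sub_sin_le _ θ).trans hθ
  generalize cos x = c at *
  generalize sin x = n at *
  have hc2 : (1 / 4 : ℝ) ≤ c ^ 2 := by nlinarith
  have hn2 : (1 / 4 : ℝ) ≤ n ^ 2 := by nlinarith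
  have hc21 : c ^ 2 ≤ 1 := by linarith
  have hn21 : n ^ 2 ≤ 1 := by linarith
  have hA : 0 < A := by
    refine pos_of_mul_pos_left (b := c ^ 2) ?_ (by positivity)
    rw [hAp]; linarith [hp₀.1]
  have hA₀le : A ≤ 80 := by
    have : A * (1 / 4) ≤ A * c ^ 2 := by gcongr
    linarith [hp₀.2]
  have hA₀ge : 1 / 17 ≤ A := by
    have : A * c ^ 2 ≤ A := mul_le_of_le_one_right hA.le hc21
    linarith [hp₀.1]
  have hm3 : m ^ 2 ≤ 16 * ε ^ 2 := by
    calc m ^ 2 ≤ (4 * ε) ^ 2 := by gcongr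
      _ = 16 * ε ^ 2 := by ring
  -- The shell relation with `A * n ^ 2 ≥ 1 / 68` and `m ^ 2 ≤ 16 * ε ^ 2` makes `B` quadratically
  -- small, `1088` being `16 * 68`: at launch the orbit is ingoing and almost radial.
  have hB₀le : B ≤ 1088 * ε ^ 2 := by
    have h1 : B * (1 / 17 * (1 / 4)) ≤ B * (A * n ^ 2) := by gcongr
    linarith
  have hε2 : ε ^ 2 ≤ ε := by nlinarith
  have hB₀le' : B ≤ 1088 * ε := by linarith
  have hE₀ : 1 / 17 ≤ A + B := by linarith
  have hBE : 2 * B ≤ 36992 * ε * (A + B) := by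
    have : ε * (1 / 17) ≤ ε * (A + B) := by gcongr
    linarith
  have hεE : 0 < ε * (A + B) := by positivity
  refine ⟨by linarith, hE₀, ?_, ?_⟩
  · have : (A + B) * (c * c) + (B - A) * (n * n) - (A + B) * cos θ
        = (A + B) * (c ^ 2 - n ^ 2 - cos θ) + 2 * B * n ^ 2 := by ring
    rw [this]
    refine (abs_add_le _ _).trans ?_
    rw [abs_mul, abs_of_pos (show 0 < A + B by linarith),
      abs_of_pos (show 0 < 2 * B * n ^ 2 by positivity)]
    have h1 : (A + B) * |c ^ 2 - n ^ 2 - cos θ| ≤ (A + B) * (2 * ε) := by gcongr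
    have h2 : 2 * B * n ^ 2 ≤ 2 * B := mul_le_of_le_one_right (by linarith) hn21
    linarith
  · have : (A + B) * (c * n) - (B - A) * (n * c) - (A + B) * sin θ
        = (A + B) * (2 * n * c - sin θ) - 2 * B * (n * c) := by ring
    rw [this]
    refine (abs_sub _ _).trans ?_
    rw [abs_mul, abs_of_pos (show 0 < A + B by linarith),
      abs_of_pos (show 0 < 2 * B * (n * c) by positivity)]
    have h1 : (A + B) * |2 * n * c - sin θ| ≤ (A + B) * (2 * ε) := by gcongr
    have h2 : 2 * B * (n * c) ≤ 2 * B :=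
      mul_le_of_le_one_right (by linarith) (by nlinarith [sq_nonneg (n - c)])
    linarith

/-- Orbits launched inward from the middle of the initial slice, with small angular momentum,
stay in the region `InBeam`. -/
theorem inBeam_of_reaches {ε θ v₀ p₀ : ℝ} (hk : 0 < k) (hε : 0 < ε) (hε1 : ε ≤ 1)
    (hX : k * (v - u) / 2 ∈ Ioo 0 (π / 2)) (hp : 0 < p) (hl : 0 < l)
    (hv₀ : k * v₀ / 2 ∈ Icc (π / 6) (π / 3)) (hp₀ : p₀ ∈ Icc (1 / 17) 20)
    (hθ : |k * v₀ - θ| ≤ 2 * ε) (hl1 : ε ≤ k * l) (hl2 : k * l ≤ 4 * ε)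
    (h : Reaches (-3 * k ^ 2) l (shellPoint (-3 * k ^ 2) 0 v₀ p₀ l)
      (shellPoint (-3 * k ^ 2) u v p l)) :
    InBeam 100000 ε θ k u v p l := by
  obtain ⟨hE, s, hs, hC, hS⟩ := h.sameOrbit hk
  have hX₀ : k * (v₀ - 0) / 2 ∈ Ioo 0 (π / 2) := by
    rw [sub_zero]
    exact ⟨by linarith [hv₀.1, pi_pos], by linarith [hv₀.2, pi_pos]⟩
  have hp₀' : 0 < p₀ := by linarith [hp₀.1]
  have hc₀ := cos_pos_of_mem hX₀
  have hr₀ := rAdS_pos hk hX₀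
  rw [energy_shellPoint hk hX, energy_shellPoint hk hX₀] at hE
  rw [phaseCos_shellPoint hk hX, phaseCos_shellPoint hk hX₀] at hC
  rw [phaseSin_shellPoint hk hX, phaseSin_shellPoint hk hX₀] at hS
  have hprod := shell_product (l := l) hk hX₀ hp₀'
  have hAc : Ω2AdS (-3 * k ^ 2) 0 v₀ * p₀ * cos (k * (v₀ - 0) / 2) ^ 2 = p₀ := by
    rw [Ω2AdS_eq hk hc₀.ne']; field_simp
  have hin := initial_energy_phase (θ := θ) hε hε1 (x := k * (v₀ - 0) / 2)
    (by rwa [sub_zero]) hp₀ (by rwa [show 2 * (k * (v₀ - 0) / 2) = k * v₀ by ring])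
    (mul_pos hk hl) hl2 (show 0 < l ^ 2 / (rAdS (-3 * k ^ 2) 0 v₀ ^ 2 * p₀) by positivity)
    hAc hprod
  -- On the initial slice `u = 0` the angles `T` and `X` coincide.
  rw [show k * (0 + v₀) / 2 = k * (v₀ - 0) / 2 by ring] at hC hS
  have hAp : 0 < Ω2AdS (-3 * k ^ 2) u v * p := mul_pos (Ω2AdS_pos hk hX) hp
  have hBp : 0 < l ^ 2 / (rAdS (-3 * k ^ 2) u v ^ 2 * p) := by
    have := rAdS_pos hk hX; positivity
  obtain ⟨i1, i2, i3, i4⟩ := hin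
  rw [← hE] at hC hS i1 i2 i3 i4
  have habs : |s| = 1 := by rcases hs with rfl | rfl <;> norm_num
  have key := abs_mul_sin_sub_le (θ := θ) (δ := 100000 * ε *
    (Ω2AdS (-3 * k ^ 2) u v * p + l ^ 2 / (rAdS (-3 * k ^ 2) u v ^ 2 * p))) hs hAp hBp hX
    (by rw [hC, ← mul_sub, abs_mul, habs, one_mul]; exact i3)
    (by rw [hS, ← mul_sub, abs_mul, habs, one_mul]; exact i4)
  rw [show k * (u + v) / 2 - k * (v - u) / 2 - θ = k * u - θ by ring,
    show k * (u + v) / 2 + k * (v - u) / 2 - θ = k * v - θ by ring] at key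
  exact ⟨by linarith, by linarith, i1, by linarith, key.1.trans_eq (by ring),
    key.2.trans_eq (by ring)⟩

end Shell

/-! ### The profile of a beam on a null slice -/

/-- A bound for the density of a beam of width `ε` on a null slice whose phase differs by `φ` from
that of the beam, at distance `z` from the axis. -/
def profile (K ε k φ z : ℝ) : ℝ :=
  if 8 * K * ε ≤ |sin φ| then
    if |sin (φ + k * z)| ≤ 5 * K ^ 3 * ε then 4 * K / |sin φ| else 0
  else if 2 * ε / K ^ 2 ≤ sin (k * z / 2) then 6 * K ^ 2 * ε / sin (k * z / 2) ^ 2 else 0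

/-- The bound for the integral of `profile` over a slice, up to a constant factor. -/
def damping (K ε φ : ℝ) : ℝ := if 8 * K * ε ≤ |sin φ| then ε / |sin φ| else 1

/-- For `b ≥ 8 K ε` the error is at most half of the main term, so `A n c` is at least a multiple of
`(A + B) b`. The shell relation `A B n² = m²` then forces `B n = O(ε)`, and the second phase
relation confines the orbit to `b' = O(ε)`, a thin strip around a null line. As `A ≤ A + B`, the
first relation also gives `b ≤ 4 n c`; this turns the trivial bound `A ≤ K` into one with the factor
`n / c = tan X`, which is needed at the axis. -/
theorem momentum_le_of_far {K ε m A B n c b b' : ℝ} (hK : 1 ≤ K) (hε : 0 < ε)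
    (hA : 0 < A) (hB : 0 < B) (hn : 0 < n) (hc : 0 < c) (hc1 : c ≤ 1)
    (hm : 0 < m) (hm1 : m ≤ K * ε) (hE : A + B ≤ K) (hE' : 1 ≤ K * (A + B))
    (hprod : A * B * n ^ 2 = m ^ 2)
    (h1 : (A + B) * b - 2 * A * (n * c) ≤ 4 * K * ε * (A + B))
    (h2 : (A + B) * b' - 2 * B * (n * c) ≤ 4 * K * ε * (A + B)) (hb : 8 * K * ε ≤ b) :
    b' ≤ 5 * K ^ 3 * ε ∧ A ≤ 4 * K / b * (n / c) := by
  have hK0 : 0 < K := by linarith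
  have hEp : 0 < A + B := by linarith
  have hbpos : 0 < b := lt_of_lt_of_le (by positivity) hb
  have h3 : (A + B) * b ≤ 4 * A * (n * c) := by
    have : (A + B) * (8 * K * ε) ≤ (A + B) * b := by gcongr
    linarith
  have hnc : 0 < n * c := mul_pos hn hc
  constructor
  · have h4 : B * n * ((A + B) * b) ≤ 4 * m ^ 2 := by
      calc B * n * ((A + B) * b) ≤ B * n * (4 * A * (n * c)) := by gcongr
        _ = 4 * (A * B * n ^ 2) * c := by ring
        _ = 4 * m ^ 2 * c := by rw [hprod]
        _ ≤ 4 * m ^ 2 * 1 := by gcongr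
        _ = 4 * m ^ 2 := by ring
    have h5 : B * n * ((A + B) * (8 * K * ε)) ≤ 4 * (K * ε) ^ 2 := by
      calc B * n * ((A + B) * (8 * K * ε)) ≤ B * n * ((A + B) * b) := by gcongr
        _ ≤ 4 * m ^ 2 := h4
        _ ≤ 4 * (K * ε) ^ 2 := by gcongr
    have h6 : 2 * (B * n) * (A + B) ≤ K * ε := by
      have : 2 * (B * n) * (A + B) * (4 * K * ε) ≤ K * ε * (4 * K * ε) := by linarith
      exact le_of_mul_le_mul_right this (by positivity)
    have h7 : 2 * (B * n) ≤ K ^ 3 * ε * (A + B) := by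
      calc 2 * (B * n) ≤ 2 * (B * n) * (K * (A + B)) :=
            le_mul_of_one_le_right (by positivity) hE'
        _ = K * (2 * (B * n) * (A + B)) := by ring
        _ ≤ K * (K * ε) := by gcongr
        _ ≤ K * (K * ε) * (K * (A + B)) := le_mul_of_one_le_right (by positivity) hE'
        _ = K ^ 3 * ε * (A + B) := by ring
    have h8 : 2 * B * (n * c) ≤ 2 * (B * n) := by
      calc 2 * B * (n * c) = 2 * (B * n) * c := by ring
        _ ≤ 2 * (B * n) := mul_le_of_le_one_right (by positivity) hc1
    have h9 : (A + B) * b' ≤ (A + B) * (K ^ 3 * ε + 4 * K * ε) := by linarith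
    have h10 := le_of_mul_le_mul_left h9 hEp
    have h11 : K * ε ≤ K ^ 3 * ε := by
      have : K ≤ K ^ 3 := le_self_pow₀ hK (by norm_num)
      gcongr
    linarith
  · have h4 : b ≤ 4 * (n * c) := by
      have h5 : 0 < B * (n * c) := by positivity
      exact le_of_mul_le_mul_left (show (A + B) * b ≤ (A + B) * (4 * (n * c)) by linarith) hEp
    rw [div_mul_div_comm, le_div_iff₀ (by positivity)]
    have h5 : b * c ≤ 4 * n := by
      have e1 : n * c ≤ n := mul_le_of_le_one_right hn.le hc1
      have e2 : b * c ≤ b := mul_le_of_le_one_right hbpos.le hc1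
      linarith
    calc A * (b * c) ≤ K * (4 * n) := by gcongr; linarith
      _ = 4 * K * n := by ring

/-- The lower bound on `n` is the centrifugal barrier: `2 m ≤ (A + B) n` by the inequality of
arithmetic and geometric means. The bound on `A` holds because `2 A n c` exceeds `(A + B) b` by at
most the error, and both are `O(ε)`. -/
theorem momentum_le_of_near {K ε m A B n c b : ℝ} (hK : 1 ≤ K) (hε : 0 < ε)
    (hA : 0 < A) (hB : 0 < B) (hn : 0 < n) (hc : 0 < c)
    (hm2 : ε ≤ K * m) (hE : A + B ≤ K)
    (hprod : A * B * n ^ 2 = m ^ 2)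
    (h1 : -(4 * K * ε * (A + B)) ≤ (A + B) * b - 2 * A * (n * c)) (hb : b < 8 * K * ε) :
    2 * ε / K ^ 2 ≤ n ∧ A ≤ 6 * K ^ 2 * ε / n ^ 2 * (n / c) := by
  have hK0 : 0 < K := by linarith
  have hEp : 0 < A + B := by linarith
  constructor
  · rw [div_le_iff₀ (by positivity)]
    have h3 : (2 * m) ^ 2 ≤ ((A + B) * n) ^ 2 := by
      have h0 : 4 * (A * B) ≤ (A + B) ^ 2 := by nlinarith [sq_nonneg (A - B)]
      calc (2 * m) ^ 2 = 4 * (A * B) * n ^ 2 := by rw [mul_assoc, hprod]; ring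
        _ ≤ (A + B) ^ 2 * n ^ 2 := by gcongr
        _ = ((A + B) * n) ^ 2 := by ring
    have h4 : 2 * m ≤ (A + B) * n := le_of_abs_le (abs_le_of_sq_le_sq h3 (by positivity))
    have h5 : (A + B) * n ≤ K * n := by gcongr
    calc 2 * ε ≤ K * (2 * m) := by linarith
      _ ≤ K * (K * n) := mul_le_mul_of_nonneg_left (h4.trans h5) hK0.le
      _ = n * K ^ 2 := by ring
  · have h3 : (A + B) * b ≤ (A + B) * (8 * K * ε) := by gcongr
    have h4 : 12 * K * ε * (A + B) ≤ 12 * K * ε * K := by gcongr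
    have e : 6 * K ^ 2 * ε / n ^ 2 * (n / c) = 6 * K ^ 2 * ε / (n * c) := by field_simp
    rw [e, le_div_iff₀ (by positivity)]
    linarith

theorem momentum_le_profile {K ε m A B n c b b' : ℝ} (hK : 1 ≤ K) (hε : 0 < ε)
    (hA : 0 < A) (hB : 0 < B) (hn : 0 < n) (hc : 0 < c) (hc1 : c ≤ 1)
    (hm : 0 < m) (hm1 : m ≤ K * ε) (hm2 : ε ≤ K * m) (hE : A + B ≤ K) (hE' : 1 ≤ K * (A + B))
    (hprod : A * B * n ^ 2 = m ^ 2)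
    (h1 : |(A + B) * b - 2 * A * (n * c)| ≤ 4 * K * ε * (A + B))
    (h2 : |(A + B) * b' - 2 * B * (n * c)| ≤ 4 * K * ε * (A + B)) :
    A ≤ (if 8 * K * ε ≤ b then if b' ≤ 5 * K ^ 3 * ε then 4 * K / b else 0
      else if 2 * ε / K ^ 2 ≤ n then 6 * K ^ 2 * ε / n ^ 2 else 0) * (n / c) := by
  by_cases hb : 8 * K * ε ≤ b
  · obtain ⟨h3, h4⟩ := momentum_le_of_far hK hε hA hB hn hc hc1 hm hm1 hE hE' hprod
      (abs_le.1 h1).2 (abs_le.1 h2).2 hb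
    rwa [if_pos hb, if_pos h3]
  · obtain ⟨h3, h4⟩ := momentum_le_of_near hK hε hA hB hn hc hm2 hE hprod
      (abs_le.1 h1).1 (not_le.1 hb)
    rwa [if_neg hb, if_pos h3]

section Profile

variable {K ε θ k u v p l : ℝ}

theorem InBeam.le_profile_u (h : InBeam K ε θ k u v p l) (hK : 1 ≤ K) (hε : 0 < ε) (hk : 0 < k)
    (hX : k * (v - u) / 2 ∈ Ioo 0 (π / 2)) (hp : 0 < p) (hl : 0 < l) :
    Ω2AdS (-3 * k ^ 2) u v * p ≤
      profile K ε k (k * u - θ) (v - u) * tan (k * (v - u) / 2) := by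
  have hr := rAdS_pos hk hX
  have hm := momentum_le_profile hK hε (mul_pos (Ω2AdS_pos hk hX) hp)
    (show 0 < l ^ 2 / (rAdS (-3 * k ^ 2) u v ^ 2 * p) by positivity) (sin_pos_of_mem hX)
    (cos_pos_of_mem hX) (cos_le_one _) (mul_pos hk hl) h.angular_le h.le_angular h.energy_le
    h.le_energy (shell_product hk hX hp) h.phase_u h.phase_v
  rwa [profile, tan_eq_sin_div_cos, show k * u - θ + k * (v - u) = k * v - θ by ring]

/-- Time reversal interchanges the two momenta and replaces the phase difference by its negative;
the conditions in `InBeam` are symmetric under this exchange. -/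
theorem InBeam.le_profile_v (h : InBeam K ε θ k u v p l) (hK : 1 ≤ K) (hε : 0 < ε) (hk : 0 < k)
    (hX : k * (v - u) / 2 ∈ Ioo 0 (π / 2)) (hp : 0 < p) (hl : 0 < l) :
    l ^ 2 / (rAdS (-3 * k ^ 2) u v ^ 2 * p) ≤
      profile K ε k (-(k * v - θ)) (v - u) * tan (k * (v - u) / 2) := by
  have hr := rAdS_pos hk hX
  have h1 := h.energy_le
  have h2 := h.le_energy
  have h3 := h.phase_u
  have h4 := h.phase_v
  have h5 := shell_product (l := l) hk hX hp
  rw [add_comm] at h1 h2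
  rw [add_comm (Ω2AdS (-3 * k ^ 2) u v * p)] at h3 h4
  rw [mul_comm (Ω2AdS (-3 * k ^ 2) u v * p)] at h5
  have hm := momentum_le_profile hK hε
    (show 0 < l ^ 2 / (rAdS (-3 * k ^ 2) u v ^ 2 * p) by positivity)
    (mul_pos (Ω2AdS_pos hk hX) hp) (sin_pos_of_mem hX)
    (cos_pos_of_mem hX) (cos_le_one _) (mul_pos hk hl) h.angular_le h.le_angular h1 h2 h5 h4 h3
  rwa [profile, tan_eq_sin_div_cos,
    show -(k * v - θ) + k * (v - u) = -(k * u - θ) by ring, sin_neg, abs_neg, sin_neg, abs_neg]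

theorem profile_nonneg (hK : 0 ≤ K) (hε : 0 ≤ ε) (φ z : ℝ) : 0 ≤ profile K ε k φ z := by
  unfold profile
  split_ifs <;> positivity

theorem measurable_profile (φ : ℝ) : Measurable (profile K ε k φ) := by
  unfold profile
  split_ifs
  · refine Measurable.ite (measurableSet_le (by fun_prop) measurable_const) measurable_const
      measurable_const
  · refine Measurable.ite (measurableSet_le measurable_const (by fun_prop)) (by fun_prop)
      measurable_const

end Profile

/-! ### Integrals over null slices -/

/-- The set where `|sin|` is small has small measure in every period. -/
theorem volume_abs_sin_le (φ k η : ℝ) (hk : 0 < k) (hη : 0 ≤ η) :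
    volume ({z | |sin (φ + k * z)| ≤ η} ∩ Ioo 0 (π / k)) ≤ ENNReal.ofReal (2 * π * η / k) := by
  -- The interval is one period of `|sin|`, so the zero nearest to `φ + k z` is `m π` or `(m + 1)
  -- π`; Jordan's inequality bounds the distance to it by `π η / 2`.
  set m : ℤ := round (φ / π) with hm
  set I : ℤ → Set ℝ := fun j => Icc ((j * π - φ - π / 2 * η) / k) ((j * π - φ + π / 2 * η) / k)
  have hsub : {z | |sin (φ + k * z)| ≤ η} ∩ Ioo 0 (π / k) ⊆ I m ∪ I (m + 1) := by
    rintro z ⟨hz, hz0, hz1⟩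
    simp only [mem_ofPred_eq] at hz
    have hkz : k * z < π := by rw [lt_div_iff₀ hk] at hz1; linarith
    have hkz0 : 0 < k * z := mul_pos hk hz0
    set y := (φ + k * z) / π with hy
    have hypi : φ + k * z = y * π := by rw [hy]; field_simp
    have hr1 : m ≤ round y := by
      rw [hm, round_eq, round_eq]
      apply Int.floor_le_floor
      rw [hy]; gcongr; linarith
    have hr2 : round y ≤ m + 1 := by
      rw [hm, ← round_add_one, round_eq, round_eq]
      apply Int.floor_le_floor
      have : y ≤ φ / π + 1 := by
        rw [hy, div_add_one pi_pos.ne']; gcongr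
      linarith
    have hd : |y - round y| ≤ 1 / 2 := abs_sub_round y
    have hmem : ∀ j : ℤ, j = round y → z ∈ I j := by
      rintro j rfl
      have h1 : |sin (y * π - round y * π)| ≤ η := by
        rw [sin_sub_int_mul_pi, abs_mul, abs_zpow, abs_neg, abs_one, one_zpow, one_mul, ← hypi]
        exact hz
      have h2 : 2 / π * |y * π - round y * π| ≤ |sin (y * π - round y * π)| := by
        refine Real.mul_abs_le_abs_sin ?_
        rw [← sub_mul, abs_mul, abs_of_pos pi_pos]
        nlinarith [pi_pos]
      have h3 : |y * π - round y * π| ≤ π / 2 * η := by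
        have := h2.trans h1
        rw [div_mul_eq_mul_div, div_le_iff₀ pi_pos] at this
        linarith
      obtain ⟨h4, h5⟩ := abs_le.1 h3
      constructor
      · rw [div_le_iff₀ hk]; linarith
      · rw [le_div_iff₀ hk]; linarith
    rcases (show m = round y ∨ m + 1 = round y by omega) with h | h
    · exact Or.inl (hmem _ h)
    · exact Or.inr (hmem _ h)
  have hvol : ∀ j, volume (I j) = ENNReal.ofReal (π * η / k) := by
    intro j
    rw [Real.volume_Icc]; congr 1; ring
  calc volume ({z | |sin (φ + k * z)| ≤ η} ∩ Ioo 0 (π / k)) ≤ volume (I m ∪ I (m + 1)) :=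
        measure_mono hsub
    _ ≤ volume (I m) + volume (I (m + 1)) := measure_union_le _ _
    _ = ENNReal.ofReal (2 * π * η / k) := by
        rw [hvol, hvol, ← ENNReal.ofReal_add (by positivity) (by positivity)]; congr 1; ring

theorem measurableSet_div_le (κ T : ℝ) : MeasurableSet {p : ℝ | 0 < p ∧ κ / p ≤ T} :=
  (measurableSet_lt measurable_const measurable_id).inter
    (measurableSet_le (measurable_id.const_div κ) measurable_const)

/-- `∫ κ / p² dp` over `{p > 0 : κ / p ≤ T}` is at most `T`. -/
theorem lintegral_div_sq_le {κ T : ℝ} (hκ : 0 < κ) :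
    ∫⁻ p in {p | 0 < p ∧ κ / p ≤ T}, ENNReal.ofReal (κ / p ^ 2) ≤ ENNReal.ofReal T := by
  -- Under the substitution `x = κ / p` the integral becomes the length of the image, which lies in
  -- `[0, T]`.
  have h := lintegral_image_eq_lintegral_abs_deriv_mul (measurableSet_div_le κ T) (f := fun p => κ / p)
    (f' := fun p => -(κ / p ^ 2)) (fun p hp => ?_) (fun p hp q hq hpq => ?_) (fun _ => 1)
  · simp only [mul_one, abs_neg, lintegral_one, Measure.restrict_apply, MeasurableSet.univ,
      univ_inter] at h
    have e : ∫⁻ p in {p | 0 < p ∧ κ / p ≤ T}, ENNReal.ofReal (κ / p ^ 2)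
        = ∫⁻ p in {p | 0 < p ∧ κ / p ≤ T}, ENNReal.ofReal |κ / p ^ 2| := by
      refine lintegral_congr fun p => ?_
      rw [abs_of_nonneg (by positivity)]
    rw [e, ← h]
    calc volume ((fun p => κ / p) '' {p | 0 < p ∧ κ / p ≤ T}) ≤ volume (Icc 0 T) := by
          refine measure_mono ?_
          rintro _ ⟨p, hp, rfl⟩
          exact ⟨(div_pos hκ hp.1).le, hp.2⟩
      _ = ENNReal.ofReal T := by rw [Real.volume_Icc, sub_zero]
  · have h1 := ((hasDerivAt_inv (ne_of_gt hp.1)).const_mul κ).hasDerivWithinAt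
      (s := {p : ℝ | 0 < p ∧ κ / p ≤ T})
    exact h1.congr_deriv (by ring)
  · simp only at hpq
    have := hp.1.ne'
    have := hq.1.ne'
    field_simp at hpq
    exact hpq.symm

/-- Far from the beam, a height of order `1 / |sin φ|` is attained on a set of measure `O(ε)`. Close
to it, `ε / sin²` is cut off at distance `ε` from the axis and therefore has an integral of order
one. -/
theorem lintegral_profile_le {K ε k : ℝ} (φ : ℝ) (hK : 2 ≤ K) (hε : 0 < ε) (hk : 0 < k) :
    ∫⁻ z in Ioo 0 (π / k), ENNReal.ofReal (profile K ε k φ z) ≤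
      ENNReal.ofReal (200 * K ^ 6 / k * damping K ε φ) := by
  have hK0 : 0 < K := by linarith
  have hK2 : 4 ≤ K ^ 2 := by nlinarith
  unfold profile damping
  split_ifs with hb
  · have hbpos : 0 < |sin φ| := lt_of_lt_of_le (by positivity) hb
    have hset : MeasurableSet {z | |sin (φ + k * z)| ≤ 5 * K ^ 3 * ε} :=
      measurableSet_le (by fun_prop) measurable_const
    have e : ∀ z, ENNReal.ofReal (if |sin (φ + k * z)| ≤ 5 * K ^ 3 * ε then 4 * K / |sin φ| else 0)
        = {z | |sin (φ + k * z)| ≤ 5 * K ^ 3 * ε}.indicator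
            (fun _ => ENNReal.ofReal (4 * K / |sin φ|)) z := by
      intro z
      simp only [indicator, mem_ofPred_eq]
      split_ifs <;> simp
    simp only [e]
    rw [lintegral_indicator_const hset, Measure.restrict_apply hset]
    calc ENNReal.ofReal (4 * K / |sin φ|)
          * volume ({z | |sin (φ + k * z)| ≤ 5 * K ^ 3 * ε} ∩ Ioo 0 (π / k))
        ≤ ENNReal.ofReal (4 * K / |sin φ|) * ENNReal.ofReal (2 * π * (5 * K ^ 3 * ε) / k) := by
          gcongr
          exact volume_abs_sin_le φ k _ hk (by positivity)
      _ = ENNReal.ofReal (40 * π * K ^ 4 / k * (ε / |sin φ|)) := by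
          rw [← ENNReal.ofReal_mul (by positivity)]; congr 1; field_simp; ring
      _ ≤ ENNReal.ofReal (200 * K ^ 6 / k * (ε / |sin φ|)) := by
          refine ENNReal.ofReal_le_ofReal ?_
          have h1 : 40 * π * K ^ 4 ≤ 200 * K ^ 6 := by
            have := pi_le_four
            have h2 : 4 * K ^ 4 ≤ K ^ 2 * K ^ 4 := by gcongr
            have h3 : π * K ^ 4 ≤ 4 * K ^ 4 := by gcongr
            nlinarith [pow_pos hK0 4]
          gcongr
  -- For `z ≤ ε / k` the barrier `sin ≥ 2 ε / K²` bounds the integrand by a constant. Beyond, `sin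
  -- (k z / 2) ≥ k z / 4` reduces it to a multiple of `ε / z²`, on the set to which
  -- `lintegral_div_sq_le` applies with `T = 1`.
  · have key : ∀ z ∈ Ioo 0 (π / k),
        ENNReal.ofReal (if 2 * ε / K ^ 2 ≤ sin (k * z / 2)
          then 6 * K ^ 2 * ε / sin (k * z / 2) ^ 2 else 0) ≤
        (Ioc 0 (ε / k)).indicator (fun _ => ENNReal.ofReal (3 * K ^ 6 / (2 * ε))) z +
        {p | 0 < p ∧ ε / k / p ≤ 1}.indicator
          (fun z => ENNReal.ofReal (96 * K ^ 2 / k) * ENNReal.ofReal (ε / k / z ^ 2)) z := by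
      intro z hz
      split_ifs with hn
      · by_cases hzε : z ≤ ε / k
        · rw [indicator_of_mem (show z ∈ Ioc 0 (ε / k) from ⟨hz.1, hzε⟩)]
          refine le_add_right (ENNReal.ofReal_le_ofReal ?_)
          calc 6 * K ^ 2 * ε / sin (k * z / 2) ^ 2 ≤ 6 * K ^ 2 * ε / (2 * ε / K ^ 2) ^ 2 := by
                gcongr
            _ = 3 * K ^ 6 / (2 * ε) := by field_simp; ring
        · push Not at hzε
          have hmem : z ∈ {p | 0 < p ∧ ε / k / p ≤ 1} :=
            ⟨hz.1, by rw [div_le_one hz.1]; exact hzε.le⟩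
          rw [indicator_of_mem hmem]
          refine le_add_left ?_
          rw [← ENNReal.ofReal_mul (by positivity)]
          refine ENNReal.ofReal_le_ofReal ?_
          have hz1 : k * z < π := by have := hz.2; rw [lt_div_iff₀ hk] at this; linarith
          have hkz : 0 < k * z := mul_pos hk hz.1
          have hsin : k * z / 4 ≤ sin (k * z / 2) := by
            refine le_trans ?_ (Real.mul_le_sin (by linarith) (by linarith))
            rw [div_mul_eq_mul_div, le_div_iff₀ pi_pos]
            have := pi_le_four
            nlinarith
          calc 6 * K ^ 2 * ε / sin (k * z / 2) ^ 2 ≤ 6 * K ^ 2 * ε / (k * z / 4) ^ 2 := by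
                gcongr
            _ = 96 * K ^ 2 / k * (ε / k / z ^ 2) := by
                have := hz.1.ne'
                field_simp; ring
      · simp
    refine (setLIntegral_mono' measurableSet_Ioo key).trans ?_
    refine (lintegral_mono_set (subset_univ _)).trans ?_
    rw [setLIntegral_univ, lintegral_add_left (measurable_const.indicator measurableSet_Ioc),
      lintegral_indicator_const measurableSet_Ioc, lintegral_indicator (measurableSet_div_le _ _),
      lintegral_const_mul _ (by fun_prop), Real.volume_Ioc, sub_zero]
    calc _ ≤ ENNReal.ofReal (3 * K ^ 6 / (2 * ε)) * ENNReal.ofReal (ε / k) +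
          ENNReal.ofReal (96 * K ^ 2 / k) * ENNReal.ofReal 1 := by
          gcongr
          exact lintegral_div_sq_le (by positivity)
      _ = ENNReal.ofReal (3 * K ^ 6 / (2 * k) + 96 * K ^ 2 / k) := by
          rw [← ENNReal.ofReal_mul (by positivity), ← ENNReal.ofReal_mul (by positivity),
            ← ENNReal.ofReal_add (by positivity) (by positivity)]
          congr 1; field_simp
      _ ≤ ENNReal.ofReal (200 * K ^ 6 / k * 1) := by
          refine ENNReal.ofReal_le_ofReal ?_
          have h1 : 16 * K ^ 2 ≤ K ^ 6 := by
            calc 16 * K ^ 2 = 4 * 4 * K ^ 2 := by ring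
              _ ≤ K ^ 2 * K ^ 2 * K ^ 2 := by gcongr
              _ = K ^ 6 := by ring
          rw [show 3 * K ^ 6 / (2 * k) + 96 * K ^ 2 / k = (3 / 2 * K ^ 6 + 96 * K ^ 2) / k by
            field_simp, mul_one]
          gcongr
          nlinarith [pow_pos hK0 6]

/-- Together with `damping_div_mul_le`, this makes `damping / (8 K)` an admissible weight in
`sum_weights_le`. -/
theorem damping_div_le_one {K ε : ℝ} (hK : 2 ≤ K) (hε : 0 < ε) (φ : ℝ) :
    damping K ε φ / (8 * K) ≤ 1 := by
  have hK0 : 0 < K := by linarith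
  unfold damping
  split_ifs with hb
  · have hbpos : 0 < |sin φ| := lt_of_lt_of_le (by positivity) hb
    rw [div_div, div_le_one (by positivity)]
    have : ε ≤ |sin φ| := by nlinarith
    nlinarith
  · rw [div_le_one (by positivity)]; linarith

theorem damping_div_mul_le {K ε : ℝ} (hK : 2 ≤ K) (hε : 0 < ε) (φ : ℝ) :
    damping K ε φ / (8 * K) * |sin φ| ≤ ε := by
  have hK0 : 0 < K := by linarith
  unfold damping
  split_ifs with hb
  · have hbpos : 0 < |sin φ| := lt_of_lt_of_le (by positivity) hb
    rw [div_mul_eq_mul_div, div_mul_cancel₀ _ hbpos.ne']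
    exact div_le_self hε.le (by linarith)
  · push Not at hb
    rw [div_mul_eq_mul_div, one_mul, div_le_iff₀ (by positivity)]
    linarith

theorem damping_nonneg {K ε : ℝ} (hε : 0 ≤ ε) (φ : ℝ) : 0 ≤ damping K ε φ := by
  unfold damping
  split_ifs <;> positivity

/-! ### Energy momentum of a superposition of beams -/

/-- Each angular momentum range has length `L i` and the momentum integral is at most `g i * L i`,
hence the square. Measurability is required of the majorants only: the free Vlasov field is an
uncountable supremum, for which it is not clear. -/
theorem lintegral_beams_le {n : ℕ} {h : ℝ → ℝ → ℝ≥0∞} {F : ℕ → ℝ → ℝ → ℝ≥0∞} {g L : ℕ → ℝ}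
    (hg : ∀ i, 0 ≤ g i) (hL : ∀ i, 0 ≤ L i) (hF : ∀ i l, Measurable (F i l))
    (hle : ∀ l > 0, ∀ p > 0, h l p ≤ ∑ i ∈ Finset.range n, F i l p)
    (hint : ∀ i, ∀ l > 0, ∫⁻ p in Ioi (0 : ℝ), F i l p ≤
      (Iic (L i)).indicator (fun _ => ENNReal.ofReal (g i * L i)) l) :
    ∫⁻ l in Ioi (0 : ℝ), ∫⁻ p in Ioi (0 : ℝ), h l p ≤
      ENNReal.ofReal (∑ i ∈ Finset.range n, g i * L i ^ 2) := by
  calc ∫⁻ l in Ioi (0 : ℝ), ∫⁻ p in Ioi (0 : ℝ), h l p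
      ≤ ∫⁻ l in Ioi (0 : ℝ), ∑ i ∈ Finset.range n,
          (Iic (L i)).indicator (fun _ => ENNReal.ofReal (g i * L i)) l := by
        refine setLIntegral_mono' measurableSet_Ioi fun l hl => ?_
        calc ∫⁻ p in Ioi (0 : ℝ), h l p
            ≤ ∫⁻ p in Ioi (0 : ℝ), ∑ i ∈ Finset.range n, F i l p :=
              setLIntegral_mono' measurableSet_Ioi fun p hp => hle l hl p hp
          _ = ∑ i ∈ Finset.range n, ∫⁻ p in Ioi (0 : ℝ), F i l p :=
              lintegral_finsetSum _ fun i _ => hF i l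
          _ ≤ _ := Finset.sum_le_sum fun i _ => hint i l hl
    _ = ∑ i ∈ Finset.range n, ∫⁻ l in Ioi (0 : ℝ),
          (Iic (L i)).indicator (fun _ => ENNReal.ofReal (g i * L i)) l :=
        lintegral_finsetSum _ fun i _ => measurable_const.indicator measurableSet_Iic
    _ = ∑ i ∈ Finset.range n, ENNReal.ofReal (g i * L i ^ 2) := by
        refine Finset.sum_congr rfl fun i _ => ?_
        rw [lintegral_indicator_const measurableSet_Iic,
          Measure.restrict_apply measurableSet_Iic, Iic_inter_Ioi, Real.volume_Ioc, sub_zero,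
          ← ENNReal.ofReal_mul (mul_nonneg (hg i) (hL i))]
        congr 1; ring
    _ = ENNReal.ofReal (∑ i ∈ Finset.range n, g i * L i ^ 2) :=
        (ENNReal.ofReal_sum_of_nonneg fun i _ => mul_nonneg (hg i) (sq_nonneg _)).symm

open Classical in
/-- `f` is dominated by a superposition of beams of widths `e i`, phases `θ i` and weights `a i`. -/
def BeamBounded (K k : ℝ) (n : ℕ) (a e θ : ℕ → ℝ) (f : ℝ → ℝ → ℝ → ℝ → ℝ≥0∞) : Prop :=
  ∀ u v p l, k * (v - u) / 2 ∈ Ioo 0 (π / 2) → 0 < p → 0 < l →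
    f u v p l ≤ ∑ i ∈ Finset.range n,
      if InBeam K (e i) (θ i) k u v p l then ENNReal.ofReal (a i / e i ^ 2) else 0

section TAdS

variable {K k u v : ℝ} {n : ℕ} {a e θ : ℕ → ℝ} {f : ℝ → ℝ → ℝ → ℝ → ℝ≥0∞} {w : ℝ → ℝ → ℝ}

/-- The factor `tan X` in the momentum bounds compensates `r⁻²` together with `r / ∂_v r`, so that
what remains is bounded up to the axis and to infinity. -/
theorem prefactor_eq (hk : 0 < k) (hX : k * (v - u) / 2 ∈ Ioo 0 (π / 2)) :
    2 / k * (sin (k * (v - u) / 2) * cos (k * (v - u) / 2)) *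
      (π / 2 * (rAdS (-3 * k ^ 2) u v ^ 2)⁻¹) * tan (k * (v - u) / 2)
      = π * k * cos (k * (v - u) / 2) ^ 2 := by
  have hc := cos_pos_of_mem hX
  have hn := sin_pos_of_mem hX
  rw [rAdS_eq hk, tan_eq_sin_div_cos]
  field_simp

/-- The amplitude `a i / e i ^ 2` cancels against the square of the angular momentum range `K e i /
k`: the width of a beam enters only through its profile `D i`. -/
theorem prefactor_mul_le (hk : 0 < k) (hX : k * (v - u) / 2 ∈ Ioo 0 (π / 2)) (hK : 0 ≤ K)
    (ha : ∀ i, 0 ≤ a i) (he : ∀ i, 0 < e i) {D : ℕ → ℝ} (hD : ∀ i, 0 ≤ D i) :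
    ENNReal.ofReal (2 / k * (sin (k * (v - u) / 2) * cos (k * (v - u) / 2))) *
      (ENNReal.ofReal (π / 2 * (rAdS (-3 * k ^ 2) u v ^ 2)⁻¹) * ENNReal.ofReal
        (∑ i ∈ Finset.range n,
          (K * (a i / e i ^ 2) * (D i * tan (k * (v - u) / 2))) * (K * e i / k) ^ 2)) ≤
      ∑ i ∈ Finset.range n, ENNReal.ofReal (π * K ^ 3 / k * a i) * ENNReal.ofReal (D i) := by
  have hc := cos_pos_of_mem hX
  have hn := sin_pos_of_mem hX
  have ht := tan_pos_of_mem hX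
  have hr := rAdS_pos hk hX
  rw [← ENNReal.ofReal_mul (by positivity), ← ENNReal.ofReal_mul (by positivity), ← mul_assoc,
    Finset.mul_sum]
  have hterm : ∀ i ∈ Finset.range n, ENNReal.ofReal (π * K ^ 3 / k * a i) * ENNReal.ofReal (D i)
      = ENNReal.ofReal (π * K ^ 3 / k * a i * D i) := fun i _ =>
    (ENNReal.ofReal_mul (by have := ha i; positivity)).symm
  rw [Finset.sum_congr rfl hterm, ← ENNReal.ofReal_sum_of_nonneg
    (fun i _ => by have := ha i; have := hD i; positivity)]
  refine ENNReal.ofReal_le_ofReal (Finset.sum_le_sum fun i _ => ?_)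
  have h1 := ha i
  have h2 := he i
  have h3 := hD i
  calc _ = (2 / k * (sin (k * (v - u) / 2) * cos (k * (v - u) / 2)) *
      (π / 2 * (rAdS (-3 * k ^ 2) u v ^ 2)⁻¹) * tan (k * (v - u) / 2)) *
        (K ^ 3 * a i * D i / k ^ 2) := by field_simp
    _ = π * K ^ 3 / k * a i * D i * cos (k * (v - u) / 2) ^ 2 := by
        rw [prefactor_eq hk hX]; field_simp
    _ ≤ π * K ^ 3 / k * a i * D i :=
        mul_le_of_le_one_right (by positivity) (pow_le_one₀ hc.le (cos_le_one _))

/-- The hypothesis on `w` covers the weights of `T_vv` and of `T_uv` alike. One power of `Ω² p^u`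
cancels the measure `dp / p`, so the momentum integral is just the length of the interval allowed by
the profile bound. -/
theorem TAdS_le_of_le_pu (hk : 0 < k) (hK : 1 ≤ K) (hX : k * (v - u) / 2 ∈ Ioo 0 (π / 2))
    (ha : ∀ i, 0 ≤ a i) (he : ∀ i, 0 < e i) (hf : BeamBounded K k n a e θ f)
    (hw : ∀ x y, 0 < x → 0 < y → x + y ≤ K → w x y ≤ K * x) :
    ENNReal.ofReal (2 / k * (sin (k * (v - u) / 2) * cos (k * (v - u) / 2))) *
      TAdS (-3 * k ^ 2) w f u v ≤
      ∑ i ∈ Finset.range n, ENNReal.ofReal (π * K ^ 3 / k * a i) *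
        ENNReal.ofReal (profile K (e i) k (k * u - θ i) (v - u)) := by
  have hΩ := Ω2AdS_pos hk hX
  have hr := rAdS_pos hk hX
  have ht := tan_pos_of_mem hX
  have hD : ∀ i, 0 ≤ profile K (e i) k (k * u - θ i) (v - u) :=
    fun i => profile_nonneg (by linarith) (he i).le _ _
  refine le_trans ?_ (prefactor_mul_le hk hX (by linarith) ha he hD)
  unfold TAdS
  gcongr
  set Ω := Ω2AdS (-3 * k ^ 2) u v
  set T : ℕ → ℝ := fun i => profile K (e i) k (k * u - θ i) (v - u) * tan (k * (v - u) / 2)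
  have hT : ∀ i, 0 ≤ T i := fun i => mul_nonneg (hD i) ht.le
  refine lintegral_beams_le (F := fun i l => (Iic (T i / Ω)).indicator fun _ =>
      (Iic (K * e i / k)).indicator (fun l => ENNReal.ofReal (K * (a i / e i ^ 2) * Ω * l)) l)
    (g := fun i => K * (a i / e i ^ 2) * T i) (L := fun i => K * e i / k)
    (fun i => by have := ha i; have := hT i; positivity)
    (fun i => by have := he i; positivity)
    (fun i l => measurable_const.indicator measurableSet_Iic) ?_ ?_
  · intro l hl p hp
    refine (mul_le_mul_right (hf u v p l hX hp hl) _).trans ?_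
    rw [Finset.mul_sum]
    refine Finset.sum_le_sum fun i _ => ?_
    by_cases hB : InBeam K (e i) (θ i) k u v p l
    · have h1 := hB.le_profile_u hK (he i) hk hX hp hl
      have hp' : p ∈ Iic (T i / Ω) := by
        rw [mem_Iic, le_div_iff₀ hΩ]; linarith
      have hl' : l ∈ Iic (K * e i / k) := by
        rw [mem_Iic, le_div_iff₀ hk]; linarith [hB.angular_le]
      rw [if_pos hB,
        indicator_of_mem hp', indicator_of_mem hl',
        ← ENNReal.ofReal_mul' (by have := ha i; positivity)]
      refine ENNReal.ofReal_le_ofReal ?_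
      have h2 := hw _ _ (mul_pos hΩ hp) (show 0 < l ^ 2 / (rAdS (-3 * k ^ 2) u v ^ 2 * p) by
        have : 0 < l := hl
        have : 0 < p := hp
        positivity) hB.energy_le
      have hp0 : 0 < p := hp
      have hl0 : 0 < l := hl
      have hai := ha i
      calc _ ≤ K * (Ω * p) * p⁻¹ * l * (a i / e i ^ 2) := by gcongr
        _ = K * (a i / e i ^ 2) * Ω * l := by field_simp
    · rw [if_neg hB, mul_zero]
      exact zero_le
  · intro i l hl
    have hl0 : 0 < l := hl
    have hai := ha i
    have hTi := hT i
    rw [lintegral_indicator_const measurableSet_Iic, Measure.restrict_apply measurableSet_Iic,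
      Iic_inter_Ioi, Real.volume_Ioc, sub_zero]
    by_cases hl' : l ∈ Iic (K * e i / k)
    · rw [indicator_of_mem hl', indicator_of_mem hl', ← ENNReal.ofReal_mul (by positivity)]
      refine ENNReal.ofReal_le_ofReal ?_
      calc K * (a i / e i ^ 2) * Ω * l * (T i / Ω) = K * (a i / e i ^ 2) * T i * l := by
            field_simp
        _ ≤ _ := by gcongr; exact hl'
    · rw [indicator_of_notMem hl', zero_mul]
      exact zero_le

/-- The bound is now on `Ω² p^v = l² / (r² p)`, whereas integration is still over `p = p^u`. The
weight divided by `p` is a multiple of `l² / (r² p²)`, and `lintegral_div_sq_le` is the change of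
variables from `p^u` to `Ω² p^v`. -/
theorem TAdS_le_of_le_pv (hk : 0 < k) (hK : 1 ≤ K) (hX : k * (v - u) / 2 ∈ Ioo 0 (π / 2))
    (ha : ∀ i, 0 ≤ a i) (he : ∀ i, 0 < e i) (hf : BeamBounded K k n a e θ f)
    (hw : ∀ x y, 0 < x → 0 < y → x + y ≤ K → w x y ≤ K * y) :
    ENNReal.ofReal (2 / k * (sin (k * (v - u) / 2) * cos (k * (v - u) / 2))) *
      TAdS (-3 * k ^ 2) w f u v ≤
      ∑ i ∈ Finset.range n, ENNReal.ofReal (π * K ^ 3 / k * a i) *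
        ENNReal.ofReal (profile K (e i) k (-(k * v - θ i)) (v - u)) := by
  have hΩ := Ω2AdS_pos hk hX
  have hr := rAdS_pos hk hX
  have ht := tan_pos_of_mem hX
  have hD : ∀ i, 0 ≤ profile K (e i) k (-(k * v - θ i)) (v - u) :=
    fun i => profile_nonneg (by linarith) (he i).le _ _
  refine le_trans ?_ (prefactor_mul_le hk hX (by linarith) ha he hD)
  unfold TAdS
  gcongr
  set r := rAdS (-3 * k ^ 2) u v
  set T : ℕ → ℝ := fun i => profile K (e i) k (-(k * v - θ i)) (v - u) * tan (k * (v - u) / 2)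
  have hT : ∀ i, 0 ≤ T i := fun i => mul_nonneg (hD i) ht.le
  have hset : ∀ (i : ℕ) (l : ℝ), MeasurableSet {p : ℝ | 0 < p ∧ l ^ 2 / r ^ 2 / p ≤ T i} :=
    fun i l => measurableSet_div_le _ _
  refine lintegral_beams_le
    (F := fun i l => {p : ℝ | 0 < p ∧ l ^ 2 / r ^ 2 / p ≤ T i}.indicator fun p =>
      (Iic (K * e i / k)).indicator (fun l => ENNReal.ofReal (K * (a i / e i ^ 2) * l)) l *
        ENNReal.ofReal (l ^ 2 / r ^ 2 / p ^ 2))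
    (g := fun i => K * (a i / e i ^ 2) * T i) (L := fun i => K * e i / k)
    (fun i => by have := ha i; have := hT i; positivity)
    (fun i => by have := he i; positivity)
    (fun i l => Measurable.indicator (by fun_prop) (hset i l)) ?_ ?_
  · intro l hl p hp
    have hp0 : 0 < p := hp
    have hl0 : 0 < l := hl
    refine (mul_le_mul_right (hf u v p l hX hp hl) _).trans ?_
    rw [Finset.mul_sum]
    refine Finset.sum_le_sum fun i _ => ?_
    by_cases hB : InBeam K (e i) (θ i) k u v p l
    · have h1 := hB.le_profile_v hK (he i) hk hX hp hl
      have hp' : p ∈ {p : ℝ | 0 < p ∧ l ^ 2 / r ^ 2 / p ≤ T i} := by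
        refine ⟨hp, ?_⟩
        rw [div_div]; exact h1
      have hl' : l ∈ Iic (K * e i / k) := by
        rw [mem_Iic, le_div_iff₀ hk]; linarith [hB.angular_le]
      have hai := ha i
      rw [if_pos hB,
        indicator_of_mem hp', indicator_of_mem hl',
        ← ENNReal.ofReal_mul' (by positivity), ← ENNReal.ofReal_mul' (by positivity)]
      refine ENNReal.ofReal_le_ofReal ?_
      have h2 := hw _ _ (mul_pos hΩ hp)
        (show 0 < l ^ 2 / (rAdS (-3 * k ^ 2) u v ^ 2 * p) by positivity) hB.energy_le
      calc _ ≤ K * (l ^ 2 / (r ^ 2 * p)) * p⁻¹ * l * (a i / e i ^ 2) := by gcongr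
        _ = K * (a i / e i ^ 2) * l * (l ^ 2 / r ^ 2 / p ^ 2) := by field_simp
    · rw [if_neg hB, mul_zero]
      exact zero_le
  · intro i l hl
    have hl0 : 0 < l := hl
    have hai := ha i
    have hTi := hT i
    rw [lintegral_indicator (hset i l), Measure.restrict_restrict (hset i l),
      inter_eq_self_of_subset_left (fun p hp => hp.1), lintegral_const_mul _ (by fun_prop)]
    by_cases hl' : l ∈ Iic (K * e i / k)
    · rw [indicator_of_mem hl', indicator_of_mem hl']
      calc _ ≤ ENNReal.ofReal (K * (a i / e i ^ 2) * l) * ENNReal.ofReal (T i) := by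
            gcongr
            exact lintegral_div_sq_le (by positivity)
        _ = ENNReal.ofReal (K * (a i / e i ^ 2) * T i * l) := by
            rw [← ENNReal.ofReal_mul (by positivity)]; congr 1; ring
        _ ≤ _ := by
            refine ENNReal.ofReal_le_ofReal ?_
            gcongr; exact hl'
    · rw [indicator_of_notMem hl', zero_mul]
      exact zero_le

end TAdS

/-! ### The two suprema in the norm -/

theorem lintegral_Ioo_comp_sub_right (g : ℝ → ℝ≥0∞) (U c : ℝ) :
    ∫⁻ v in Ioo U (U + c), g (v - U) = ∫⁻ z in Ioo 0 c, g z := by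
  rw [← lintegral_indicator measurableSet_Ioo, ← lintegral_indicator measurableSet_Ioo,
    ← lintegral_sub_right_eq_self ((Ioo 0 c).indicator g) U]
  refine lintegral_congr fun v => ?_
  by_cases hv : v ∈ Ioo U (U + c)
  · rw [indicator_of_mem hv, indicator_of_mem (by constructor <;> linarith [hv.1, hv.2])]
  · rw [indicator_of_notMem hv, indicator_of_notMem]
    exact fun h => hv ⟨by linarith [h.1], by linarith [h.2]⟩

theorem lintegral_Ioo_comp_sub_left (g : ℝ → ℝ≥0∞) (V c : ℝ) :
    ∫⁻ u in Ioo (V - c) V, g (V - u) = ∫⁻ z in Ioo 0 c, g z := by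
  rw [← lintegral_indicator measurableSet_Ioo, ← lintegral_indicator measurableSet_Ioo,
    ← lintegral_sub_left_eq_self ((Ioo 0 c).indicator g) V]
  refine lintegral_congr fun u => ?_
  by_cases hu : u ∈ Ioo (V - c) V
  · rw [indicator_of_mem hu, indicator_of_mem (by constructor <;> linarith [hu.1, hu.2])]
  · rw [indicator_of_notMem hu, indicator_of_notMem]
    exact fun h => hu ⟨by linarith [h.2], by linarith [h.1]⟩

section Parts

variable {K k B : ℝ} {n : ℕ} {a e θ : ℕ → ℝ} {f : ℝ → ℝ → ℝ → ℝ → ℝ≥0∞}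

theorem lintegral_sum_profile_le (hk : 0 < k) (hK : 2 ≤ K) (ha : ∀ i, 0 ≤ a i)
    (he : ∀ i, 0 < e i) (φ : ℕ → ℝ)
    (hB : ∑ i ∈ Finset.range n, a i * damping K (e i) (φ i) ≤ B) :
    ∫⁻ z in Ioo 0 (π / k), 2 * ∑ i ∈ Finset.range n, ENNReal.ofReal (π * K ^ 3 / k * a i) *
        ENNReal.ofReal (profile K (e i) k (φ i) z) ≤
      ENNReal.ofReal (400 * π * K ^ 9 / k ^ 2 * B) := by
  have hK0 : 0 < K := by linarith
  have hm : ∀ i, Measurable fun z => ENNReal.ofReal (profile K (e i) k (φ i) z) :=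
    fun i => (measurable_profile _).ennreal_ofReal
  rw [lintegral_const_mul _ (Finset.measurable_fun_sum _ fun i _ => (hm i).const_mul _),
    lintegral_finsetSum _ fun i _ => (hm i).const_mul _]
  calc _ ≤ 2 * ∑ i ∈ Finset.range n, ENNReal.ofReal (π * K ^ 3 / k * a i) *
        ENNReal.ofReal (200 * K ^ 6 / k * damping K (e i) (φ i)) := by
        gcongr with i hi
        rw [lintegral_const_mul _ (hm i)]
        gcongr
        exact lintegral_profile_le _ hK (he i) hk
    _ = ENNReal.ofReal 2 * ENNReal.ofReal (∑ i ∈ Finset.range n, π * K ^ 3 / k * a i *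
        (200 * K ^ 6 / k * damping K (e i) (φ i))) := by
        rw [ENNReal.ofReal_sum_of_nonneg, ENNReal.ofReal_ofNat]
        · congr 1
          refine Finset.sum_congr rfl fun i _ => ?_
          exact (ENNReal.ofReal_mul (by have := ha i; positivity)).symm
        · intro i _
          have := ha i
          have := damping_nonneg (K := K) (he i).le (φ i)
          positivity
    _ = ENNReal.ofReal (400 * π * K ^ 9 / k ^ 2 *
          ∑ i ∈ Finset.range n, a i * damping K (e i) (φ i)) := by
        rw [← ENNReal.ofReal_mul (by norm_num), Finset.mul_sum, Finset.mul_sum]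
        congr 1
        refine Finset.sum_congr rfl fun i _ => ?_
        field_simp; ring
    _ ≤ ENNReal.ofReal (400 * π * K ^ 9 / k ^ 2 * B) := by
        refine ENNReal.ofReal_le_ofReal ?_
        gcongr

theorem outgoingPart_le (hk : 0 < k) (hK : 2 ≤ K) (ha : ∀ i, 0 ≤ a i) (he : ∀ i, 0 < e i)
    (hf : BeamBounded K k n a e θ f)
    (hB : ∀ φ, ∑ i ∈ Finset.range n, a i * damping K (e i) (φ - θ i) ≤ B) :
    outgoingPart (-3 * k ^ 2) f ≤ ENNReal.ofReal (400 * π * K ^ 9 / k ^ 2 * B) := by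
  refine iSup₂_le fun U _ => ?_
  refine le_trans ?_ (lintegral_sum_profile_le hk hK ha he (fun i => k * U - θ i) (hB (k * U)))
  rw [← lintegral_Ioo_comp_sub_right _ U, ← vInf_eq hk]
  refine setLIntegral_mono' measurableSet_Ioo fun v hv => ?_
  have hX := angle_mem hk hv.1 hv.2
  have hc := (cos_pos_of_mem hX).ne'
  -- On AdS `r / ∂_v r` and `r / (-∂_u r)` agree, so both terms have the same prefactor and the same
  -- majorant.
  rw [rOverDvr_eq hk hc, rOverDur_eq hk hc, two_mul]
  have hK1 : 1 ≤ K := by linarith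
  refine add_le_add (TAdS_le_of_le_pu hk hK1 hX ha he hf fun x y hx hy hxy => ?_)
    (TAdS_le_of_le_pu hk hK1 hX ha he hf fun x y hx hy hxy => ?_) <;> nlinarith

theorem ingoingPart_le (hk : 0 < k) (hK : 2 ≤ K) (ha : ∀ i, 0 ≤ a i) (he : ∀ i, 0 < e i)
    (hf : BeamBounded K k n a e θ f)
    (hB : ∀ φ, ∑ i ∈ Finset.range n, a i * damping K (e i) (φ - θ i) ≤ B) :
    ingoingPart (-3 * k ^ 2) f ≤ ENNReal.ofReal (400 * π * K ^ 9 / k ^ 2 * B) := by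
  refine iSup₂_le fun V _ => ?_
  have hB' : ∑ i ∈ Finset.range n, a i * damping K (e i) (-(k * V - θ i)) ≤ B := by
    simpa only [damping, sin_neg, abs_neg] using hB (k * V)
  refine le_trans ?_ (lintegral_sum_profile_le hk hK ha he (fun i => -(k * V - θ i)) hB')
  rw [← lintegral_Ioo_comp_sub_left _ V, ← vInf_eq hk]
  -- The pointwise bounds hold for negative `u` too, so the cut at `u = 0` can be dropped and every
  -- slice has full length.
  refine (lintegral_mono_set (Ioo_subset_Ioo_left (le_max_right _ _))).trans ?_
  refine setLIntegral_mono' measurableSet_Ioo fun u hu => ?_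
  have hX := angle_mem hk hu.2 (by linarith [hu.1])
  have hc := (cos_pos_of_mem hX).ne'
  rw [rOverDvr_eq hk hc, rOverDur_eq hk hc, two_mul]
  have hK1 : 1 ≤ K := by linarith
  refine add_le_add (TAdS_le_of_le_pv hk hK1 hX ha he hf fun x y hx hy hxy => ?_)
    (TAdS_le_of_le_pv hk hK1 hX ha he hf fun x y hx hy hxy => ?_) <;> nlinarith

end Parts

/-! ### Momentum integrals of the seed functions -/

/-- The momentum integral of the total seed function with weights `w` in `p` and `z` in `l`. -/
def beamMoment (Λ : ℝ) (χ : ℝ → ℝ) (a : ℕ → ℝ) (ε : ℝ) (w z : ℝ → ℝ) (v : ℝ) : ℝ :=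
  ∫ l in Ioi (0 : ℝ), ∫ p in Ioi (0 : ℝ), w p * totalSeed Λ χ a ε v p l * z l

section Cutoff

variable {χ : ℝ → ℝ}

theorem IsCutoff.nonneg (h : IsCutoff χ) (x : ℝ) : 0 ≤ χ x := (h.mem_Icc x).1

theorem IsCutoff.le_one (h : IsCutoff χ) (x : ℝ) : χ x ≤ 1 := (h.mem_Icc x).2

theorem IsCutoff.abs_lt (h : IsCutoff χ) {x : ℝ} (hx : χ x ≠ 0) : |x| < 2 := by
  by_contra hcon
  exact hx (h.eq_zero x fun hm => hcon (_root_.abs_lt.2 hm))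

theorem IsCutoff.continuous (h : IsCutoff χ) : Continuous χ := h.smooth.continuous

/-- A nonnegative function on `(0, ∞)` that is at most `C` and vanishes beyond `b`. -/
theorem setIntegral_Ioi_le {g : ℝ → ℝ} {b C : ℝ} (hb : 0 ≤ b)
    (h0 : ∀ x > b, g x = 0) (hC : ∀ x ∈ Ioc 0 b, |g x| ≤ C) :
    ∫ x in Ioi (0 : ℝ), g x ≤ C * b := by
  have e : ∫ x in Ioi (0 : ℝ), g x = ∫ x in Ioc 0 b, g x := by
    refine (setIntegral_eq_of_subset_of_forall_sdiff_eq_zero measurableSet_Ioi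
      Ioc_subset_Ioi_self fun x hx => h0 x ?_)
    by_contra hcon
    exact hx.2 ⟨hx.1, not_lt.1 hcon⟩
  rw [e]
  refine (le_abs_self _).trans ?_
  have := norm_setIntegral_le_of_norm_le_const (μ := volume) (s := Ioc 0 b) (f := g) (C := C)
    measure_Ioc_lt_top hC
  simpa [Measure.real, hb] using this

theorem seed_ne_zero {Λ ε v p l : ℝ} {i : ℕ} (h : IsCutoff χ) (hs : seed Λ χ ε i v p l ≠ 0) :
    |√(-Λ) * (v - center Λ ε i) / epsSeq ε i| < 2 ∧ |p - 3| < 2 ∧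
      |√(-Λ) * l / epsSeq ε i - 4| < 2 := by
  simp only [seed, ne_eq, mul_eq_zero, not_or] at hs
  exact ⟨h.abs_lt hs.1.1.2, h.abs_lt hs.1.2, h.abs_lt hs.2⟩

end Cutoff

section Moments

variable {k κ ε : ℝ} {χ : ℝ → ℝ} {a : ℕ → ℝ} {w z : ℝ → ℝ}

theorem integrableOn_angular (hk : 0 < k) (hs : Small κ ε) (hχ : IsCutoff χ) (hz : Continuous z)
    (i : ℕ) :
    IntegrableOn (fun l => χ (√(-(-3 * k ^ 2)) * l / epsSeq ε i - 4) * z l) (Ioi 0) := by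
  have he := epsSeq_pos hs.eps_pos i
  have hΛ : 0 < √(-(-3 * k ^ 2)) := by rw [sqrt_neg_Λ hk]; positivity
  have hc : Continuous fun l => χ (√(-(-3 * k ^ 2)) * l / epsSeq ε i - 4) * z l :=
    (hχ.continuous.comp (by fun_prop)).mul hz
  refine (hc.integrableOn_Icc (a := 0)
    (b := 6 * epsSeq ε i / √(-(-3 * k ^ 2)))).of_forall_sdiff_eq_zero measurableSet_Ioi
    fun l hl => ?_
  have hl6 : 6 * epsSeq ε i / √(-(-3 * k ^ 2)) < l := by
    by_contra hcon
    exact hl.2 ⟨le_of_lt hl.1, not_lt.1 hcon⟩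
  rw [hχ.eq_zero, zero_mul]
  intro hm
  rw [div_lt_iff₀ hΛ] at hl6
  have h1 : √(-(-3 * k ^ 2)) * l / epsSeq ε i < 6 := by linarith [hm.2]
  rw [div_lt_iff₀ he] at h1
  linarith

/-- The seeds are products of functions of `v`, `p` and `l`, so the double integral factorises.
Continuity in `v`, signs and bounds can then be read off. -/
theorem beamMoment_eq (hk : 0 < k) (hs : Small κ ε) (hχ : IsCutoff χ) (hz : Continuous z)
    (v : ℝ) :
    beamMoment (-3 * k ^ 2) χ a ε w z v
      = (∑ i ∈ Finset.range (numBeams ε + 1), a i * (1 / epsSeq ε i ^ 2 *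
          χ (√(-(-3 * k ^ 2)) * (v - center (-3 * k ^ 2) ε i) / epsSeq ε i)) *
          ∫ l in Ioi (0 : ℝ), χ (√(-(-3 * k ^ 2)) * l / epsSeq ε i - 4) * z l) *
        ∫ p in Ioi (0 : ℝ), w p * χ (p - 3) := by
  have hinner : ∀ l, ∫ p in Ioi (0 : ℝ), w p * totalSeed (-3 * k ^ 2) χ a ε v p l * z l
      = (∑ i ∈ Finset.range (numBeams ε + 1), a i * (1 / epsSeq ε i ^ 2 *
          χ (√(-(-3 * k ^ 2)) * (v - center (-3 * k ^ 2) ε i) / epsSeq ε i)) *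
          (χ (√(-(-3 * k ^ 2)) * l / epsSeq ε i - 4) * z l)) *
        ∫ p in Ioi (0 : ℝ), w p * χ (p - 3) := by
    intro l
    rw [← integral_const_mul]
    refine setIntegral_congr_fun measurableSet_Ioi fun p _ => ?_
    simp only [totalSeed, seed, Finset.mul_sum, Finset.sum_mul]
    refine Finset.sum_congr rfl fun i _ => ?_
    ring
  simp only [beamMoment, hinner]
  rw [integral_mul_const, integral_finsetSum]
  · congr 1
    refine Finset.sum_congr rfl fun i _ => ?_
    rw [integral_const_mul]
  · intro i _
    exact (integrableOn_angular hk hs hχ hz i).const_mul _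

theorem continuous_beamMoment (hk : 0 < k) (hs : Small κ ε) (hχ : IsCutoff χ)
    (hz : Continuous z) : Continuous (beamMoment (-3 * k ^ 2) χ a ε w z) := by
  rw [funext fun v => beamMoment_eq (a := a) (w := w) hk hs hχ hz v]
  have := hχ.continuous
  fun_prop

theorem integral_momentum_nonneg (hχ : IsCutoff χ) (hw : ∀ p > 0, 0 ≤ w p) :
    0 ≤ ∫ p in Ioi (0 : ℝ), w p * χ (p - 3) :=
  setIntegral_nonneg measurableSet_Ioi fun p hp => mul_nonneg (hw p hp) (hχ.nonneg _)

theorem beamMoment_nonneg (hk : 0 < k) (hs : Small κ ε) (hχ : IsCutoff χ)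
    (ha : ∀ i ∈ Finset.range (numBeams ε + 1), 0 ≤ a i) (hz : Continuous z)
    (hz0 : ∀ l > 0, 0 ≤ z l) (hw : ∀ p > 0, 0 ≤ w p) (v : ℝ) :
    0 ≤ beamMoment (-3 * k ^ 2) χ a ε w z v := by
  rw [beamMoment_eq hk hs hχ hz]
  refine mul_nonneg (Finset.sum_nonneg fun i hi => mul_nonneg (mul_nonneg (ha i hi)
    (mul_nonneg (by positivity) (hχ.nonneg _))) ?_) (integral_momentum_nonneg hχ hw)
  exact setIntegral_nonneg measurableSet_Ioi fun l hl => mul_nonneg (hχ.nonneg _) (hz0 l hl)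

/-- Since `l` is at most `6 ε⁽ⁱ⁾ / √(-Λ)`, one factor `l` and the length of the `l` range absorb the
normalisation `(ε⁽ⁱ⁾)⁻²`; the remaining `m` powers of `l` are bounded by `3 / k`. Overlap of the
beams is estimated trivially, at the price of the full sum of the weights. The constant is `300 = 12
* 25`. -/
theorem beamMoment_le {m : ℕ} (hk : 0 < k) (hs : Small κ ε) (hχ : IsCutoff χ)
    (ha : ∀ i ∈ Finset.range (numBeams ε + 1), 0 ≤ a i)
    (hsum : ∑ i ∈ Finset.range (numBeams ε + 1), a i ≤ (rho ε)⁻¹ * sigma ε)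
    (hw : ∀ p > 0, 0 ≤ w p) (hw5 : ∀ p ∈ Icc 1 5, w p ≤ 5) (v : ℝ) :
    beamMoment (-3 * k ^ 2) χ a ε w (fun l => l ^ (m + 1)) v ≤
      300 / k ^ 2 * (3 / k) ^ m * ((rho ε)⁻¹ * sigma ε) := by
  have hz : Continuous fun l : ℝ => l ^ (m + 1) := by fun_prop
  rw [beamMoment_eq hk hs hχ hz]
  have hΛ : 0 < √(-(-3 * k ^ 2)) := by rw [sqrt_neg_Λ hk]; positivity
  have hI : ∫ p in Ioi (0 : ℝ), w p * χ (p - 3) ≤ 5 * 5 := by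
    refine setIntegral_Ioi_le (by norm_num) (fun p hp => ?_) fun p hp => ?_
    · rw [hχ.eq_zero, mul_zero]
      exact fun hm => by linarith [hm.2]
    · by_cases hp1 : 1 ≤ p
      · rw [abs_of_nonneg (mul_nonneg (hw p hp.1) (hχ.nonneg _))]
        have := hw5 p ⟨hp1, hp.2⟩
        exact (mul_le_of_le_one_right (hw p hp.1) (hχ.le_one _)).trans this
      · rw [hχ.eq_zero (p - 3) fun hm => by linarith [hm.1]]; simp
  have hI0 := integral_momentum_nonneg hχ hw
  have hJ : ∀ i, ∫ l in Ioi (0 : ℝ), χ (√(-(-3 * k ^ 2)) * l / epsSeq ε i - 4) * l ^ (m + 1) ≤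
      12 * epsSeq ε i ^ 2 / k ^ 2 * (3 / k) ^ m := by
    intro i
    have he := epsSeq_pos hs.eps_pos i
    have he1 := (epsSeq_le_self hs.eps_pos hs.eps_le i).trans hs.eps_le
    set b := 6 * epsSeq ε i / √(-(-3 * k ^ 2)) with hb
    have hb0 : 0 ≤ b := by positivity
    have hb3 : b ≤ 3 / k := by
      rw [hb, sqrt_neg_Λ hk]
      have := one_le_sqrt_three
      have h2 : k ≤ √3 * k := le_mul_of_one_le_left hk.le this
      gcongr
      linarith
    have hb2 : b * b = 12 * epsSeq ε i ^ 2 / k ^ 2 := by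
      rw [hb, sqrt_neg_Λ hk, div_mul_div_comm,
        show √3 * k * (√3 * k) = (√3 * √3) * k ^ 2 by ring,
        Real.mul_self_sqrt (by norm_num)]
      field_simp; ring
    have := setIntegral_Ioi_le (g := fun l => χ (√(-(-3 * k ^ 2)) * l / epsSeq ε i - 4) * l ^ (m + 1))
      (b := b) (C := b * (3 / k) ^ m) hb0 (fun l hl => ?_) fun l hl => ?_
    · refine this.trans_eq ?_
      rw [← hb2]; ring
    · rw [hχ.eq_zero, zero_mul]
      intro hm
      rw [hb, gt_iff_lt, div_lt_iff₀ hΛ] at hl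
      have h1 : √(-(-3 * k ^ 2)) * l / epsSeq ε i < 6 := by linarith [hm.2]
      rw [div_lt_iff₀ he] at h1
      linarith
    · have hl0 : 0 < l := hl.1
      rw [abs_of_nonneg (mul_nonneg (hχ.nonneg _) (by positivity))]
      refine (mul_le_of_le_one_left (by positivity) (hχ.le_one _)).trans ?_
      rw [pow_succ, mul_comm]
      have h1 := hl.2
      have h2 := h1.trans hb3
      gcongr
  have hterm : ∀ i ∈ Finset.range (numBeams ε + 1), a i * (1 / epsSeq ε i ^ 2 *
          χ (√(-(-3 * k ^ 2)) * (v - center (-3 * k ^ 2) ε i) / epsSeq ε i)) *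
          ∫ l in Ioi (0 : ℝ), χ (√(-(-3 * k ^ 2)) * l / epsSeq ε i - 4) * l ^ (m + 1) ≤
        a i * (12 / k ^ 2 * (3 / k) ^ m) := by
    intro i hi
    have he := epsSeq_pos hs.eps_pos i
    have h1 := ha i hi
    have h2 := hχ.nonneg (√(-(-3 * k ^ 2)) * (v - center (-3 * k ^ 2) ε i) / epsSeq ε i)
    have h3 := hχ.le_one (√(-(-3 * k ^ 2)) * (v - center (-3 * k ^ 2) ε i) / epsSeq ε i)
    calc _ ≤ a i * (1 / epsSeq ε i ^ 2 * 1) * (12 * epsSeq ε i ^ 2 / k ^ 2 * (3 / k) ^ m) := by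
          refine mul_le_mul (by gcongr) (hJ i) ?_ (by positivity)
          exact setIntegral_nonneg measurableSet_Ioi fun l hl =>
            mul_nonneg (hχ.nonneg _) (pow_nonneg (le_of_lt hl) _)
      _ = _ := by field_simp
  calc _ ≤ (∑ i ∈ Finset.range (numBeams ε + 1), a i * (12 / k ^ 2 * (3 / k) ^ m)) * (5 * 5) := by
        refine mul_le_mul (Finset.sum_le_sum hterm) hI hI0 (Finset.sum_nonneg fun i hi => ?_)
        have := ha i hi
        positivity
    _ = (∑ i ∈ Finset.range (numBeams ε + 1), a i) * (300 / k ^ 2 * (3 / k) ^ m) := by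
        rw [← Finset.sum_mul]; ring
    _ ≤ ((rho ε)⁻¹ * sigma ε) * (300 / k ^ 2 * (3 / k) ^ m) := by gcongr
    _ = _ := by ring

/-- The beams sit close to the middle of the initial slice. -/
theorem mem_of_cutoff_ne_zero (hk : 0 < k) (hs : Small κ ε) {i : ℕ} {v : ℝ}
    (h : |√(-(-3 * k ^ 2)) * (v - center (-3 * k ^ 2) ε i) / epsSeq ε i| < 2) :
    |k * v - k * center (-3 * k ^ 2) ε i| ≤ 2 * epsSeq ε i ∧
      k * v ∈ Ioo (π / 2 - 2 * ε) (π / 2 + 4 * (rho ε)⁻¹ * ε) := by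
  have he := epsSeq_pos hs.eps_pos i
  have he1 := epsSeq_le_self hs.eps_pos hs.eps_le i
  have hc := mul_center_mem hk hs i
  have hρ : 1 ≤ (rho ε)⁻¹ := one_le_inv_iff₀.2 ⟨hs.rho_pos, hs.rho_le⟩
  rw [abs_div, abs_of_pos he, div_lt_iff₀ he, sqrt_neg_Λ hk, mul_assoc, mul_sub, abs_mul,
    abs_of_pos (show (0 : ℝ) < √3 by positivity)] at h
  have h1 : |k * v - k * center (-3 * k ^ 2) ε i| < 2 * epsSeq ε i :=
    lt_of_le_of_lt (le_mul_of_one_le_left (abs_nonneg _) one_le_sqrt_three) h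
  obtain ⟨h2, h3⟩ := abs_lt.1 h1
  have h4 : ε ≤ (rho ε)⁻¹ * ε := le_mul_of_one_le_left hs.eps_pos.le hρ
  exact ⟨h1.le, by linarith [hc.1], by linarith [hc.2]⟩

theorem totalSeed_eq_zero (hk : 0 < k) (hs : Small κ ε) (hχ : IsCutoff χ) {v : ℝ}
    (hv : k * v ∉ Ioo (π / 2 - 2 * ε) (π / 2 + 4 * (rho ε)⁻¹ * ε)) (p l : ℝ) :
    totalSeed (-3 * k ^ 2) χ a ε v p l = 0 := by
  refine Finset.sum_eq_zero fun i _ => ?_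
  by_contra hcon
  exact hv (mem_of_cutoff_ne_zero hk hs (seed_ne_zero hχ (right_ne_zero_of_mul hcon)).1).2

theorem beamMoment_eq_zero (hk : 0 < k) (hs : Small κ ε) (hχ : IsCutoff χ) {v : ℝ}
    (hv : k * v ∉ Ioo (π / 2 - 2 * ε) (π / 2 + 4 * (rho ε)⁻¹ * ε)) :
    beamMoment (-3 * k ^ 2) χ a ε w z v = 0 := by
  simp only [beamMoment, totalSeed_eq_zero hk hs hχ hv, mul_zero, zero_mul, integral_zero]

end Moments

/-! ### The energy momentum tensor of the initial data -/

section Tensor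

variable {Λ ε v : ℝ} {χ : ℝ → ℝ} {a : ℕ → ℝ} {S : InitialData}

/-- The substitution `P = ∂_v r p` removes the unknown geometry from the momentum integral, so the
moment depends on the seeds alone. -/
theorem InitialData.Tvv_eq (hr : 0 < deriv S.r v)
    (hf : ∀ p ≥ 0, ∀ l ≥ 0, S.f v p l = totalSeed Λ χ a ε v (deriv S.r v * p) l) :
    S.Tvv v = π / 2 * (S.r v ^ 2)⁻¹ * (S.Ω2 v ^ 2 / deriv S.r v ^ 2 *
      beamMoment Λ χ a ε (fun p => p) (fun l => l ^ 1) v) := by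
  rw [InitialData.Tvv, beamMoment, ← integral_const_mul (S.Ω2 v ^ 2 / deriv S.r v ^ 2)]
  congr 1
  refine setIntegral_congr_fun measurableSet_Ioi fun l hl => ?_
  rw [← integral_const_mul]
  have h1 := integral_comp_mul_left_Ioi
    (fun P => S.Ω2 v ^ 2 / deriv S.r v * (P * totalSeed Λ χ a ε v P l * l ^ 1)) 0 hr
  rw [mul_zero, smul_eq_mul, ← integral_const_mul] at h1
  have h2 : ∀ p ∈ Ioi (0 : ℝ), (S.Ω2 v * p) ^ 2 * S.f v p l * p⁻¹ * l
      = S.Ω2 v ^ 2 / deriv S.r v *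
        (deriv S.r v * p * totalSeed Λ χ a ε v (deriv S.r v * p) l * l ^ 1) := by
    intro p hp
    have hp0 : 0 < p := hp
    rw [hf p hp0.le l (le_of_lt hl)]
    field_simp
  rw [setIntegral_congr_fun measurableSet_Ioi h2, h1]
  refine setIntegral_congr_fun measurableSet_Ioi fun p _ => ?_
  field_simp

theorem InitialData.Tuv_eq (hr : 0 < deriv S.r v)
    (hf : ∀ p ≥ 0, ∀ l ≥ 0, S.f v p l = totalSeed Λ χ a ε v (deriv S.r v * p) l) :
    S.Tuv v = π / 2 * (S.r v ^ 2)⁻¹ * (S.Ω2 v / S.r v ^ 2 *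
      beamMoment Λ χ a ε (fun p => p⁻¹) (fun l => l ^ 3) v) := by
  rw [InitialData.Tuv, beamMoment, ← integral_const_mul (S.Ω2 v / S.r v ^ 2)]
  congr 1
  refine setIntegral_congr_fun measurableSet_Ioi fun l hl => ?_
  rw [← integral_const_mul]
  have h1 := integral_comp_mul_left_Ioi
    (fun P => S.Ω2 v / S.r v ^ 2 * deriv S.r v * (P⁻¹ * totalSeed Λ χ a ε v P l * l ^ 3)) 0 hr
  rw [mul_zero, smul_eq_mul, ← integral_const_mul] at h1
  have h2 : ∀ p ∈ Ioi (0 : ℝ), S.Ω2 v * p * (l ^ 2 / (S.r v ^ 2 * p)) * S.f v p l * p⁻¹ * l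
      = S.Ω2 v / S.r v ^ 2 * deriv S.r v *
        ((deriv S.r v * p)⁻¹ * totalSeed Λ χ a ε v (deriv S.r v * p) l * l ^ 3) := by
    intro p hp
    have hp0 : 0 < p := hp
    rw [hf p hp0.le l (le_of_lt hl), mul_inv, div_eq_mul_inv, div_eq_mul_inv, mul_inv]
    field_simp
  rw [setIntegral_congr_fun measurableSet_Ioi h2, h1]
  refine setIntegral_congr_fun measurableSet_Ioi fun p _ => ?_
  field_simp

end Tensor

/-! ### The radial constraint equation in the normalised gauge -/

theorem sub_le_of_hasDerivAt {f f' : ℝ → ℝ} {x y C : ℝ} (hxy : x ≤ y)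
    (h : ∀ z ∈ Icc x y, HasDerivAt f (f' z) z) (hC : ∀ z ∈ Ioo x y, f' z ≤ C) :
    f y - f x ≤ C * (y - x) := by
  rcases hxy.eq_or_lt with rfl | hlt
  · simp
  obtain ⟨c, hc, hc'⟩ := exists_hasDerivAt_eq_slope f f' hlt
    (fun z hz => (h z hz).continuousAt.continuousWithinAt)
    (fun z hz => h z (Ioo_subset_Icc_self hz))
  have h1 := hC c hc
  rwa [hc', div_le_iff₀ (by linarith)] at h1

theorem le_sub_of_hasDerivAt {f f' : ℝ → ℝ} {x y C : ℝ} (hxy : x ≤ y)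
    (h : ∀ z ∈ Icc x y, HasDerivAt f (f' z) z) (hC : ∀ z ∈ Ioo x y, C ≤ f' z) :
    C * (y - x) ≤ f y - f x := by
  have := sub_le_of_hasDerivAt (f := fun z => -f z) (f' := fun z => -f' z) (C := -C) hxy
    (fun z hz => (h z hz).neg) (fun z hz => neg_le_neg (hC z hz))
  linarith

theorem arctan_le_of_nonneg {x : ℝ} (hx : 0 ≤ x) : arctan x ≤ x := by
  have := Real.le_tan (arctan_nonneg.2 hx) (arctan_lt_pi_div_two x)
  rwa [tan_arctan] at this

/-- The constraint equations of gauge normalised data for the area radius `r` and for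
`q = 2 Ω⁻² ∂_v r`, with a source `G` concentrated in `(vm, vp)`. -/
structure RadialSystem (k vm vp G₀ : ℝ) (r q G : ℝ → ℝ) : Prop where
  r_pos : ∀ v ∈ Ioo 0 (π / k), 0 < r v
  q_pos : ∀ v ∈ Ioo 0 (π / k), 0 < q v
  deriv_r : ∀ v ∈ Ioo 0 (π / k), HasDerivAt r ((1 + k ^ 2 * r v ^ 2) / (2 * q v)) v
  deriv_q : ∀ v ∈ Ioo 0 (π / k),
    HasDerivAt q (-(16 * π ^ 2 * G v / (r v * (1 + k ^ 2 * r v ^ 2)))) v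
  G_nonneg : ∀ v, 0 ≤ G v
  G_le : ∀ v, G v ≤ G₀
  G_zero : ∀ v, v ∉ Ioo vm vp → G v = 0
  axis : Tendsto r (𝓝[>] 0) (𝓝 0)
  infinity : Tendsto r (𝓝[<] (π / k)) atTop
  vm_ge : 1 ≤ k * vm
  vm_lt : vm < vp
  vp_le : k * vp ≤ 2 * π / 3
  small : 16 * π ^ 2 * G₀ * (vp - vm) ≤ vm / 4

namespace RadialSystem

variable {k vm vp G₀ : ℝ} {r q G : ℝ → ℝ}

theorem vm_pos (h : RadialSystem k vm vp G₀ r q G) (hk : 0 < k) :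
    0 < vm := pos_of_mul_pos_right (by linarith [h.vm_ge]) hk.le

theorem vp_lt (h : RadialSystem k vm vp G₀ r q G) (hk : 0 < k) :
    vp < π / k := by
  rw [lt_div_iff₀ hk]
  linarith [h.vp_le, pi_pos]

theorem vm_mem (h : RadialSystem k vm vp G₀ r q G) (hk : 0 < k) :
    vm ∈ Ioo 0 (π / k) := ⟨h.vm_pos hk, h.vm_lt.trans (h.vp_lt hk)⟩

theorem vp_mem (h : RadialSystem k vm vp G₀ r q G) (hk : 0 < k) :
    vp ∈ Ioo 0 (π / k) := ⟨(h.vm_pos hk).trans h.vm_lt, h.vp_lt hk⟩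

theorem source_nonneg (h : RadialSystem k vm vp G₀ r q G)
    {v : ℝ} (hv : v ∈ Ioo 0 (π / k)) :
    0 ≤ 16 * π ^ 2 * G v / (r v * (1 + k ^ 2 * r v ^ 2)) := by
  have := h.r_pos v hv
  have := h.G_nonneg v
  positivity

theorem q_antitone (h : RadialSystem k vm vp G₀ r q G)
    {x y : ℝ} (hx : x ∈ Ioo 0 (π / k)) (hy : y ∈ Ioo 0 (π / k)) (hxy : x ≤ y) :
    q y ≤ q x := by
  have hmem : ∀ z ∈ Icc x y, z ∈ Ioo 0 (π / k) := fun z hz =>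
    ⟨hx.1.trans_le hz.1, hz.2.trans_lt hy.2⟩
  have := sub_le_of_hasDerivAt (C := 0) hxy (fun z hz => h.deriv_q z (hmem z hz))
    (fun z hz => neg_nonpos.2 (h.source_nonneg (hmem z (Ioo_subset_Icc_self hz))))
  linarith

theorem r_monotone (h : RadialSystem k vm vp G₀ r q G)
    {x y : ℝ} (hx : x ∈ Ioo 0 (π / k)) (hy : y ∈ Ioo 0 (π / k)) (hxy : x ≤ y) :
    r x ≤ r y := by
  have hmem : ∀ z ∈ Icc x y, z ∈ Ioo 0 (π / k) := fun z hz =>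
    ⟨hx.1.trans_le hz.1, hz.2.trans_lt hy.2⟩
  have := le_sub_of_hasDerivAt (C := 0) hxy (fun z hz => h.deriv_r z (hmem z hz))
    (fun z hz => by
      have := h.q_pos z (hmem z (Ioo_subset_Icc_self hz))
      positivity)
  linarith

theorem q_eq_of_source_zero (h : RadialSystem k vm vp G₀ r q G)
    {x y : ℝ} (hx : x ∈ Ioo 0 (π / k)) (hy : y ∈ Ioo 0 (π / k))
    (hxy : x ≤ y) (h0 : ∀ z ∈ Ioo x y, G z = 0) : q y = q x := by
  have hmem : ∀ z ∈ Icc x y, z ∈ Ioo 0 (π / k) := fun z hz =>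
    ⟨hx.1.trans_le hz.1, hz.2.trans_lt hy.2⟩
  have h1 := le_sub_of_hasDerivAt (C := 0) hxy (fun z hz => h.deriv_q z (hmem z hz))
    (fun z hz => by rw [h0 z hz]; simp)
  have h2 := h.q_antitone hx hy hxy
  linarith

theorem q_eq_before (h : RadialSystem k vm vp G₀ r q G) (hk : 0 < k)
    {v : ℝ} (hv : v ∈ Ioc 0 vm) : q v = q vm :=
  (h.q_eq_of_source_zero ⟨hv.1, hv.2.trans_lt (h.vm_mem hk).2⟩ (h.vm_mem hk) hv.2
    fun z hz => h.G_zero z fun hm => by linarith [hz.2, hm.1]).symm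

theorem q_eq_after (h : RadialSystem k vm vp G₀ r q G) (hk : 0 < k)
    {v : ℝ} (hv : v ∈ Ico vp (π / k)) : q v = q vp :=
  h.q_eq_of_source_zero (h.vp_mem hk) ⟨(h.vp_mem hk).1.trans_le hv.1, hv.2⟩ hv.1
    fun z hz => h.G_zero z fun hm => by linarith [hz.1, hm.2]

theorem q_le (h : RadialSystem k vm vp G₀ r q G) (hk : 0 < k)
    {v : ℝ} (hv : v ∈ Ioo 0 (π / k)) : q v ≤ q vm := by
  rcases le_total v vm with hle | hle
  · exact (h.q_eq_before hk ⟨hv.1, hle⟩).le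
  · exact h.q_antitone (h.vm_mem hk) hv hle

theorem le_q (h : RadialSystem k vm vp G₀ r q G) (hk : 0 < k)
    {v : ℝ} (hv : v ∈ Ioo 0 (π / k)) : q vp ≤ q v := by
  rcases le_total vp v with hle | hle
  · exact (h.q_eq_after hk ⟨hle, hv.2⟩).ge
  · exact h.q_antitone hv (h.vp_mem hk) hle

/-- The area radius at the inner edge of the source. -/
theorem le_r_vm (h : RadialSystem k vm vp G₀ r q G) (hk : 0 < k) :
    vm / (2 * q vm) ≤ r vm := by
  have hvm := h.vm_mem hk
  have hq := h.q_pos vm hvm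
  have hlim : Tendsto (fun v => 1 / (2 * q vm) * (vm - v)) (𝓝[>] 0)
      (𝓝 (1 / (2 * q vm) * (vm - 0))) :=
    ((continuous_const.mul (continuous_const.sub continuous_id)).tendsto 0).mono_left
      nhdsWithin_le_nhds
  have hlim2 : Tendsto (fun v => r vm - r v) (𝓝[>] 0) (𝓝 (r vm - 0)) :=
    tendsto_const_nhds.sub h.axis
  have := le_of_tendsto_of_tendsto hlim hlim2 (by
    filter_upwards [Ioo_mem_nhdsGT hvm.1] with v hv
    have hmem : ∀ z ∈ Icc v vm, z ∈ Ioo 0 (π / k) := fun z hz =>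
      ⟨hv.1.trans_le hz.1, hz.2.trans_lt hvm.2⟩
    refine le_sub_of_hasDerivAt hv.2.le (fun z hz => h.deriv_r z (hmem z hz)) fun z hz => ?_
    rw [h.q_eq_before hk ⟨hv.1.trans hz.1, hz.2.le⟩]
    gcongr
    have : 0 ≤ k ^ 2 * r z ^ 2 := by positivity
    linarith)
  rw [sub_zero, sub_zero] at this
  exact le_trans (le_of_eq (by ring)) this

/-- The loss of `q` across the source is at most `16 π² G₀ (vp - vm) / r vm`, and `r vm ≥ vm / (2 q
vm)` bounds this by a multiple of `q vm` itself. The estimate thus closes without any prior bound on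
`q`. -/
theorem half_le_q_ratio (h : RadialSystem k vm vp G₀ r q G) (hk : 0 < k) :
    q vm / 2 ≤ q vp := by
  have hvm := h.vm_mem hk
  have hvp := h.vp_mem hk
  have hq := h.q_pos vm hvm
  have hr := h.r_pos vm hvm
  have hvm0 := h.vm_pos hk
  have hmem : ∀ z ∈ Icc vm vp, z ∈ Ioo 0 (π / k) := fun z hz =>
    ⟨hvm.1.trans_le hz.1, hz.2.trans_lt hvp.2⟩
  have hG₀ : 0 ≤ G₀ := (h.G_nonneg 0).trans (h.G_le 0)
  have h1 := le_sub_of_hasDerivAt (C := -(16 * π ^ 2 * G₀ / r vm)) h.vm_lt.le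
    (fun z hz => h.deriv_q z (hmem z hz)) (fun z hz => by
      refine neg_le_neg ?_
      have h2 := h.r_monotone hvm (hmem z (Ioo_subset_Icc_self hz)) hz.1.le
      have h3 := h.G_le z
      have h4 := h.G_nonneg z
      have h5 : r vm ≤ r z * (1 + k ^ 2 * r z ^ 2) :=
        h2.trans (le_mul_of_one_le_right (by linarith) (by
          have : 0 ≤ k ^ 2 * r z ^ 2 := by positivity
          linarith))
      gcongr)
  have h2 := h.le_r_vm hk
  rw [div_le_iff₀ (by positivity)] at h2
  have h3 : 16 * π ^ 2 * G₀ / r vm * (vp - vm) ≤ q vm / 2 := by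
    rw [div_mul_eq_mul_div, div_le_iff₀ hr]
    linarith [h.small]
  linarith

/-- `y = (2/k) arctan (k r)` is the affine variable with `y' = 1/q`. -/
theorem hasDerivAt_arctan (h : RadialSystem k vm vp G₀ r q G) (hk : 0 < k)
    {v : ℝ} (hv : v ∈ Ioo 0 (π / k)) :
    HasDerivAt (fun w => 2 / k * arctan (k * r w)) (1 / q v) v := by
  have hq := h.q_pos v hv
  have h1 := (((h.deriv_r v hv).const_mul k).arctan).const_mul (2 / k)
  refine h1.congr_deriv ?_
  have : 1 + (k * r v) ^ 2 ≠ 0 := by positivity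
  have : 1 + k ^ 2 * r v ^ 2 ≠ 0 := by positivity
  rw [mul_pow] at *
  field_simp

theorem tendsto_arctan_axis (h : RadialSystem k vm vp G₀ r q G) :
    Tendsto (fun w => 2 / k * arctan (k * r w)) (𝓝[>] 0) (𝓝 0) := by
  have := ((continuous_arctan.tendsto _).comp (h.axis.const_mul k)).const_mul (2 / k)
  simpa using this

theorem tendsto_arctan_infinity (h : RadialSystem k vm vp G₀ r q G) (hk : 0 < k)
    :
    Tendsto (fun w => 2 / k * arctan (k * r w)) (𝓝[<] (π / k)) (𝓝 (π / k)) := by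
  have h1 : Tendsto (fun w => arctan (k * r w)) (𝓝[<] (π / k)) (𝓝 (π / 2)) :=
    (tendsto_arctan_atTop.mono_right nhdsWithin_le_nhds).comp
      (h.infinity.const_mul_atTop hk)
  have := h1.const_mul (2 / k)
  rwa [show 2 / k * (π / 2) = π / k by ring] at this

theorem arctan_infinity_sub (h : RadialSystem k vm vp G₀ r q G) (hk : 0 < k)
    {x C : ℝ} (hx : x ∈ Ioo 0 (π / k))
    (hC : ∀ z ∈ Ioo 0 (π / k), C ≤ 1 / q z) :
    C * (π / k - x) ≤ π / k - 2 / k * arctan (k * r x) := by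
  have hlim : Tendsto (fun v => C * (v - x)) (𝓝[<] (π / k)) (𝓝 (C * (π / k - x))) :=
    ((continuous_const.mul (continuous_id.sub continuous_const)).tendsto _).mono_left
      nhdsWithin_le_nhds
  refine le_of_tendsto_of_tendsto hlim
    ((h.tendsto_arctan_infinity hk).sub_const (2 / k * arctan (k * r x))) ?_
  filter_upwards [Ioo_mem_nhdsLT hx.2] with v hv
  have hmem : ∀ z ∈ Icc x v, z ∈ Ioo 0 (π / k) := fun z hz =>
    ⟨hx.1.trans_le hz.1, hz.2.trans_lt hv.2⟩
  exact le_sub_of_hasDerivAt hv.1.le (fun z hz => h.hasDerivAt_arctan hk (hmem z hz))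
    fun z hz => hC z (hmem z (Ioo_subset_Icc_self hz))

theorem arctan_infinity_sub' (h : RadialSystem k vm vp G₀ r q G) (hk : 0 < k)
    {x C : ℝ} (hx : x ∈ Ioo 0 (π / k))
    (hC : ∀ z ∈ Ioo 0 (π / k), 1 / q z ≤ C) :
    π / k - 2 / k * arctan (k * r x) ≤ C * (π / k - x) := by
  have hlim : Tendsto (fun v => C * (v - x)) (𝓝[<] (π / k)) (𝓝 (C * (π / k - x))) :=
    ((continuous_const.mul (continuous_id.sub continuous_const)).tendsto _).mono_left
      nhdsWithin_le_nhds
  refine le_of_tendsto_of_tendsto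
    ((h.tendsto_arctan_infinity hk).sub_const (2 / k * arctan (k * r x))) hlim ?_
  filter_upwards [Ioo_mem_nhdsLT hx.2] with v hv
  have hmem : ∀ z ∈ Icc x v, z ∈ Ioo 0 (π / k) := fun z hz =>
    ⟨hx.1.trans_le hz.1, hz.2.trans_lt hv.2⟩
  exact sub_le_of_hasDerivAt hv.1.le (fun z hz => h.hasDerivAt_arctan hk (hmem z hz))
    fun z hz => hC z (hmem z (Ioo_subset_Icc_self hz))

/-- As `v` runs through `(0, π / k)`, so does `(2/k) arctan (k r)`, whose derivative is `1 / q`. The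
mean of `1 / q` is therefore one, and the maximum `q vm` of `q` is at least one; in the same way the
minimum `q vp` is at most one. -/
theorem one_le_q_vm (h : RadialSystem k vm vp G₀ r q G) (hk : 0 < k) :
    1 ≤ q vm := by
  have hq := h.q_pos vm (h.vm_mem hk)
  have hL : 0 < π / k := by positivity
  have hlim : Tendsto (fun v => 1 / q vm * (π / k - v)) (𝓝[>] 0)
      (𝓝 (1 / q vm * (π / k - 0))) :=
    ((continuous_const.mul (continuous_const.sub continuous_id)).tendsto 0).mono_left
      nhdsWithin_le_nhds
  have := le_of_tendsto_of_tendsto hlim (tendsto_const_nhds.sub (h.tendsto_arctan_axis)) (by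
    filter_upwards [Ioo_mem_nhdsGT hL] with v hv
    exact h.arctan_infinity_sub hk hv fun z hz =>
      one_div_le_one_div_of_le (h.q_pos z hz) (h.q_le hk hz))
  rw [sub_zero, one_div_mul_eq_div, div_le_iff₀ hq] at this
  nlinarith

theorem q_vp_le_one (h : RadialSystem k vm vp G₀ r q G) (hk : 0 < k) :
    q vp ≤ 1 := by
  have hq := h.q_pos vp (h.vp_mem hk)
  have hL : 0 < π / k := by positivity
  have hlim : Tendsto (fun v => 1 / q vp * (π / k - v)) (𝓝[>] 0)
      (𝓝 (1 / q vp * (π / k - 0))) :=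
    ((continuous_const.mul (continuous_const.sub continuous_id)).tendsto 0).mono_left
      nhdsWithin_le_nhds
  have := le_of_tendsto_of_tendsto (tendsto_const_nhds.sub (h.tendsto_arctan_axis)) hlim (by
    filter_upwards [Ioo_mem_nhdsGT hL] with v hv
    exact h.arctan_infinity_sub' hk hv fun z hz =>
      one_div_le_one_div_of_le hq (h.le_q hk hz))
  rw [sub_zero, one_div_mul_eq_div, le_div_iff₀ hq] at this
  nlinarith

theorem q_mem (h : RadialSystem k vm vp G₀ r q G) (hk : 0 < k)
    {v : ℝ} (hv : v ∈ Ioo 0 (π / k)) : q v ∈ Icc (1 / 2) 2 := by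
  have h1 := h.one_le_q_vm hk
  have h2 := h.q_vp_le_one hk
  have h3 := h.half_le_q_ratio hk
  have h4 := h.q_le hk hv
  have h5 := h.le_q hk hv
  constructor <;> linarith

theorem mul_r_le (h : RadialSystem k vm vp G₀ r q G) (hk : 0 < k)
    {v : ℝ} (hv : v ∈ Ioc 0 vp) : k * r v ≤ 4 := by
  have hmem : v ∈ Ioo 0 (π / k) := ⟨hv.1, hv.2.trans_lt (h.vp_mem hk).2⟩
  have hkr : 0 < k * r v := mul_pos hk (h.r_pos v hmem)
  have h1 := h.arctan_infinity_sub hk hmem (C := 1 / 2) fun z hz =>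
    one_div_le_one_div_of_le (h.q_pos z hz) (h.q_mem hk hz).2
  have h2 : k * v ≤ 2 * π / 3 := (mul_le_mul_of_nonneg_left hv.2 hk.le).trans h.vp_le
  -- From `k v ≤ 2 π / 3` at least `π / 3` of phase is left before infinity, and it is covered with
  -- speed at least `1 / 2`. Then `(k r)⁻¹ ≥ arctan ((k r)⁻¹) ≥ π / 12 ≥ 1 / 4`.
  have h3 : arctan (k * r v) ≤ π / 2 - π / 12 := by
    have e1 : k * (1 / 2 * (π / k - v)) = (π - k * v) / 2 := by field_simp
    have e2 : k * (π / k - 2 / k * arctan (k * r v)) = π - 2 * arctan (k * r v) := by field_simp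
    have := mul_le_mul_of_nonneg_left h1 hk.le
    rw [e1, e2] at this
    linarith
  have h4 := arctan_inv_of_pos hkr
  have h5 : arctan ((k * r v)⁻¹) ≤ (k * r v)⁻¹ := arctan_le_of_nonneg (by positivity)
  have h6 : 1 / 4 ≤ (k * r v)⁻¹ := by
    have := pi_gt_three
    linarith
  rw [← inv_inv (k * r v)]
  exact (inv_anti₀ (by norm_num) h6).trans (by norm_num)

theorem le_mul_r (h : RadialSystem k vm vp G₀ r q G) (hk : 0 < k)
    {v : ℝ} (hv : v ∈ Ico vm (π / k)) : 1 / 4 ≤ k * r v := by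
  have hvm := h.vm_mem hk
  have h1 := h.le_r_vm hk
  have h2 := (h.q_mem hk hvm).2
  have hq := h.q_pos vm hvm
  have h3 := h.r_monotone hvm ⟨hvm.1.trans_le hv.1, hv.2⟩ hv.1
  have h4 : vm / 4 ≤ vm / (2 * q vm) := by
    have := hvm.1
    gcongr
    linarith
  have h5 : k * (vm / 4) ≤ k * r v := mul_le_mul_of_nonneg_left (by linarith) hk.le
  linarith [h.vm_ge]

/-- `∂_v r` is comparable to `1` where the source is. -/
theorem deriv_r_mem (h : RadialSystem k vm vp G₀ r q G) (hk : 0 < k)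
    {v : ℝ} (hv : v ∈ Ioc 0 vp) :
    (1 + k ^ 2 * r v ^ 2) / (2 * q v) ∈ Icc (1 / 4) 17 := by
  have hmem : v ∈ Ioo 0 (π / k) := ⟨hv.1, hv.2.trans_lt (h.vp_mem hk).2⟩
  have h1 := h.q_mem hk hmem
  have h2 := h.mul_r_le hk hv
  have hkr : 0 < k * r v := mul_pos hk (h.r_pos v hmem)
  have hq := h.q_pos v hmem
  rw [← mul_pow]
  constructor
  · rw [le_div_iff₀ (by positivity)]
    nlinarith [h1.2]
  · rw [div_le_iff₀ (by positivity)]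
    nlinarith [h1.1]

end RadialSystem

namespace InitialData

/-! ### Regularity and monotonicity of asymptotically AdS data -/

section General

variable {Λ v : ℝ} {S : InitialData}

theorem IsAsymptoticallyAdS.hasDerivAt_r (h : S.IsAsymptoticallyAdS Λ) (hv : v ∈ Ioo 0 (vInf Λ)) :
    HasDerivAt S.r (deriv S.r v) v :=
  (((h.smooth_r.mono Ioo_subset_Ico_self).differentiableOn (by simp)).differentiableAt
    (isOpen_Ioo.mem_nhds hv)).hasDerivAt

theorem IsAsymptoticallyAdS.differentiableAt_Ω2 (h : S.IsAsymptoticallyAdS Λ)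
    (hv : v ∈ Ioo 0 (vInf Λ)) : DifferentiableAt ℝ S.Ω2 v :=
  ((h.smooth_Ω2.mono Ioo_subset_Ico_self).differentiableOn (by simp)).differentiableAt
    (isOpen_Ioo.mem_nhds hv)

theorem IsAsymptoticallyAdS.differentiableAt_deriv_r (h : S.IsAsymptoticallyAdS Λ)
    (hv : v ∈ Ioo 0 (vInf Λ)) : DifferentiableAt ℝ (deriv S.r) v :=
  (((h.smooth_r.mono Ioo_subset_Ico_self).deriv_of_isOpen isOpen_Ioo
    (m := ∞) (by simp)).differentiableOn (by simp)).differentiableAt (isOpen_Ioo.mem_nhds hv)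

theorem IsAsymptoticallyAdS.hasDerivAt_constraint (h : S.IsAsymptoticallyAdS Λ)
    (hv : v ∈ Ioo 0 (vInf Λ)) :
    HasDerivAt (fun w => (S.Ω2 w)⁻¹ * deriv S.r w)
      (-4 * π * S.r v * S.Tvv v * (S.Ω2 v)⁻¹) v := by
  rw [← h.constraint v hv]
  exact (((h.differentiableAt_Ω2 hv).inv (h.Ω2_pos v hv).ne').mul
    (h.differentiableAt_deriv_r hv)).hasDerivAt

theorem IsAsymptoticallyAdS.Tvv_nonneg (h : S.IsAsymptoticallyAdS Λ)
    (hv : v ∈ Ioo 0 (vInf Λ)) : 0 ≤ S.Tvv v := by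
  refine mul_nonneg (by positivity) (setIntegral_nonneg measurableSet_Ioi fun l hl =>
    setIntegral_nonneg measurableSet_Ioi fun p hp => ?_)
  have hp0 : 0 < p := hp
  have hl0 : 0 < l := hl
  have := h.f_nonneg v hv p hp0.le l hl0.le
  positivity

theorem IsAsymptoticallyAdS.tendsto_r_infinity (h : S.IsAsymptoticallyAdS Λ)
    (hL : 0 < vInf Λ) : Tendsto S.r (𝓝[<] (vInf Λ)) atTop := by
  obtain ⟨g, hg, hgr, hg0, -⟩ := h.inv_r_infinity
  have h1 : Tendsto g (𝓝[<] (vInf Λ)) (𝓝[>] 0) := by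
    refine tendsto_nhdsWithin_iff.2 ⟨?_, ?_⟩
    · have h2 := (hg.continuousOn (vInf Λ) ⟨hL, le_rfl⟩).tendsto
      rw [hg0] at h2
      refine h2.mono_left ?_
      rw [← nhdsWithin_Ioo_eq_nhdsLT hL]
      exact nhdsWithin_mono _ Ioo_subset_Ioc_self
    · filter_upwards [Ioo_mem_nhdsLT hL] with v hv
      rw [hgr v hv]
      exact one_div_pos.2 (h.r_pos v hv)
  refine (tendsto_inv_nhdsGT_zero.comp h1).congr' ?_
  filter_upwards [Ioo_mem_nhdsLT hL] with v hv
  simp only [Function.comp, hgr v hv, one_div, inv_inv]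

theorem IsAsymptoticallyAdS.tendsto_r_axis (h : S.IsAsymptoticallyAdS Λ) (hL : 0 < vInf Λ) :
    Tendsto S.r (𝓝[>] 0) (𝓝 0) := by
  have h2 := (h.smooth_r.continuousOn 0 ⟨le_rfl, hL⟩).tendsto
  rw [h.r_axis] at h2
  refine h2.mono_left ?_
  rw [← nhdsWithin_Ioo_eq_nhdsGT hL]
  exact nhdsWithin_mono _ Ioo_subset_Ico_self

/-- `∂_v r > 0`: the radius could not become infinite otherwise, `Ω⁻² ∂_v r` being
nonincreasing. -/
theorem IsAsymptoticallyAdS.deriv_r_pos (h : S.IsAsymptoticallyAdS Λ)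
    (hv : v ∈ Ioo 0 (vInf Λ)) : 0 < deriv S.r v := by
  by_contra hcon
  push Not at hcon
  have hL : 0 < vInf Λ := hv.1.trans hv.2
  have hneg : ∀ w ∈ Ico v (vInf Λ), deriv S.r w ≤ 0 := by
    intro w hw
    have hmem : ∀ z ∈ Icc v w, z ∈ Ioo 0 (vInf Λ) := fun z hz =>
      ⟨hv.1.trans_le hz.1, hz.2.trans_lt hw.2⟩
    have h1 := sub_le_of_hasDerivAt (C := 0) hw.1
      (fun z hz => h.hasDerivAt_constraint (hmem z hz)) (fun z hz => by
        have hz' := hmem z (Ioo_subset_Icc_self hz)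
        have a1 := h.r_pos z hz'
        have a2 := h.Tvv_nonneg hz'
        have a3 := h.Ω2_pos z hz'
        have : 0 ≤ 4 * π * S.r z * S.Tvv z * (S.Ω2 z)⁻¹ := by positivity
        linarith)
    have h2 : (S.Ω2 v)⁻¹ * deriv S.r v ≤ 0 :=
      mul_nonpos_of_nonneg_of_nonpos (inv_nonneg.2 (h.Ω2_pos v hv).le) hcon
    have h3 : (S.Ω2 w)⁻¹ * deriv S.r w ≤ 0 := by linarith
    have h4 := inv_pos.2 (h.Ω2_pos w (hmem w ⟨hw.1, le_rfl⟩))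
    by_contra h5
    push Not at h5
    linarith [mul_pos h4 h5]
  have hev : ∀ᶠ w in 𝓝[<] (vInf Λ), S.r w ≤ S.r v := by
    filter_upwards [Ioo_mem_nhdsLT hv.2] with w hw
    have := sub_le_of_hasDerivAt (C := 0) hw.1.le
      (fun z hz => h.hasDerivAt_r (v := z) ⟨hv.1.trans_le hz.1, hz.2.trans_lt hw.2⟩)
      (fun z hz => hneg z ⟨hz.1.le, hz.2.trans hw.2⟩)
    linarith
  obtain ⟨w, hw1, hw2⟩ := (hev.and
    ((h.tendsto_r_infinity hL).eventually_gt_atTop (S.r v))).exists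
  linarith

end General

/-! ### Gauge normalised data launched by beams -/

/-- `q = 2 Ω⁻² ∂_v r`. -/
def invSpeed (S : InitialData) (v : ℝ) : ℝ := 2 * ((S.Ω2 v)⁻¹ * deriv S.r v)

section Normalised

variable {k v : ℝ} {S : InitialData}

theorem IsAsymptoticallyAdS.invSpeed_pos {Λ : ℝ} (h : S.IsAsymptoticallyAdS Λ)
    (hv : v ∈ Ioo 0 (vInf Λ)) : 0 < S.invSpeed v :=
  mul_pos two_pos (mul_pos (inv_pos.2 (h.Ω2_pos v hv)) (h.deriv_r_pos hv))

theorem gauge_eq (h : S.IsAsymptoticallyAdS (-3 * k ^ 2))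
    (hg : S.IsGaugeNormalised (-3 * k ^ 2)) (hv : v ∈ Ioo 0 (vInf (-3 * k ^ 2))) :
    S.Ω2 v * (1 + k ^ 2 * S.r v ^ 2) = 4 * deriv S.r v ^ 2 := by
  have h1 := hg v hv
  have h2 := h.deriv_r_pos hv
  have e : 1 - 1 / 3 * (-3 * k ^ 2) * S.r v ^ 2 = 1 + k ^ 2 * S.r v ^ 2 := by ring
  rw [e, div_eq_div_iff (by positivity) (by positivity)] at h1
  linarith

theorem deriv_r_eq (h : S.IsAsymptoticallyAdS (-3 * k ^ 2))
    (hg : S.IsGaugeNormalised (-3 * k ^ 2)) (hv : v ∈ Ioo 0 (vInf (-3 * k ^ 2))) :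
    deriv S.r v = (1 + k ^ 2 * S.r v ^ 2) / (2 * S.invSpeed v) := by
  have h1 := gauge_eq h hg hv
  have h2 := h.deriv_r_pos hv
  have h3 := h.Ω2_pos v hv
  rw [invSpeed, eq_div_iff (by positivity)]
  field_simp
  linarith

theorem Ω2_eq (h : S.IsAsymptoticallyAdS (-3 * k ^ 2))
    (hg : S.IsGaugeNormalised (-3 * k ^ 2)) (hv : v ∈ Ioo 0 (vInf (-3 * k ^ 2))) :
    S.Ω2 v = (1 + k ^ 2 * S.r v ^ 2) / S.invSpeed v ^ 2 := by
  have h1 := gauge_eq h hg hv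
  have h2 := h.deriv_r_pos hv
  have h3 := h.Ω2_pos v hv
  rw [invSpeed, eq_div_iff (by positivity)]
  field_simp
  linarith

end Normalised

/-- Gauge normalised asymptotically AdS data whose Vlasov part is the total seed function, with
the smallness that the estimates use. -/
structure IsBeamData (k κ ε : ℝ) (χ : ℝ → ℝ) (a : ℕ → ℝ) (S : InitialData) : Prop where
  k_pos : 0 < k
  small : Small κ ε
  κ_le : κ ≤ 1 / 20
  κ_le_sq : 2000000 * κ ≤ k ^ 2
  cutoff : IsCutoff χ
  a_mem : ∀ i ∈ Finset.range (numBeams ε + 1), a i ∈ Icc 0 (sigma ε)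
  a_sum : ∑ i ∈ Finset.range (numBeams ε + 1), a i ≤ (rho ε)⁻¹ * sigma ε
  adS : S.IsAsymptoticallyAdS (-3 * k ^ 2)
  gauge : S.IsGaugeNormalised (-3 * k ^ 2)
  f_eq : ∀ v ∈ Ioo 0 (vInf (-3 * k ^ 2)), ∀ p ≥ 0, ∀ l ≥ 0,
      S.f v p l = totalSeed (-3 * k ^ 2) χ a ε v (deriv S.r v * p) l

/-- The inner edge of the beams. -/
def innerEdge (k ε : ℝ) : ℝ := (π / 2 - 2 * ε) / k

/-- The outer edge of the beams. -/
def outerEdge (k ε : ℝ) : ℝ := (π / 2 + 4 * (rho ε)⁻¹ * ε) / k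

namespace IsBeamData

variable {k κ ε : ℝ} {χ : ℝ → ℝ} {a : ℕ → ℝ} {S : InitialData}

theorem rho_inv_ge (h : IsBeamData k κ ε χ a S) : 1 ≤ (rho ε)⁻¹ :=
  one_le_inv_iff₀.2 ⟨h.small.rho_pos, h.small.rho_le⟩

theorem rho_inv_mul_le (h : IsBeamData k κ ε χ a S) : (rho ε)⁻¹ * ε ≤ 1 / 20 := by
  have h1 := h.small.rho_eps
  have h2 := h.rho_inv_ge
  have h3 : (rho ε)⁻¹ * ε ≤ (rho ε)⁻¹ ^ 2 * ε := by
    have := h.small.eps_pos.le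
    gcongr
    exact le_self_pow₀ h2 (by norm_num)
  linarith [h.κ_le]

theorem eps_le (h : IsBeamData k κ ε χ a S) : ε ≤ 1 / 20 :=
  (le_mul_of_one_le_left h.small.eps_pos.le h.rho_inv_ge).trans h.rho_inv_mul_le

theorem mem_edges_iff (h : IsBeamData k κ ε χ a S) {v : ℝ} :
    v ∈ Ioo (innerEdge k ε) (outerEdge k ε) ↔
      k * v ∈ Ioo (π / 2 - 2 * ε) (π / 2 + 4 * (rho ε)⁻¹ * ε) := by
  simp only [innerEdge, outerEdge, mem_Ioo, div_lt_iff₀ h.k_pos, lt_div_iff₀ h.k_pos,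
    mul_comm v k]

theorem a_nonneg (h : IsBeamData k κ ε χ a S) :
    ∀ i ∈ Finset.range (numBeams ε + 1), 0 ≤ a i := fun i hi => (h.a_mem i hi).1

theorem sourceG_le (h : IsBeamData k κ ε χ a S) (v : ℝ) :
    beamMoment (-3 * k ^ 2) χ a ε (fun p => p) (fun l => l ^ 1) v ≤
      300 / k ^ 2 * ((rho ε)⁻¹ * sigma ε) := by
  have := beamMoment_le (m := 0) (w := fun p => p) h.k_pos h.small h.cutoff h.a_nonneg h.a_sum
    (fun p hp => le_of_lt hp) (fun p hp => hp.2) v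
  simpa using this

theorem sourceH_le (h : IsBeamData k κ ε χ a S) (v : ℝ) :
    beamMoment (-3 * k ^ 2) χ a ε (fun p => p⁻¹) (fun l => l ^ 3) v ≤
      300 / k ^ 2 * (3 / k) ^ 2 * ((rho ε)⁻¹ * sigma ε) :=
  beamMoment_le (m := 2) (w := fun p => p⁻¹) h.k_pos h.small h.cutoff h.a_nonneg h.a_sum
    (fun p hp => (inv_pos.2 hp).le)
    (fun p hp => (inv_le_one_of_one_le₀ hp.1).trans (by norm_num)) v

theorem sourceG_nonneg (h : IsBeamData k κ ε χ a S) (v : ℝ) :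
    0 ≤ beamMoment (-3 * k ^ 2) χ a ε (fun p => p) (fun l => l ^ 1) v :=
  beamMoment_nonneg h.k_pos h.small h.cutoff h.a_nonneg (by fun_prop)
    (fun l hl => pow_nonneg (le_of_lt hl) _) (fun p hp => le_of_lt hp) v

theorem sourceH_nonneg (h : IsBeamData k κ ε χ a S) (v : ℝ) :
    0 ≤ beamMoment (-3 * k ^ 2) χ a ε (fun p => p⁻¹) (fun l => l ^ 3) v :=
  beamMoment_nonneg h.k_pos h.small h.cutoff h.a_nonneg (by fun_prop)
    (fun l hl => pow_nonneg (le_of_lt hl) _) (fun p hp => (inv_pos.2 hp).le) v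

theorem rho_sigma_eps_le (h : IsBeamData k κ ε χ a S) :
    (rho ε)⁻¹ * sigma ε * ((rho ε)⁻¹ * ε) ≤ κ * sigma ε := by
  have h1 := h.small.rho_eps
  have h2 := h.small.sigma_pos
  calc (rho ε)⁻¹ * sigma ε * ((rho ε)⁻¹ * ε) = (rho ε)⁻¹ ^ 2 * ε * sigma ε := by ring
    _ ≤ κ * sigma ε := by gcongr

theorem edges_sub_le (h : IsBeamData k κ ε χ a S) :
    outerEdge k ε - innerEdge k ε ≤ 6 * ((rho ε)⁻¹ * ε) / k := by
  rw [outerEdge, innerEdge, ← sub_div]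
  have h1 := h.k_pos
  have h2 : ε ≤ (rho ε)⁻¹ * ε := le_mul_of_one_le_left h.small.eps_pos.le h.rho_inv_ge
  gcongr
  linarith

theorem radialSystem (h : IsBeamData k κ ε χ a S) :
    RadialSystem k (innerEdge k ε) (outerEdge k ε) (300 / k ^ 2 * ((rho ε)⁻¹ * sigma ε))
      S.r S.invSpeed (beamMoment (-3 * k ^ 2) χ a ε (fun p => p) (fun l => l ^ 1)) := by
  have hk := h.k_pos
  have hvI := vInf_eq hk
  have hL : 0 < vInf (-3 * k ^ 2) := by rw [hvI]; positivity
  have hpi := pi_gt_three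
  have hpi4 := pi_le_four
  have hεpos := h.small.eps_pos
  have hρε : 0 < (rho ε)⁻¹ * ε := mul_pos (inv_pos.2 h.small.rho_pos) hεpos
  have e1 : k * innerEdge k ε = π / 2 - 2 * ε := by rw [innerEdge]; field_simp
  have e2 : k * outerEdge k ε = π / 2 + 4 * (rho ε)⁻¹ * ε := by rw [outerEdge]; field_simp
  have hε20 := h.eps_le
  have hρ20 := h.rho_inv_mul_le
  refine ⟨?_, ?_, ?_, ?_, h.sourceG_nonneg, h.sourceG_le, ?_, h.adS.tendsto_r_axis hL, ?_, ?_, ?_,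
    ?_, ?_⟩
  · rw [← hvI]; exact h.adS.r_pos
  · rw [← hvI]; exact fun v hv => h.adS.invSpeed_pos hv
  · rw [← hvI]; intro v hv
    rw [← deriv_r_eq h.adS h.gauge hv]
    exact h.adS.hasDerivAt_r hv
  · rw [← hvI]; intro v hv
    have h1 := (h.adS.hasDerivAt_constraint hv).const_mul 2
    -- The gauge condition expresses `∂_v r ^ 2` through `Ω²`, which then drops out of the
    -- constraint.
    refine h1.congr_deriv ?_
    have hr' := h.adS.deriv_r_pos hv
    have hr := h.adS.r_pos v hv
    have hΩ := h.adS.Ω2_pos v hv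
    rw [Tvv_eq hr' (h.f_eq v hv)]
    have hge := gauge_eq h.adS h.gauge hv
    have h1 : deriv S.r v ^ 2 = S.Ω2 v * (1 + k ^ 2 * S.r v ^ 2) / 4 := by linarith
    rw [h1]
    field_simp
    ring
  · intro v hv
    exact beamMoment_eq_zero hk h.small h.cutoff fun hm => hv (h.mem_edges_iff.2 hm)
  · rw [← hvI]; exact h.adS.tendsto_r_infinity hL
  · rw [e1]; linarith
  · have := lt_of_mul_lt_mul_left (a := k)
      (show k * innerEdge k ε < k * outerEdge k ε by rw [e1, e2]; linarith) hk.le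
    exact this
  · rw [e2]; linarith
  · have h1 := h.edges_sub_le
    have h2 := h.rho_sigma_eps_le
    have h3 := h.small.sigma_pos
    have h4 := h.κ_le_sq
    have h5 : 1 ≤ k * innerEdge k ε := by rw [e1]; linarith
    have hπ2 : π ^ 2 ≤ 10 := by nlinarith [pi_lt_d2]
    have hκ : 0 ≤ κ := le_trans (by positivity) h.small.rho_eps
    have hρσ : 0 ≤ (rho ε)⁻¹ * sigma ε := mul_nonneg (inv_nonneg.2 h.small.rho_pos.le) h3.le
    -- Source strength times width contains `ρ⁻² ε ≤ κ`. The numerical factor is `288000 = 160 * 300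
    -- * 6`, and `κ_le_sq` leaves room to spare for it.
    calc 16 * π ^ 2 * (300 / k ^ 2 * ((rho ε)⁻¹ * sigma ε)) * (outerEdge k ε - innerEdge k ε)
        ≤ 16 * 10 * (300 / k ^ 2 * ((rho ε)⁻¹ * sigma ε)) * (6 * ((rho ε)⁻¹ * ε) / k) := by
          have : 0 ≤ outerEdge k ε - innerEdge k ε := by
            have : innerEdge k ε ≤ outerEdge k ε :=
              le_of_mul_le_mul_left (by rw [e1, e2]; linarith) hk
            linarith
          gcongr
      _ = 288000 / (k ^ 2 * k) * ((rho ε)⁻¹ * sigma ε * ((rho ε)⁻¹ * ε)) := by field_simp; ring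
      _ ≤ 288000 / (k ^ 2 * k) * (κ * 1) := by
          refine mul_le_mul_of_nonneg_left ?_ (by positivity)
          exact h2.trans (mul_le_mul_of_nonneg_left h.small.sigma_le hκ)
      _ = 288000 * κ / (k ^ 2 * k) := by ring
      _ ≤ (k ^ 2 / 4) / (k ^ 2 * k) := by gcongr; linarith
      _ = 1 / k / 4 := by field_simp
      _ ≤ innerEdge k ε / 4 := by
          gcongr
          rw [div_le_iff₀ hk]; linarith

theorem source_zero (h : IsBeamData k κ ε χ a S) {w z : ℝ → ℝ} {v : ℝ}
    (hv : v ∉ Ioo (innerEdge k ε) (outerEdge k ε)) :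
    beamMoment (-3 * k ^ 2) χ a ε w z v = 0 :=
  beamMoment_eq_zero h.k_pos h.small h.cutoff fun hm => hv (h.mem_edges_iff.2 hm)

end IsBeamData

end InitialData

namespace InitialData

/-! ### The renormalised Hawking mass of gauge normalised data -/

/-- The integrand in the definition of `∂_u r`. -/
def durIntegrand (Λ : ℝ) (S : InitialData) (w : ℝ) : ℝ :=
  -(1 / 2) * (1 - Λ * (S.r w) ^ 2) * S.Ω2 w + 8 * π * (S.r w) ^ 2 * S.Tuv w

/-- `2 m̃ / q` for gauge normalised data, where `q = 2 Ω⁻² ∂_v r`. -/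
def massPotential (k : ℝ) (S : InitialData) (v : ℝ) : ℝ :=
  (∫ w in (0 : ℝ)..v, S.durIntegrand (-3 * k ^ 2) w) +
    S.r v * (1 + k ^ 2 * S.r v ^ 2) / S.invSpeed v

theorem renMass_eq {k v : ℝ} {S : InitialData} (h : S.IsAsymptoticallyAdS (-3 * k ^ 2))
    (hg : S.IsGaugeNormalised (-3 * k ^ 2)) (hv : v ∈ Ioo 0 (vInf (-3 * k ^ 2))) :
    S.renMass (-3 * k ^ 2) v = S.invSpeed v / 2 * S.massPotential k v := by
  have hq := h.invSpeed_pos hv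
  have hr := h.r_pos v hv
  rw [renMass, hawkingMass, massPotential, deriv_r_eq h hg hv, Ω2_eq h hg hv,
    show S.dur (-3 * k ^ 2) v = 1 / (2 * S.r v) *
      ∫ w in (0 : ℝ)..v, S.durIntegrand (-3 * k ^ 2) w from rfl]
  generalize (∫ w in (0 : ℝ)..v, S.durIntegrand (-3 * k ^ 2) w) = J
  field_simp
  ring

namespace IsBeamData

variable {k κ ε : ℝ} {χ : ℝ → ℝ} {a : ℕ → ℝ} {S : InitialData}

theorem sq_mul_Tuv (h : IsBeamData k κ ε χ a S) {v : ℝ} (hv : v ∈ Ioo 0 (vInf (-3 * k ^ 2))) :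
    8 * π * S.r v ^ 2 * S.Tuv v = 4 * π ^ 2 * S.Ω2 v / S.r v ^ 2 *
      beamMoment (-3 * k ^ 2) χ a ε (fun p => p⁻¹) (fun l => l ^ 3) v := by
  have hr := h.adS.r_pos v hv
  rw [Tuv_eq (h.adS.deriv_r_pos hv) (h.f_eq v hv)]
  field_simp
  ring

theorem continuousOn_durIntegrand (h : IsBeamData k κ ε χ a S) :
    ContinuousOn (S.durIntegrand (-3 * k ^ 2)) (Ico 0 (vInf (-3 * k ^ 2))) := by
  have hr := h.adS.smooth_r.continuousOn
  have hΩ := h.adS.smooth_Ω2.continuousOn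
  have hm := (h.radialSystem.vm_mem h.k_pos)
  refine ContinuousOn.add (((continuousOn_const.mul
    (continuousOn_const.sub (continuousOn_const.mul (hr.pow 2)))).mul hΩ)) ?_
  intro v hv
  rcases hv.1.eq_or_lt with rfl | hv0
  -- The factor `r⁻²` is singular at the axis, but the matter term vanishes near it since the beams
  -- start at `innerEdge`.
  · have hzero : ∀ w ∈ Ico (0 : ℝ) (vInf (-3 * k ^ 2)), w < innerEdge k ε →
        8 * π * S.r w ^ 2 * S.Tuv w = 0 := by
      intro w hw hwm
      rcases hw.1.eq_or_lt with rfl | hw0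
      · simp [h.adS.r_axis]
      · rw [h.sq_mul_Tuv ⟨hw0, hw.2⟩, h.source_zero fun hc => by linarith [hc.1], mul_zero]
    refine (continuousWithinAt_const (b := (0 : ℝ))).congr_of_eventuallyEq ?_
      (hzero 0 hv hm.1)
    filter_upwards [self_mem_nhdsWithin, nhdsWithin_le_nhds (Iio_mem_nhds hm.1)] with w hw hw'
    exact hzero w hw hw'
  · have hvI : v ∈ Ioo 0 (vInf (-3 * k ^ 2)) := ⟨hv0, hv.2⟩
    have hc : ContinuousAt (fun v => 4 * π ^ 2 * S.Ω2 v / S.r v ^ 2 *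
        beamMoment (-3 * k ^ 2) χ a ε (fun p => p⁻¹) (fun l => l ^ 3) v) v := by
      have c1 : ContinuousAt S.Ω2 v := (h.adS.differentiableAt_Ω2 hvI).continuousAt
      have c2 : ContinuousAt S.r v := (h.adS.hasDerivAt_r hvI).continuousAt
      have c3 := (continuous_beamMoment (a := a) (w := fun p => p⁻¹) (z := fun l => l ^ 3)
        h.k_pos h.small h.cutoff (by fun_prop)).continuousAt (x := v)
      exact ((continuousAt_const.mul c1).div (c2.pow 2)
        (pow_ne_zero 2 (h.adS.r_pos v hvI).ne')).mul c3
    refine (hc.congr ?_).continuousWithinAt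
    filter_upwards [isOpen_Ioo.mem_nhds hvI] with w hw
    exact (h.sq_mul_Tuv hw).symm

theorem intervalIntegrable_durIntegrand (h : IsBeamData k κ ε χ a S) {v : ℝ}
    (hv : v ∈ Ioo 0 (vInf (-3 * k ^ 2))) :
    IntervalIntegrable (S.durIntegrand (-3 * k ^ 2)) volume 0 v := by
  refine (h.continuousOn_durIntegrand.mono ?_).intervalIntegrable
  rw [uIcc_of_le hv.1.le]
  exact fun w hw => ⟨hw.1, hw.2.trans_lt hv.2⟩

/-- The vacuum part of the integrand for `∂_u r`, namely `-(1 + 3 k² r²)(1 + k² r²) / (2 q²)`,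
cancels the derivative of `r (1 + k² r²)` divided by `q`. Only the two matter terms are left; both
are nonnegative and supported in the beams. -/
theorem hasDerivAt_massPotential (h : IsBeamData k κ ε χ a S) {v : ℝ}
    (hv : v ∈ Ioo 0 (vInf (-3 * k ^ 2))) :
    HasDerivAt (S.massPotential k)
      (4 * π ^ 2 * (1 + k ^ 2 * S.r v ^ 2) / (S.invSpeed v ^ 2 * S.r v ^ 2) *
          beamMoment (-3 * k ^ 2) χ a ε (fun p => p⁻¹) (fun l => l ^ 3) v +
        16 * π ^ 2 / S.invSpeed v ^ 2 *
          beamMoment (-3 * k ^ 2) χ a ε (fun p => p) (fun l => l ^ 1) v) v := by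
  have hk := h.k_pos
  have hsys := h.radialSystem
  have hv' : v ∈ Ioo 0 (π / k) := by rwa [← vInf_eq hk]
  have hq := h.adS.invSpeed_pos hv
  have hr := h.adS.r_pos v hv
  have hcont : ContinuousOn (S.durIntegrand (-3 * k ^ 2)) (Ioo 0 (vInf (-3 * k ^ 2))) :=
    h.continuousOn_durIntegrand.mono Ioo_subset_Ico_self
  have hJ := intervalIntegral.integral_hasDerivAt_right (h.intervalIntegrable_durIntegrand hv)
    (hcont.stronglyMeasurableAtFilter isOpen_Ioo v hv) (hcont.continuousAt (isOpen_Ioo.mem_nhds hv))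
  have hdr := hsys.deriv_r v hv'
  have hdq := hsys.deriv_q v hv'
  have hnum := hdr.mul (((hdr.pow 2).const_mul (k ^ 2)).const_add 1)
  have hfull := hJ.add (hnum.div hdq hq.ne')
  refine HasDerivAt.congr_deriv hfull ?_
  rw [durIntegrand, h.sq_mul_Tuv hv, Ω2_eq h.adS h.gauge hv]
  simp only [Pi.pow_apply, Pi.mul_apply, Nat.cast_ofNat, Nat.add_one_sub_one, pow_one]
  field_simp
  ring

theorem tendsto_massPotential_axis (h : IsBeamData k κ ε χ a S) :
    Tendsto (S.massPotential k) (𝓝[>] 0) (𝓝 0) := by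
  have hk := h.k_pos
  have hsys := h.radialSystem
  have hm := hsys.vm_mem hk
  have hmI : innerEdge k ε ∈ Ioo 0 (vInf (-3 * k ^ 2)) := by rwa [vInf_eq hk]
  have h1 : Tendsto (fun v => ∫ w in (0 : ℝ)..v, S.durIntegrand (-3 * k ^ 2) w) (𝓝[>] 0) (𝓝 0) := by
    have hint := (h.intervalIntegrable_durIntegrand hmI)
    rw [intervalIntegrable_iff_integrableOn_Icc_of_le hm.1.le, ← uIcc_of_le hm.1.le] at hint
    have hc := (intervalIntegral.continuousOn_primitive_interval hint) 0 left_mem_uIcc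
    have ht := hc.tendsto
    rw [intervalIntegral.integral_same] at ht
    refine ht.mono_left ?_
    rw [← nhdsWithin_Ioo_eq_nhdsGT hm.1, uIcc_of_le hm.1.le]
    exact nhdsWithin_mono _ Ioo_subset_Icc_self
  have hr := hsys.axis
  have h2 : Tendsto (fun v => S.r v * (1 + k ^ 2 * S.r v ^ 2) / S.invSpeed (innerEdge k ε))
      (𝓝[>] 0) (𝓝 (0 * (1 + k ^ 2 * 0 ^ 2) / S.invSpeed (innerEdge k ε))) :=
    (hr.mul (((hr.pow 2).const_mul _).const_add 1)).div_const _
  have h3 := h1.add h2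
  rw [zero_mul, zero_div, add_zero] at h3
  refine h3.congr' ?_
  filter_upwards [Ioo_mem_nhdsGT hm.1] with v hv
  rw [massPotential, hsys.q_eq_before hk ⟨hv.1, hv.2.le⟩]

theorem massPotential_deriv_le (h : IsBeamData k κ ε χ a S) {v : ℝ}
    (hv : v ∈ Ico (innerEdge k ε) (outerEdge k ε)) :
    4 * π ^ 2 * (1 + k ^ 2 * S.r v ^ 2) / (S.invSpeed v ^ 2 * S.r v ^ 2) *
          beamMoment (-3 * k ^ 2) χ a ε (fun p => p⁻¹) (fun l => l ^ 3) v +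
        16 * π ^ 2 / S.invSpeed v ^ 2 *
          beamMoment (-3 * k ^ 2) χ a ε (fun p => p) (fun l => l ^ 1) v ≤
      200000000 / k ^ 2 * ((rho ε)⁻¹ * sigma ε) := by
  have hk := h.k_pos
  have hsys := h.radialSystem
  have hm := hsys.vm_mem hk
  have hp := hsys.vp_mem hk
  have hv' : v ∈ Ioo 0 (π / k) := ⟨hm.1.trans_le hv.1, hv.2.trans hp.2⟩
  have hq := (hsys.q_mem hk hv').1
  have h1 := hsys.mul_r_le hk ⟨hv'.1, hv.2.le⟩
  have h2 := hsys.le_mul_r hk ⟨hv.1, hv'.2⟩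
  have hG := h.sourceG_le v
  have hH := h.sourceH_le v
  have hG0 := h.sourceG_nonneg v
  have hH0 := h.sourceH_nonneg v
  have hπ2 : π ^ 2 ≤ 10 := by nlinarith [pi_lt_d2, pi_pos]
  have hrpos := hsys.r_pos v hv'
  have hqpos := hsys.q_pos v hv'
  have hρσ : 0 ≤ (rho ε)⁻¹ * sigma ε :=
    mul_nonneg (inv_nonneg.2 h.small.rho_pos.le) h.small.sigma_pos.le
  have hq2 : (1 / 4 : ℝ) ≤ S.invSpeed v ^ 2 := by nlinarith
  have hr1 : 1 + k ^ 2 * S.r v ^ 2 ≤ 17 := by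
    rw [← mul_pow]; nlinarith [mul_pos hk hrpos]
  have hr2 : 1 / (16 * k ^ 2) ≤ S.r v ^ 2 := by
    rw [div_le_iff₀ (by positivity)]
    nlinarith [mul_pos hk hrpos]
  calc _ ≤ 4 * 10 * 17 / (1 / 4 * (1 / (16 * k ^ 2))) *
          (300 / k ^ 2 * (3 / k) ^ 2 * ((rho ε)⁻¹ * sigma ε)) +
        16 * 10 / (1 / 4) * (300 / k ^ 2 * ((rho ε)⁻¹ * sigma ε)) := by gcongr
    _ = 117696000 / k ^ 2 * ((rho ε)⁻¹ * sigma ε) := by field_simp; ring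
    _ ≤ _ := by gcongr; norm_num

/-- The mass aspect is constant beyond the beams, nonnegative, and bounded by `σ`. -/
theorem massPotential_outer (h : IsBeamData k κ ε χ a S) :
    S.massPotential k (outerEdge k ε) ∈ Icc 0 (1200000000 * κ / k ^ 3 * sigma ε) ∧
    ∀ v ∈ Ico (outerEdge k ε) (vInf (-3 * k ^ 2)),
      S.massPotential k v = S.massPotential k (outerEdge k ε) := by
  have hk := h.k_pos
  have hsys := h.radialSystem
  have hm := hsys.vm_mem hk
  have hp := hsys.vp_mem hk
  have hvI := vInf_eq hk
  have hder := fun v (hv : v ∈ Ioo 0 (π / k)) =>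
    h.hasDerivAt_massPotential (v := v) (by rwa [hvI])
  have hlow : S.massPotential k (innerEdge k ε) = 0 := by
    have hconst : ∀ v ∈ Ioo 0 (innerEdge k ε),
        S.massPotential k v = S.massPotential k (innerEdge k ε) := by
      intro v hv
      have hmem : ∀ z ∈ Icc v (innerEdge k ε), z ∈ Ioo 0 (π / k) := fun z hz =>
        ⟨hv.1.trans_le hz.1, hz.2.trans_lt hm.2⟩
      have hz0 : ∀ z ∈ Ioo v (innerEdge k ε), z ∉ Ioo (innerEdge k ε) (outerEdge k ε) :=
        fun z hz hc => by linarith [hz.2, hc.1]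
      have h1 := sub_le_of_hasDerivAt (C := 0) hv.2.le (fun z hz => hder z (hmem z hz))
        (fun z hz => by rw [h.source_zero (hz0 z hz), h.source_zero (hz0 z hz)]; simp)
      have h2 := le_sub_of_hasDerivAt (C := 0) hv.2.le (fun z hz => hder z (hmem z hz))
        (fun z hz => by rw [h.source_zero (hz0 z hz), h.source_zero (hz0 z hz)]; simp)
      linarith
    refine tendsto_nhds_unique (tendsto_const_nhds.congr' ?_) h.tendsto_massPotential_axis
    filter_upwards [Ioo_mem_nhdsGT hm.1] with v hv
    exact (hconst v hv).symm
  have hmem : ∀ z ∈ Icc (innerEdge k ε) (outerEdge k ε), z ∈ Ioo 0 (π / k) := fun z hz =>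
    ⟨hm.1.trans_le hz.1, hz.2.trans_lt hp.2⟩
  refine ⟨⟨?_, ?_⟩, ?_⟩
  · have h2 := le_sub_of_hasDerivAt (C := 0) hsys.vm_lt.le (fun z hz => hder z (hmem z hz))
      (fun z hz => by
        have := h.sourceG_nonneg z
        have := h.sourceH_nonneg z
        positivity)
    linarith
  · have h1 := sub_le_of_hasDerivAt hsys.vm_lt.le (fun z hz => hder z (hmem z hz))
      (fun z hz => h.massPotential_deriv_le (Ioo_subset_Ico_self hz))
    have hρσ : 0 ≤ (rho ε)⁻¹ * sigma ε :=
      mul_nonneg (inv_nonneg.2 h.small.rho_pos.le) h.small.sigma_pos.le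
    rw [hlow, sub_zero] at h1
    refine h1.trans ?_
    calc 200000000 / k ^ 2 * ((rho ε)⁻¹ * sigma ε) * (outerEdge k ε - innerEdge k ε)
        ≤ 200000000 / k ^ 2 * ((rho ε)⁻¹ * sigma ε) * (6 * ((rho ε)⁻¹ * ε) / k) := by
          gcongr
          exact h.edges_sub_le
      _ = 1200000000 / k ^ 3 * ((rho ε)⁻¹ * sigma ε * ((rho ε)⁻¹ * ε)) := by field_simp; ring
      _ ≤ 1200000000 / k ^ 3 * (κ * sigma ε) :=
          mul_le_mul_of_nonneg_left h.rho_sigma_eps_le (by positivity)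
      _ = _ := by ring
  · intro v hv
    rw [hvI] at hv
    have hmem : ∀ z ∈ Icc (outerEdge k ε) v, z ∈ Ioo 0 (π / k) := fun z hz =>
      ⟨hp.1.trans_le hz.1, hz.2.trans_lt hv.2⟩
    have hz0 : ∀ z ∈ Ioo (outerEdge k ε) v, z ∉ Ioo (innerEdge k ε) (outerEdge k ε) :=
      fun z hz hc => by linarith [hz.1, hc.2]
    have h1 := sub_le_of_hasDerivAt (C := 0) hv.1 (fun z hz => hder z (hmem z hz))
      (fun z hz => by rw [h.source_zero (hz0 z hz), h.source_zero (hz0 z hz)]; simp)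
    have h2 := le_sub_of_hasDerivAt (C := 0) hv.1 (fun z hz => hder z (hmem z hz))
      (fun z hz => by rw [h.source_zero (hz0 z hz), h.source_zero (hz0 z hz)]; simp)
    linarith

/-- The renormalised mass at infinity of gauge normalised beam data. -/
theorem exists_mass (h : IsBeamData k κ ε χ a S) :
    ∃ M ∈ Icc 0 (1200000000 * κ / k ^ 3 * sigma ε),
      ∀ v ∈ Ico (outerEdge k ε) (vInf (-3 * k ^ 2)), S.renMass (-3 * k ^ 2) v = M := by
  have hk := h.k_pos
  have hsys := h.radialSystem
  have hp := hsys.vp_mem hk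
  obtain ⟨⟨h0, h1⟩, h2⟩ := h.massPotential_outer
  have hq := hsys.q_mem hk hp
  refine ⟨S.invSpeed (outerEdge k ε) / 2 * S.massPotential k (outerEdge k ε), ⟨?_, ?_⟩, ?_⟩
  · exact mul_nonneg (by linarith [hq.1]) h0
  · exact (mul_le_of_le_one_left h0 (by linarith [hq.2])).trans h1
  · intro v hv
    have hv' : v ∈ Ioo 0 (vInf (-3 * k ^ 2)) := ⟨hp.1.trans_le hv.1, hv.2⟩
    rw [renMass_eq h.adS h.gauge hv', h2 v hv, hsys.q_eq_after hk]
    rwa [← vInf_eq hk]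

end IsBeamData

end InitialData

/-! ### Gauge transformations -/

/-- Diffeomorphisms of `[0, L]` which fix the end points. -/
structure IsGaugeMap (L : ℝ) (V : ℝ → ℝ) : Prop where
  smooth : ContDiffOn ℝ ∞ V (Icc 0 L)
  deriv_pos : ∀ v ∈ Icc 0 L, 0 < derivWithin V (Icc 0 L) v
  map_zero : V 0 = 0
  map_top : V L = L

namespace IsGaugeMap

variable {L v : ℝ} {V W : ℝ → ℝ}

theorem hasDerivWithinAt (h : IsGaugeMap L V) (hv : v ∈ Icc 0 L) :
    HasDerivWithinAt V (derivWithin V (Icc 0 L) v) (Icc 0 L) v :=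
  (h.smooth.differentiableOn (by simp) v hv).hasDerivWithinAt

theorem hasDerivAt (h : IsGaugeMap L V) (hv : v ∈ Ioo 0 L) :
    HasDerivAt V (derivWithin V (Icc 0 L) v) v :=
  (h.hasDerivWithinAt (Ioo_subset_Icc_self hv)).hasDerivAt (Icc_mem_nhds hv.1 hv.2)

theorem strictMonoOn (h : IsGaugeMap L V) : StrictMonoOn V (Icc 0 L) := by
  refine strictMonoOn_of_deriv_pos (convex_Icc _ _) h.smooth.continuousOn fun v hv => ?_
  rw [interior_Icc] at hv
  rw [(h.hasDerivAt hv).deriv]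
  exact h.deriv_pos v (Ioo_subset_Icc_self hv)

theorem mapsTo_Ioo (h : IsGaugeMap L V) : MapsTo V (Ioo 0 L) (Ioo 0 L) := by
  intro v hv
  have hL : 0 ≤ L := (hv.1.trans hv.2).le
  have h1 := h.strictMonoOn (left_mem_Icc.2 hL) (Ioo_subset_Icc_self hv) hv.1
  have h2 := h.strictMonoOn (Ioo_subset_Icc_self hv) (right_mem_Icc.2 hL) hv.2
  rw [h.map_zero] at h1
  rw [h.map_top] at h2
  exact ⟨h1, h2⟩

theorem mapsTo_Ico (h : IsGaugeMap L V) : MapsTo V (Ico 0 L) (Ico 0 L) := by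
  intro v hv
  rcases hv.1.eq_or_lt with h0 | h0
  · rw [← h0, h.map_zero]
    exact ⟨le_rfl, hv.1.trans_lt hv.2⟩
  · exact Ioo_subset_Ico_self (h.mapsTo_Ioo ⟨h0, hv.2⟩)

theorem mapsTo_Icc (h : IsGaugeMap L V) : MapsTo V (Icc 0 L) (Icc 0 L) := by
  intro v hv
  rcases hv.2.eq_or_lt with h0 | h0
  · rw [h0, h.map_top]
    exact ⟨hv.1.trans hv.2, le_rfl⟩
  · exact Ico_subset_Icc_self (h.mapsTo_Ico ⟨hv.1, h0⟩)

theorem surjOn (h : IsGaugeMap L V) (hL : 0 < L) : SurjOn V (Icc 0 L) (Icc 0 L) := by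
  have h1 := intermediate_value_Icc hL.le h.smooth.continuousOn
  rwa [h.map_zero, h.map_top] at h1

theorem image_Ioo (h : IsGaugeMap L V) (hv : v ∈ Ioo 0 L) : V '' Ioo 0 v = Ioo 0 (V v) := by
  have hL : 0 < L := hv.1.trans hv.2
  have h0 : (0 : ℝ) ∈ Icc 0 L := left_mem_Icc.2 hL.le
  ext y
  constructor
  · rintro ⟨w, hw, rfl⟩
    have hw' : w ∈ Ioo 0 L := ⟨hw.1, hw.2.trans hv.2⟩
    exact ⟨(h.mapsTo_Ioo hw').1,
      h.strictMonoOn (Ioo_subset_Icc_self hw') (Ioo_subset_Icc_self hv) hw.2⟩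
  · intro hy
    have hVv := h.mapsTo_Ioo hv
    obtain ⟨w, hw, rfl⟩ := h.surjOn hL ⟨hy.1.le, (hy.2.trans hVv.2).le⟩
    refine ⟨w, ⟨(h.strictMonoOn.lt_iff_lt h0 hw).1 ?_,
      (h.strictMonoOn.lt_iff_lt hw (Ioo_subset_Icc_self hv)).1 hy.2⟩, rfl⟩
    rw [h.map_zero]
    exact hy.1

theorem comp (hV : IsGaugeMap L V) (hW : IsGaugeMap L W) (hL : 0 < L) :
    IsGaugeMap L (V ∘ W) ∧ ∀ v ∈ Icc 0 L, derivWithin (V ∘ W) (Icc 0 L) v =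
      derivWithin V (Icc 0 L) (W v) * derivWithin W (Icc 0 L) v := by
  have hd : ∀ v ∈ Icc 0 L, derivWithin (V ∘ W) (Icc 0 L) v =
      derivWithin V (Icc 0 L) (W v) * derivWithin W (Icc 0 L) v := fun v hv =>
    ((hV.hasDerivWithinAt (hW.mapsTo_Icc hv)).comp v (hW.hasDerivWithinAt hv)
      hW.mapsTo_Icc).derivWithin (uniqueDiffOn_Icc hL v hv)
  refine ⟨⟨hV.smooth.comp hW.smooth hW.mapsTo_Icc, fun v hv => ?_, ?_, ?_⟩, hd⟩
  · rw [hd v hv]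
    exact mul_pos (hV.deriv_pos _ (hW.mapsTo_Icc hv)) (hW.deriv_pos v hv)
  · simp [hW.map_zero, hV.map_zero]
  · simp [hW.map_top, hV.map_top]

theorem exists_inverse (h : IsGaugeMap L V) (hL : 0 < L) :
    ∃ W, IsGaugeMap L W ∧ (∀ y ∈ Icc 0 L, V (W y) = y) ∧
      ∀ y ∈ Icc 0 L, derivWithin W (Icc 0 L) y = (derivWithin V (Icc 0 L) (W y))⁻¹ := by
  have hs := h.surjOn hL
  set W := Function.invFunOn V (Icc 0 L) with hW
  have hmaps : MapsTo W (Icc 0 L) (Icc 0 L) := hs.mapsTo_invFunOn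
  have hinv : ∀ y ∈ Icc 0 L, V (W y) = y := fun y hy => hs.rightInvOn_invFunOn hy
  have hinj := h.strictMonoOn.injOn
  -- A continuous injection on a compact interval is an embedding, so its inverse is continuous.
  have hcont : ContinuousOn W (Icc 0 L) := by
    have emb : IsEmbedding ((Icc 0 L).domRestrict V) :=
      (Continuous.isClosedEmbedding (continuousOn_iff_continuous_domRestrict.1 h.smooth.continuousOn)
        (injOn_iff_injective.1 hinj)).isEmbedding
    have hc : Continuous (hmaps.restrict W (Icc 0 L) (Icc 0 L)) := by
      rw [emb.continuous_iff]
      have : (Icc 0 L).domRestrict V ∘ hmaps.restrict W (Icc 0 L) (Icc 0 L) = Subtype.val := by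
        ext y
        exact hinv y y.2
      rw [this]
      exact continuous_subtype_val
    exact continuousOn_iff_continuous_domRestrict.2 (continuous_subtype_val.comp hc)
  have hderiv : ∀ y ∈ Icc 0 L,
      HasDerivWithinAt W (derivWithin V (Icc 0 L) (W y))⁻¹ (Icc 0 L) y := by
    intro y hy
    have hpos := h.deriv_pos (W y) (hmaps hy)
    have h1 := HasFDerivWithinAt.of_local_left_inverse (s := Icc 0 L) (t := Icc 0 L)
      (f' := ContinuousLinearEquiv.unitsEquivAut ℝ (Units.mk0 _ hpos.ne'))
      (tendsto_nhdsWithin_iff.2 ⟨hcont y hy, eventually_nhdsWithin_of_forall fun z hz => hmaps hz⟩)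
      ((h.hasDerivWithinAt (hmaps hy)).hasFDerivWithinAt.congr_fderiv (by ext; simp)) hy
      (eventually_nhdsWithin_of_forall hinv)
    rw [hasDerivWithinAt_iff_hasFDerivWithinAt]
    refine h1.congr_fderiv ?_
    ext
    simp
  have hd : ∀ y ∈ Icc 0 L, derivWithin W (Icc 0 L) y = (derivWithin V (Icc 0 L) (W y))⁻¹ :=
    fun y hy => (hderiv y hy).derivWithin (uniqueDiffOn_Icc hL y hy)
  have hV' : ContDiffOn ℝ ∞ (derivWithin V (Icc 0 L)) (Icc 0 L) :=
    h.smooth.derivWithin (uniqueDiffOn_Icc hL) (by simp)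
  -- Bootstrap: `W' = 1 / (V' ∘ W)` has the regularity of `W`, so each round gains one derivative.
  have hsm : ∀ n : ℕ, ContDiffOn ℝ n W (Icc 0 L) := by
    intro n
    induction n with
    | zero => exact contDiffOn_zero.2 hcont
    | succ n ih =>
      rw [Nat.cast_add, Nat.cast_one, contDiffOn_succ_iff_derivWithin (uniqueDiffOn_Icc hL)]
      refine ⟨fun y hy => (hderiv y hy).differentiableWithinAt, by simp, ?_⟩
      refine ContDiffOn.congr ?_ hd
      exact ((hV'.of_le (by exact_mod_cast le_top)).comp ih hmaps).inv
        fun y hy => (h.deriv_pos _ (hmaps hy)).ne'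
  refine ⟨W, ⟨contDiffOn_infty.2 hsm, fun y hy => ?_, ?_, ?_⟩, hinv, hd⟩
  · rw [hd y hy]
    exact inv_pos.2 (h.deriv_pos _ (hmaps hy))
  · refine hinj (hmaps (left_mem_Icc.2 hL.le)) (left_mem_Icc.2 hL.le) ?_
    rw [hinv 0 (left_mem_Icc.2 hL.le), h.map_zero]
  · refine hinj (hmaps (right_mem_Icc.2 hL.le)) (right_mem_Icc.2 hL.le) ?_
    rw [hinv L (right_mem_Icc.2 hL.le), h.map_top]

theorem eq_id_of_deriv_eq (h : IsGaugeMap L V) (hL : 0 < L)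
    (hd : ∀ v ∈ Ioo 0 L, derivWithin V (Icc 0 L) v = derivWithin V (Icc 0 L) 0) :
    (∀ v ∈ Icc 0 L, V v = v) ∧ derivWithin V (Icc 0 L) 0 = 1 := by
  set c := derivWithin V (Icc 0 L) 0
  have hder : ∀ v ∈ Icc 0 L, HasDerivWithinAt (fun v => V v - c * v)
      (derivWithin V (Icc 0 L) v - c * 1) (Icc 0 L) v := fun v hv =>
    (h.hasDerivWithinAt hv).sub ((hasDerivWithinAt_id v _).const_mul c)
  have h1 : ∀ v ∈ Icc 0 L, V v - c * v = V 0 - c * 0 :=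
    constant_of_derivWithin_zero (fun v hv => (hder v hv).differentiableWithinAt) fun v hv => by
      rw [(hder v (Ico_subset_Icc_self hv)).derivWithin
        (uniqueDiffOn_Icc hL v (Ico_subset_Icc_self hv))]
      rcases hv.1.eq_or_lt with h0 | h0
      · rw [← h0]; ring
      · rw [hd v ⟨h0, hv.2⟩]; ring
  have h2 := h1 L (right_mem_Icc.2 hL.le)
  rw [h.map_top, h.map_zero] at h2
  have hc : c = 1 := by
    have : L * (1 - c) = 0 := by linarith
    rcases mul_eq_zero.1 this with h3 | h3
    · exact absurd h3 hL.ne'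
    · linarith
  refine ⟨fun v hv => ?_, hc⟩
  have h3 := h1 v hv
  rw [h.map_zero, hc] at h3
  linarith

end IsGaugeMap

namespace InitialData

variable {Λ v : ℝ} {V W : ℝ → ℝ} {S S' S'' : InitialData}

namespace IsGaugeTransformation

theorem isGaugeMap (h : S.IsGaugeTransformation Λ V S') : IsGaugeMap (vInf Λ) V :=
  ⟨h.smooth, h.deriv_pos, h.map_axis, h.map_infinity⟩

theorem trans (h : S.IsGaugeTransformation Λ W S') (h' : S'.IsGaugeTransformation Λ V S'')
    (hL : 0 < vInf Λ) : S.IsGaugeTransformation Λ (V ∘ W) S'' := by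
  have hW := h.isGaugeMap
  obtain ⟨hVW, hd⟩ := h'.isGaugeMap.comp hW hL
  have h0 : (0 : ℝ) ∈ Icc 0 (vInf Λ) := left_mem_Icc.2 hL.le
  refine ⟨hVW.smooth, hVW.deriv_pos, hVW.map_zero, hVW.map_top, fun v hv => ?_, fun v hv => ?_,
    fun v hv p hp l hl => ?_⟩
  · rw [Function.comp, h'.r_eq _ (hW.mapsTo_Ico hv), h.r_eq v hv]
  · rw [hd 0 h0, hd v (Ico_subset_Icc_self hv), Function.comp, h'.Ω2_eq _ (hW.mapsTo_Ico hv),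
      h.Ω2_eq v hv, hW.map_zero]
    simp only [one_div, mul_inv]
    ring
  · rw [hd 0 h0, hW.map_zero, mul_assoc, Function.comp, h'.f_eq _ (hW.mapsTo_Ioo hv) _ _ l hl,
      h.f_eq v hv p hp l hl]
    exact mul_nonneg (hW.deriv_pos 0 h0).le hp

theorem exists_symm (h : S.IsGaugeTransformation Λ V S') (hL : 0 < vInf Λ) :
    ∃ W, S'.IsGaugeTransformation Λ W S := by
  obtain ⟨W, hW, hVW, hd⟩ := h.isGaugeMap.exists_inverse hL
  have h0 : (0 : ℝ) ∈ Icc 0 (vInf Λ) := left_mem_Icc.2 hL.le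
  refine ⟨W, hW.smooth, hW.deriv_pos, hW.map_zero, hW.map_top, fun v hv => ?_, fun v hv => ?_,
    fun v hv p hp l hl => ?_⟩
  · rw [← h.r_eq _ (hW.mapsTo_Ico hv), hVW v (Ico_subset_Icc_self hv)]
  · have h1 := h.Ω2_eq _ (hW.mapsTo_Ico hv)
    have hp0 := h.deriv_pos 0 h0
    have hp1 := h.deriv_pos (W v) (hW.mapsTo_Icc (Ico_subset_Icc_self hv))
    rw [hVW v (Ico_subset_Icc_self hv)] at h1
    rw [hd 0 h0, hd v (Ico_subset_Icc_self hv), hW.map_zero, h1]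
    field_simp
  · have hp0 := h.deriv_pos 0 h0
    have h1 := h.f_eq _ (hW.mapsTo_Ioo hv) ((derivWithin V (Icc 0 (vInf Λ)) 0)⁻¹ * p)
      (mul_nonneg (inv_nonneg.2 hp0.le) hp) l hl
    rw [hVW v (Ioo_subset_Icc_self hv), mul_inv_cancel_left₀ hp0.ne'] at h1
    rw [hd 0 h0, hW.map_zero, h1]

theorem deriv_r_eq (h : S.IsGaugeTransformation Λ V S') (hv : v ∈ Ioo 0 (vInf Λ))
    (hr : DifferentiableAt ℝ S.r v) :
    deriv S'.r (V v) = deriv S.r v / derivWithin V (Icc 0 (vInf Λ)) v := by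
  have hL : 0 < vInf Λ := hv.1.trans hv.2
  have hV := h.isGaugeMap
  obtain ⟨W, hW, hVW, hd⟩ := hV.exists_inverse hL
  have hVv := hV.mapsTo_Ioo hv
  have hWV : W (V v) = v := hV.strictMonoOn.injOn (hW.mapsTo_Icc (Ioo_subset_Icc_self hVv))
    (Ioo_subset_Icc_self hv) (hVW _ (Ioo_subset_Icc_self hVv))
  have h1 : HasDerivAt (S.r ∘ W) (deriv S.r v * (derivWithin V (Icc 0 (vInf Λ)) v)⁻¹) (V v) := by
    have h2 := hW.hasDerivAt hVv
    rw [hd _ (Ioo_subset_Icc_self hVv), hWV] at h2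
    refine HasDerivAt.comp (V v) ?_ h2
    rw [hWV]
    exact hr.hasDerivAt
  rw [div_eq_mul_inv]
  refine (h1.congr_of_eventuallyEq ?_).deriv
  filter_upwards [isOpen_Ioo.mem_nhds hVv] with y hy
  rw [Function.comp, ← h.r_eq _ (Ioo_subset_Ico_self (hW.mapsTo_Ioo hy)),
    hVW y (Ioo_subset_Icc_self hy)]

theorem Tuv_eq (h : S.IsGaugeTransformation Λ V S') (hv : v ∈ Ioo 0 (vInf Λ)) :
    S'.Tuv (V v) = S.Tuv v /
      (derivWithin V (Icc 0 (vInf Λ)) 0 * derivWithin V (Icc 0 (vInf Λ)) v) := by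
  have hL : 0 < vInf Λ := hv.1.trans hv.2
  have hc := h.deriv_pos 0 (left_mem_Icc.2 hL.le)
  have hd := h.deriv_pos v (Ioo_subset_Icc_self hv)
  rw [Tuv, Tuv, h.r_eq v (Ioo_subset_Ico_self hv), h.Ω2_eq v (Ioo_subset_Ico_self hv),
    mul_div_assoc, ← integral_div]
  congr 1
  refine setIntegral_congr_fun measurableSet_Ioi fun l hl => ?_
  have hl0 : 0 < l := hl
  set c := derivWithin V (Icc 0 (vInf Λ)) 0
  set d := derivWithin V (Icc 0 (vInf Λ)) v
  have h1 := integral_comp_mul_left_Ioi (fun p => 1 / (c * d) * S.Ω2 v * p *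
    (l ^ 2 / (S.r v ^ 2 * p)) * S'.f (V v) p l * p⁻¹ * l) 0 hc
  rw [mul_zero, smul_eq_mul, eq_comm, inv_mul_eq_iff_eq_mul₀ hc.ne'] at h1
  rw [h1, ← integral_const_mul, ← integral_div]
  refine setIntegral_congr_fun measurableSet_Ioi fun p hp => ?_
  have hp0 : 0 < p := hp
  rw [h.f_eq v hv p hp0.le l hl0.le]
  -- Positivity of `r` is not assumed here; for `r = 0` both integrands vanish by the convention on
  -- division by zero.
  by_cases hr : S.r v = 0
  · simp [hr]
  · field_simp

theorem dur_eq (h : S.IsGaugeTransformation Λ V S') (hv : v ∈ Ioo 0 (vInf Λ)) :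
    S'.dur Λ (V v) = S.dur Λ v / derivWithin V (Icc 0 (vInf Λ)) 0 := by
  have hL : 0 < vInf Λ := hv.1.trans hv.2
  have hV := h.isGaugeMap
  have hc := h.deriv_pos 0 (left_mem_Icc.2 hL.le)
  rw [dur, dur, h.r_eq v (Ioo_subset_Ico_self hv), mul_div_assoc,
    intervalIntegral.integral_of_le hv.1.le, intervalIntegral.integral_of_le (hV.mapsTo_Ioo hv).1.le,
    integral_Ioc_eq_integral_Ioo, integral_Ioc_eq_integral_Ioo, ← hV.image_Ioo hv, ← integral_div]
  congr 1
  have hsub : Ioo 0 v ⊆ Ioo 0 (vInf Λ) := Ioo_subset_Ioo_right hv.2.le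
  rw [integral_image_eq_integral_abs_deriv_smul measurableSet_Ioo
    (fun w hw => (hV.hasDerivAt (hsub hw)).hasDerivWithinAt)
    (hV.strictMonoOn.injOn.mono (hsub.trans Ioo_subset_Icc_self))]
  refine setIntegral_congr_fun measurableSet_Ioo fun w hw => ?_
  have hw' := hsub hw
  have hd := h.deriv_pos w (Ioo_subset_Icc_self hw')
  rw [abs_of_pos hd, smul_eq_mul, h.r_eq w (Ioo_subset_Ico_self hw'),
    h.Ω2_eq w (Ioo_subset_Ico_self hw'), h.Tuv_eq hw']
  field_simp

/-- With `c = V'(0)` and `d = V'(v)`, the factor `c d` gained by `Ω⁻²` cancels the losses `1 / c` of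
`∂_u r` and `1 / d` of `∂_v r`. -/
theorem renMass_eq (h : S.IsGaugeTransformation Λ V S') (hv : v ∈ Ioo 0 (vInf Λ))
    (hr : DifferentiableAt ℝ S.r v) : S'.renMass Λ (V v) = S.renMass Λ v := by
  have hL : 0 < vInf Λ := hv.1.trans hv.2
  have hc := h.deriv_pos 0 (left_mem_Icc.2 hL.le)
  have hd := h.deriv_pos v (Ioo_subset_Icc_self hv)
  rw [renMass, renMass, hawkingMass, hawkingMass, h.dur_eq hv, h.deriv_r_eq hv hr,
    h.r_eq v (Ioo_subset_Ico_self hv), h.Ω2_eq v (Ioo_subset_Ico_self hv)]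
  congr 3
  rw [one_div, mul_inv, inv_inv]
  field_simp

theorem tendsto_renMass (h : S.IsGaugeTransformation Λ V S') {v₀ M : ℝ}
    (hv₀ : v₀ ∈ Ioo 0 (vInf Λ)) (hr : ∀ v ∈ Ioo 0 (vInf Λ), DifferentiableAt ℝ S.r v)
    (hM : ∀ v ∈ Ico v₀ (vInf Λ), S.renMass Λ v = M) :
    Tendsto (S'.renMass Λ) (𝓝[<] (vInf Λ)) (𝓝 M) := by
  have hL : 0 < vInf Λ := hv₀.1.trans hv₀.2
  have hV := h.isGaugeMap
  have hVv := hV.mapsTo_Ioo hv₀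
  refine tendsto_const_nhds.congr' ?_
  filter_upwards [Ioo_mem_nhdsLT hVv.2] with y hy
  obtain ⟨w, hw, rfl⟩ := hV.surjOn hL ⟨(hVv.1.trans hy.1).le, hy.2.le⟩
  have h1 := (hV.strictMonoOn.lt_iff_lt (Ioo_subset_Icc_self hv₀) hw).1 hy.1
  have h2 : w < vInf Λ := by
    refine (hV.strictMonoOn.lt_iff_lt hw (right_mem_Icc.2 hL.le)).1 ?_
    rw [hV.map_top]
    exact hy.2
  have hw' : w ∈ Ioo 0 (vInf Λ) := ⟨hv₀.1.trans h1, h2⟩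
  rw [h.renMass_eq hw' (hr w hw'), hM w ⟨h1.le, h2⟩]

/-- A gauge transformation between gauge normalised data sets is trivial. -/
theorem f_eq_of_isGaugeNormalised (h : S.IsGaugeTransformation Λ V S') (hΛ : Λ ≤ 0)
    (hL : 0 < vInf Λ) (hr : ∀ v ∈ Ioo 0 (vInf Λ), DifferentiableAt ℝ S.r v)
    (hr' : ∀ v ∈ Ioo 0 (vInf Λ), 0 < deriv S.r v)
    (hS : S.IsGaugeNormalised Λ) (hS' : S'.IsGaugeNormalised Λ) :
    ∀ v ∈ Ioo 0 (vInf Λ), ∀ p ≥ 0, ∀ l ≥ 0, S'.f v p l = S.f v p l := by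
  have hV := h.isGaugeMap
  have hc := h.deriv_pos 0 (left_mem_Icc.2 hL.le)
  -- Comparing the two normalisation conditions gives `V'(v) = V'(0)`. Thus `V` is linear, and since
  -- it fixes both end points it is the identity.
  obtain ⟨h1, h2⟩ := hV.eq_id_of_deriv_eq hL fun v hv => by
    have hd := h.deriv_pos v (Ioo_subset_Icc_self hv)
    have e1 := hS v hv
    have e2 := hS' (V v) (hV.mapsTo_Ioo hv)
    rw [h.deriv_r_eq hv (hr v hv), h.r_eq v (Ioo_subset_Ico_self hv),
      h.Ω2_eq v (Ioo_subset_Ico_self hv)] at e2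
    have hD := hr' v hv
    have hE : 0 < 1 - 1 / 3 * Λ * S.r v ^ 2 := by nlinarith [sq_nonneg (S.r v)]
    set D := deriv S.r v
    set E := 1 - 1 / 3 * Λ * S.r v ^ 2
    set c := derivWithin V (Icc 0 (vInf Λ)) 0
    set d := derivWithin V (Icc 0 (vInf Λ)) v
    have e3 : S.Ω2 v = 4 * D * (D / E) := by rw [e1]; field_simp
    rw [e3] at e2
    field_simp at e2
    linarith
  intro v hv p hp l hl
  have h3 := h.f_eq v hv p hp l hl
  rwa [h2, one_mul, h1 v (Ioo_subset_Icc_self hv)] at h3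

end IsGaugeTransformation

end InitialData

/-! ### Dependence of the norm on the Vlasov data -/

section Congruence

variable {Λ : ℝ}

theorem freeVlasov_congr {f g : ℝ → ℝ → ℝ → ℝ}
    (h : ∀ v ∈ Ioo 0 (vInf Λ), ∀ p ≥ 0, ∀ l ≥ 0, f v p l = g v p l) {u v p l : ℝ} (hl : 0 < l) :
    freeVlasov Λ f u v p l = freeVlasov Λ g u v p l := by
  unfold freeVlasov
  refine iSup_congr fun v₀ => iSup_congr fun p₀ => iSup_congr fun hv₀ => iSup_congr fun hp₀ => ?_
  rw [h v₀ hv₀ p₀ hp₀.le l hl.le]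

theorem TAdS_congr {f g : ℝ → ℝ → ℝ → ℝ → ℝ≥0∞} (w : ℝ → ℝ → ℝ)
    (h : ∀ u v p l, 0 < l → f u v p l = g u v p l) : TAdS Λ w f = TAdS Λ w g := by
  funext u v
  unfold TAdS
  congr 1
  refine setLIntegral_congr_fun measurableSet_Ioi fun l hl => ?_
  simp only [h u v _ l hl]

theorem outgoingPart_congr {f g : ℝ → ℝ → ℝ → ℝ → ℝ≥0∞}
    (h : ∀ u v p l, 0 < l → f u v p l = g u v p l) : outgoingPart Λ f = outgoingPart Λ g := by
  simp only [outgoingPart, TvvAdS, TuvAdS, TAdS_congr _ h]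

theorem ingoingPart_congr {f g : ℝ → ℝ → ℝ → ℝ → ℝ≥0∞}
    (h : ∀ u v p l, 0 < l → f u v p l = g u v p l) : ingoingPart Λ f = ingoingPart Λ g := by
  simp only [ingoingPart, TuuAdS, TuvAdS, TAdS_congr _ h]

end Congruence

/-- The norm, read off from one gauge normalised form of the data. -/
theorem isInitialDataNorm_iff {Λ M : ℝ} {W : ℝ → ℝ} {S S' : InitialData} (hΛ : Λ ≤ 0)
    (hL : 0 < vInf Λ) (hS' : S'.IsAsymptoticallyAdS Λ) (hn : S'.IsGaugeNormalised Λ)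
    (hW : S'.IsGaugeTransformation Λ W S)
    (hM : Tendsto (S.renMass Λ) (𝓝[<] (vInf Λ)) (𝓝 M)) (x : EReal) :
    IsInitialDataNorm Λ S x ↔
      x = ((outgoingPart Λ (freeVlasov Λ S'.f) + ingoingPart Λ (freeVlasov Λ S'.f) : ℝ≥0∞) : EReal)
        + ((√(-Λ) * M : ℝ) : EReal) := by
  constructor
  · rintro ⟨V, S'', M', hV, hn'', hM', rfl⟩
    -- The composition of the two transformations links two normalised forms of `S`, so these have
    -- the same Vlasov data; this makes the norm single valued.
    have hf := (hW.trans hV hL).f_eq_of_isGaugeNormalised hΛ hL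
      (fun v hv => (hS'.hasDerivAt_r hv).differentiableAt) (fun v hv => hS'.deriv_r_pos hv) hn hn''
    have hfree : ∀ u v p l, 0 < l → freeVlasov Λ S''.f u v p l = freeVlasov Λ S'.f u v p l :=
      fun u v p l hl => freeVlasov_congr hf hl
    have : (𝓝[<] (vInf Λ)).NeBot := inferInstance
    rw [outgoingPart_congr hfree, ingoingPart_congr hfree, tendsto_nhds_unique hM' hM]
  · rintro rfl
    obtain ⟨V, hV⟩ := hW.exists_symm hL
    exact ⟨V, S', M, hV, hn, hM, rfl⟩

/-! ### The norm of data launched by beams -/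

namespace InitialData

namespace IsBeamData

variable {k κ ε : ℝ} {χ : ℝ → ℝ} {a : ℕ → ℝ} {S : InitialData}

theorem deriv_r_mem (h : IsBeamData k κ ε χ a S) {v : ℝ}
    (hv : v ∈ Ioo (innerEdge k ε) (outerEdge k ε)) : deriv S.r v ∈ Icc (1 / 4) 17 := by
  have hsys := h.radialSystem
  have hk := h.k_pos
  have hm := hsys.vm_mem hk
  have hp := hsys.vp_mem hk
  have hv' : v ∈ Ioo 0 (vInf (-3 * k ^ 2)) := by
    rw [vInf_eq hk]
    exact ⟨hm.1.trans hv.1, hv.2.trans hp.2⟩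
  rw [deriv_r_eq h.adS h.gauge hv']
  exact hsys.deriv_r_mem hk ⟨hv'.1, hv.2.le⟩

/-- Where a seed function does not vanish, the null geodesic stays in the corresponding beam. -/
theorem inBeam_of_seed_ne_zero (h : IsBeamData k κ ε χ a S) {i : ℕ} {v₀ p₀ u v p l : ℝ}
    (hX : k * (v - u) / 2 ∈ Ioo 0 (π / 2)) (hp : 0 < p) (hl : 0 < l)
    (hr : Reaches (-3 * k ^ 2) l (shellPoint (-3 * k ^ 2) 0 v₀ p₀ l)
      (shellPoint (-3 * k ^ 2) u v p l))
    (hs : seed (-3 * k ^ 2) χ ε i v₀ (deriv S.r v₀ * p₀) l ≠ 0) :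
    InBeam 100000 (epsSeq ε i) (k * center (-3 * k ^ 2) ε i) k u v p l := by
  have hk := h.k_pos
  obtain ⟨h1, h2, h3⟩ := seed_ne_zero h.cutoff hs
  have he := epsSeq_pos h.small.eps_pos i
  have he1 := epsSeq_le_self h.small.eps_pos h.small.eps_le i
  obtain ⟨h4, h5⟩ := mem_of_cutoff_ne_zero hk h.small h1
  have hd := h.deriv_r_mem (h.mem_edges_iff.2 h5)
  have hpi := pi_gt_three
  have hε := h.eps_le
  have hρ := h.rho_inv_mul_le
  rw [abs_lt] at h2 h3
  have hd0 : 0 < deriv S.r v₀ := by linarith [hd.1]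
  -- The seed requires `1 < ∂_v r p₀ < 5`, and `∂_v r` lies in `[1/4, 17]` on the beams.
  have hp₀ : p₀ ∈ Icc (1 / 17) 20 := by
    have hpos : 0 < p₀ := by
      by_contra hc
      push Not at hc
      nlinarith [mul_nonneg_of_nonpos_of_nonpos hc (neg_nonpos.2 hd0.le)]
    constructor
    · nlinarith [hd.2]
    · nlinarith [hd.1]
  rw [sqrt_neg_Λ hk, lt_sub_iff_add_lt, sub_lt_iff_lt_add, lt_div_iff₀ he, div_lt_iff₀ he] at h3
  have hkl : 0 < k * l := mul_pos hk hl
  have s1 := one_le_sqrt_three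
  have s2 := sqrt_three_le_two
  refine inBeam_of_reaches hk he (by linarith [h.small.eps_le]) hX hp hl
    ⟨by linarith [h5.1], by linarith [h5.2]⟩ hp₀ h4 ?_ ?_ hr
  -- The cutoff gives `2 e < √3 k l < 6 e` with `e` the width of the beam; `√3 ≤ 2` and `√3 ≥ 3 / 2`
  -- turn this into `e ≤ k l ≤ 4 e`.
  · nlinarith [h3.1]
  · have e : √3 * √3 = 3 := mul_self_sqrt (by norm_num)
    have : 3 / 2 ≤ √3 := by nlinarith
    nlinarith [h3.2]

/-- Every launch point in the supremum that defines the free field and at which a seed is nonzero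
leads to a point of the region `InBeam` of that seed, and cutoffs are at most one. The weights are
replaced by `max (a i) 0` because nonnegativity is known only for the indices that occur, while the
general estimates ask for it at all indices. -/
theorem beamBounded (h : IsBeamData k κ ε χ a S) :
    BeamBounded 100000 k (numBeams ε + 1) (fun i => max (a i) 0) (epsSeq ε)
      (fun i => k * center (-3 * k ^ 2) ε i) (freeVlasov (-3 * k ^ 2) S.f) := by
  intro u v p l hX hp hl
  refine iSup_le fun v₀ => iSup_le fun p₀ => iSup_le fun hv₀ => iSup_le fun hp₀ =>
    iSup_le fun hr => ?_
  rw [h.f_eq v₀ hv₀ p₀ hp₀.le l hl.le, totalSeed]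
  refine (ENNReal.ofReal_le_ofReal (q := ∑ i ∈ Finset.range (numBeams ε + 1),
    max (a i) 0 * seed (-3 * k ^ 2) χ ε i v₀ (deriv S.r v₀ * p₀) l) ?_).trans ?_
  · exact le_of_eq (Finset.sum_congr rfl fun i hi => by rw [max_eq_left (h.a_nonneg i hi)])
  have hseed : ∀ i, 0 ≤ seed (-3 * k ^ 2) χ ε i v₀ (deriv S.r v₀ * p₀) l := fun i =>
    mul_nonneg (mul_nonneg (mul_nonneg (by positivity) (h.cutoff.nonneg _)) (h.cutoff.nonneg _))
      (h.cutoff.nonneg _)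
  rw [ENNReal.ofReal_sum_of_nonneg fun i _ => mul_nonneg (le_max_right _ _) (hseed i)]
  refine Finset.sum_le_sum fun i _ => ?_
  by_cases hs : seed (-3 * k ^ 2) χ ε i v₀ (deriv S.r v₀ * p₀) l = 0
  · rw [hs, mul_zero, ENNReal.ofReal_zero]
    exact zero_le
  rw [if_pos (h.inBeam_of_seed_ne_zero hX hp hl hr hs)]
  refine ENNReal.ofReal_le_ofReal ?_
  rw [div_eq_mul_one_div]
  refine mul_le_mul_of_nonneg_left ?_ (le_max_right _ _)
  have he : 0 ≤ 1 / epsSeq ε i ^ 2 := by positivity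
  calc seed (-3 * k ^ 2) χ ε i v₀ (deriv S.r v₀ * p₀) l
      ≤ 1 / epsSeq ε i ^ 2 * 1 * 1 * 1 := by
        unfold seed
        gcongr
        all_goals first
          | exact h.cutoff.nonneg _
          | exact h.cutoff.le_one _
    _ = 1 / epsSeq ε i ^ 2 := by ring

theorem sum_damping_le (h : IsBeamData k κ ε χ a S) {K : ℝ} (hK : 2 ≤ K) (φ : ℝ) :
    ∑ i ∈ Finset.range (numBeams ε + 1), max (a i) 0 *
      damping K (epsSeq ε i) (φ - k * center (-3 * k ^ 2) ε i) ≤ 8 * K * (9 * sigma ε) := by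
  have he := epsSeq_pos h.small.eps_pos
  have hK0 : 0 < K := by linarith
  have h1 := sum_weights_le h.k_pos h.small (h.κ_le.trans (by norm_num)) h.a_mem h.a_sum φ
    (fun i => damping_div_le_one hK (he i) (φ - k * center (-3 * k ^ 2) ε i))
    (fun i => damping_div_mul_le hK (he i) _)
  refine le_trans (le_of_eq ?_) (mul_le_mul_of_nonneg_left h1 (by positivity : 0 ≤ 8 * K))
  rw [Finset.mul_sum]
  refine Finset.sum_congr rfl fun i hi => ?_
  rw [max_eq_left (h.a_nonneg i hi)]
  field_simp

/-- The part of the norm that measures the free Vlasov field. -/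
theorem freeVlasov_part_le (h : IsBeamData k κ ε χ a S) :
    outgoingPart (-3 * k ^ 2) (freeVlasov (-3 * k ^ 2) S.f) +
      ingoingPart (-3 * k ^ 2) (freeVlasov (-3 * k ^ 2) S.f) ≤
      ENNReal.ofReal (2 * (400 * π * 100000 ^ 9 / k ^ 2 * (8 * 100000 * (9 * sigma ε)))) := by
  have hk := h.k_pos
  have hσ := h.small.sigma_pos
  have he := epsSeq_pos h.small.eps_pos
  have h1 := outgoingPart_le hk (by norm_num) (fun i => le_max_right (a i) 0) he h.beamBounded
    (h.sum_damping_le (by norm_num))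
  have h2 := ingoingPart_le hk (by norm_num) (fun i => le_max_right (a i) 0) he h.beamBounded
    (h.sum_damping_le (by norm_num))
  rw [two_mul, ENNReal.ofReal_add (by positivity) (by positivity)]
  exact add_le_add h1 h2

end IsBeamData

end InitialData

/-- The constant of the norm bound. -/
def normConst (k κ : ℝ) : ℝ :=
  2 * (400 * π * 100000 ^ 9 / k ^ 2 * (8 * 100000 * 9)) +
    √(-(-3 * k ^ 2)) * (1200000000 * κ / k ^ 3)

theorem InitialData.IsBeamData.exists_norm {k κ ε : ℝ} {χ : ℝ → ℝ} {a : ℕ → ℝ} {S S' : InitialData}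
    {W : ℝ → ℝ} (h : IsBeamData k κ ε χ a S') (hW : S'.IsGaugeTransformation (-3 * k ^ 2) W S) :
    ∃ N : ℝ, 0 ≤ N ∧ N ≤ normConst k κ * sigma ε ∧
      ∀ x : EReal, IsInitialDataNorm (-3 * k ^ 2) S x ↔ x = (N : EReal) := by
  have hk := h.k_pos
  have hσ := h.small.sigma_pos
  have hL : 0 < vInf (-3 * k ^ 2) := by rw [vInf_eq hk]; positivity
  have hp := h.radialSystem.vp_mem hk
  rw [← vInf_eq hk] at hp
  obtain ⟨M, hM, hMeq⟩ := h.exists_mass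
  have hT := hW.tendsto_renMass hp (fun v hv => (h.adS.hasDerivAt_r hv).differentiableAt) hMeq
  have hle := h.freeVlasov_part_le
  set Z := outgoingPart (-3 * k ^ 2) (freeVlasov (-3 * k ^ 2) S'.f) +
      ingoingPart (-3 * k ^ 2) (freeVlasov (-3 * k ^ 2) S'.f) with hZ
  have hfin : Z ≠ ⊤ := (hle.trans_lt ENNReal.ofReal_lt_top).ne
  refine ⟨Z.toReal + √(-(-3 * k ^ 2)) * M, ?_, ?_, fun x => ?_⟩
  · have := hM.1
    positivity
  · have h1 := ENNReal.toReal_le_of_le_ofReal (by positivity) hle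
    have h2 : √(-(-3 * k ^ 2)) * M ≤ √(-(-3 * k ^ 2)) * (1200000000 * κ / k ^ 3 * sigma ε) :=
      mul_le_mul_of_nonneg_left hM.2 (sqrt_nonneg _)
    rw [normConst]
    linarith
  · rw [isInitialDataNorm_iff (by nlinarith [sq_nonneg k]) hL h.adS h.gauge hW hT, ← hZ,
      EReal.coe_add, EReal.coe_ennreal_toReal hfin]

end AdSVlasov

end

/-! ### Choice of the constants and conclusion -/

theorem mainTheorem7 (Λ : ℝ) (hΛ : Λ < 0) :
    ∃ ε₀ ∈ Set.Ioo (0 : ℝ) 1, ∃ C > (0 : ℝ), ∀ ε₁ ∈ Set.Ioc 0 ε₀,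
      ∀ (χ : ℝ → ℝ) (a : ℝ → ℕ → ℝ) (𝒮 : ℝ → AdSVlasov.InitialData),
        AdSVlasov.IsCutoff χ → AdSVlasov.IsWeightFamily ε₁ a →
        AdSVlasov.IsInitialDataFamily Λ ε₁ χ a 𝒮 →
        ∃ N : ℝ → ℝ,
          (∀ ε ∈ Set.Ioc (0 : ℝ) 1, ∀ x : EReal,
            AdSVlasov.IsInitialDataNorm Λ (𝒮 ε) x ↔ x = (N ε : EReal)) ∧
          (∀ ε ∈ Set.Ioo (0 : ℝ) 1, N ε ≤ C * AdSVlasov.sigmaTrunc ε₁ ε) ∧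
          Filter.Tendsto N (nhdsWithin 0 (Set.Ioi 0)) (nhds 0) := by
  obtain ⟨k, hk, rfl⟩ : ∃ k : ℝ, 0 < k ∧ Λ = -3 * k ^ 2 := by
    refine ⟨√(-Λ / 3), sqrt_pos.2 (by linarith), ?_⟩
    rw [sq_sqrt (by linarith)]
    ring
  -- The threshold depends on `k` alone, hence so do `ε₀` and the constant: the smallness of the
  -- source in `RadialSystem` scales like `k²`.
  set κ := min (1 / 20) (k ^ 2 / 2000000) with hκ
  have hκ0 : 0 < κ := lt_min (by norm_num) (by positivity)
  have hκ1 : κ ≤ 1 / 20 := min_le_left _ _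
  have hκ2 : 2000000 * κ ≤ k ^ 2 := by
    have := min_le_right (1 / 20) (k ^ 2 / 2000000)
    linarith
  obtain ⟨ε₀, hε₀, hsmall⟩ := AdSVlasov.exists_small hκ0
  have hC : 0 < AdSVlasov.normConst k κ := by
    unfold AdSVlasov.normConst
    positivity
  refine ⟨ε₀, hε₀, AdSVlasov.normConst k κ, hC, fun ε₁ hε₁ χ a 𝒮 hχ ha h𝒮 => ?_⟩
  have key : ∀ ε ∈ Ioc 0 ε₁, ∃ N : ℝ, 0 ≤ N ∧ N ≤ AdSVlasov.normConst k κ * AdSVlasov.sigma ε ∧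
      ∀ x : EReal, AdSVlasov.IsInitialDataNorm (-3 * k ^ 2) (𝒮 ε) x ↔ x = (N : EReal) := by
    intro ε hε
    obtain ⟨W, S', hS', hn, hf, hW⟩ := h𝒮.small ε hε
    refine AdSVlasov.InitialData.IsBeamData.exists_norm (χ := χ) (a := a ε) (S' := S') (W := W)
      ⟨hk, hsmall ε ⟨hε.1, hε.2.trans hε₁.2⟩, hκ1, hκ2, hχ, fun i hi => ?_, ha.sum_le ε hε, hS', hn,
        hf⟩ hW
    exact Ioo_subset_Icc_self (ha.mem ε hε i (Nat.lt_succ_iff.1 (Finset.mem_range.1 hi)))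
  have key' : ∀ ε : ℝ, ∃ N : ℝ, ε ∈ Ioc (0 : ℝ) 1 →
      0 ≤ N ∧ N ≤ AdSVlasov.normConst k κ * AdSVlasov.sigmaTrunc ε₁ ε ∧
      ∀ x : EReal, AdSVlasov.IsInitialDataNorm (-3 * k ^ 2) (𝒮 ε) x ↔ x = (N : EReal) := by
    intro ε
    by_cases hε : ε ∈ Ioc (0 : ℝ) 1
    · rcases le_or_gt ε ε₁ with h | h
      · obtain ⟨N, hN⟩ := key ε ⟨hε.1, h⟩
        refine ⟨N, fun _ => ?_⟩
        rwa [AdSVlasov.sigmaTrunc, min_eq_left h]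
      · obtain ⟨N, hN⟩ := key ε₁ ⟨hε₁.1, le_rfl⟩
        refine ⟨N, fun _ => ?_⟩
        rwa [AdSVlasov.sigmaTrunc, min_eq_right h.le, h𝒮.large ε ⟨h, hε.2⟩]
    · exact ⟨0, fun h => absurd h hε⟩
  choose N hN using key'
  refine ⟨N, fun ε hε => (hN ε hε).2.2, fun ε hε => (hN ε (Ioo_subset_Ioc_self hε)).2.1, ?_⟩
  have hσ : Tendsto (fun ε => AdSVlasov.normConst k κ * AdSVlasov.sigma ε) (𝓝[>] 0) (𝓝 0) := by
    simpa using (tendsto_nhdsWithin_iff.1 AdSVlasov.tendsto_sigma).1.const_mul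
      (AdSVlasov.normConst k κ)
  have hε₁1 : ε₁ ≤ 1 := hε₁.2.trans hε₀.2.le
  -- The lower bound `0 ≤ N` needs the mass to be nonnegative, which the sign of the matter terms
  -- guarantees.
  refine tendsto_of_tendsto_of_tendsto_of_le_of_le' tendsto_const_nhds hσ ?_ ?_
  · filter_upwards [Ioc_mem_nhdsGT hε₁.1] with ε hε
    exact (hN ε ⟨hε.1, hε.2.trans hε₁1⟩).1
  · filter_upwards [Ioc_mem_nhdsGT hε₁.1] with ε hε
    have h := (hN ε ⟨hε.1, hε.2.trans hε₁1⟩).2.1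
    rwa [AdSVlasov.sigmaTrunc, min_eq_left hε.2] at h
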